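/- Let $m\ge 1$. Consider the pencil $L$ given by $$Y''+(\rho^2I+2i\rho Q_1(x)+Q_0(x))Y=0,\quad x\in(0,\pi),$$ $$U(Y):=Y'(0)+(i\rho h_1+h_0)Y(0)=0,\qquad V(Y):=Y'(\pi)+(i\rho H_1+H_0)Y(\pi)=0,$$ where $Y$ is a column vector of length $m$, $\rho$ is the spectral parameter, $Q_0,Q_1$ are $m\times m$ complex matrix functions on $[0,\pi]$, the entries of $Q_0$ are in $L_1[0,\pi]$, those of $Q_1$ are absolutely continuous (i.e. in $W_1^1[0,\pi]$), and $h_0,h_1,H_0,H_1\in\mathbb C^{m\times m}$. Assume (I) $\det(I\pm h_1)\ne0$, $\det(I\pm H_1)\neq 0$; (II) $Q_1^\dagger=-Q_1$ and $Q_0^\dagger=Q_0$ a.e. on $[0,\pi]$, $h_1^\dagger=-h_1$, $H_1^\dagger=-H_1$, $h_0^\dagger=h_0$, $H_0^\dagger=H_0$ ($\dagger$ is the conjugate transpose). Let $\varphi(x,\rho)$ be the matrix solution of the equation with $\varphi(0,\rho)=I$, $U(\varphi)=0$; let $\Phi(x,\rho)$ be the matrix solution with $U(\Phi)=I$, $V(\Phi)=0$,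 and let $M(\rho):=\Phi(0,\rho)$ be the Weyl matrix. The multiplicity of an eigenvalue is its order as a zero of $\det V(\varphi(\cdot,\rho))$. Let $P_\pm$ solve $P_\pm'=\pm Q_1P_\pm$, $P_\pm(0)=I$, and put $$A:=P_-^{-1}(\pi)(I+H_1)^{-1}(I-H_1)P_+(\pi)(I+h_1)(I-h_1)^{-1}.$$ Let $w:=\{\pm0,\pm1,\pm2,\dots\}$, where $+0$ and $-0$ are two different indices with the value $0$. Then the set of eigenvalues of $L$ is countably infinite; the eigenvalues are exactly the zeros of the entire function $\det V(\varphi(\cdot,\rho))$; $M$ is meromorphic in $\mathbb C$ and its poles are exactly the eigenvalues of $L$. Moreover, there are numbers $\omega_1,\dots,\omega_m\in[0,1)$ and a unitary matrix $W\in\mathbb C^{m\times m}$ with $A=W^\dagger\operatorname{diag}(e^{2\pi i\omega_1},\dots,e^{2\pi i\omega_m})W$ such that the following holds. (i) All the eigenvalues, counted with multiplicities, can be numbered as $\rho_{nq}$, $n\in w$, $q=1,\dots,m$, so that $\rho_{nq}=n+\omega_q+O(1/n)$ as $|n|\to\infty$. For every such numbering there is $N\ge1$ such that: (ii) the eigenvalues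 $\rho_{nq}$ with $|n|\ge N$ are real; (iii) the poles of $M$ at $\rho_{nq}$ with $|n|\ge N$ are simple; (iv) for $|n|\ge N$ the weight matrices $\alpha_{nq}:=\operatorname{Res}_{\rho=\rho_{nq}}M(\rho)$ satisfy $\operatorname{rank}\alpha_{nq}=m_{nq}$, where $m_{nq}$ is the multiplicity of $\rho_{nq}$, and, as $|n|\to\infty$, for $q=1,\dots,m$, $$\sum_{s\in J_q}\frac{\alpha_{ns}}{m_{ns}}=\frac1{\pi n}(I-h_1)^{-1}W^\dagger I_qW(I+h_1)^{-1}+O(n^{-2}),$$ where $J_q:=\{s:\omega_s=\omega_q\}$ and $I_q$ is the diagonal matrix whose $j$-th diagonal entry is $1$ if $j\in J_q$ and $0$ otherwise. -/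

import Mathlib

open Matrix MeasureTheory

noncomputable section

/-- Coefficients of the pencil
`Y'' + (ρ² I + 2 i ρ Q₁(x) + Q₀(x)) Y = 0` on `(0, π)`,
`Y'(0) + (i ρ h₁ + h₀) Y(0) = 0`, `Y'(π) + (i ρ H₁ + H₀) Y(π) = 0`,
where the entries of `Q₀` are in `L¹[0, π]` and those of `Q₁` are in `W₁¹[0, π]`
(i.e. absolutely continuous). -/
structure MatrixPencil (m : ℕ) where
  Q₀ : ℝ → Matrix (Fin m) (Fin m) ℂ
  Q₁ : ℝ → Matrix (Fin m) (Fin m) ℂ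
  h₀ : Matrix (Fin m) (Fin m) ℂ
  h₁ : Matrix (Fin m) (Fin m) ℂ
  H₀ : Matrix (Fin m) (Fin m) ℂ
  H₁ : Matrix (Fin m) (Fin m) ℂ
  integrable_Q₀ : ∀ j k, IntegrableOn (fun x => Q₀ x j k) (Set.Icc 0 Real.pi)
  absCont_Q₁ : ∀ j k, AbsolutelyContinuousOnInterval (fun x => Q₁ x j k) 0 Real.pi

/-- The residue `(2 π i)⁻¹ ∮_{|w - z| = r} f(w) dw`, for all small `r > 0`. -/
def residueAt (f : ℂ → ℂ) (z : ℂ) : ℂ :=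
  Filter.limUnder (nhdsWithin (0 : ℝ) (Set.Ioi 0))
    fun r => (2 * Real.pi * Complex.I)⁻¹ * ∮ w in C(z, r), f w

/-- The matrix-valued function `F` has a pole at `z`. -/
def HasMatrixPole {m : ℕ} (F : ℂ → Matrix (Fin m) (Fin m) ℂ) (z : ℂ) : Prop :=
  (∀ j k, MeromorphicAt (fun w => F w j k) z) ∧
    ∃ j k, meromorphicOrderAt (fun w => F w j k) z < 0

/-- The matrix-valued function `F` has a simple pole at `z`. -/
def HasSimpleMatrixPole {m : ℕ} (F : ℂ → Matrix (Fin m) (Fin m) ℂ) (z : ℂ) : Prop :=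
  HasMatrixPole F z ∧ ∀ j k, -1 ≤ meromorphicOrderAt (fun w => F w j k) z

/-- The index set `w = {±0, ±1, ±2, …}`, where `+0` and `-0` are different elements:
`Sum.inl n` is `+n` and `Sum.inr n` is `-n`. -/
abbrev SignedIndex : Type := ℕ ⊕ ℕ

/-- The integer value of an element of `w`. -/
def SignedIndex.val : SignedIndex → ℤ
  | Sum.inl n => (n : ℤ)
  | Sum.inr n => -(n : ℤ)

/-- `P` solves the Cauchy problem `P'(x) = Q(x) P(x)` on `[0, π]`, `P(0) = I`. -/
structure IsCauchySolution {m : ℕ} (Q P : ℝ → Matrix (Fin m) (Fin m) ℂ) : Prop where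
  hasDeriv : ∀ x ∈ Set.Icc 0 Real.pi, ∀ j k,
    HasDerivWithinAt (fun t => P t j k) ((Q x * P x) j k) (Set.Icc 0 Real.pi) x
  init : P 0 = 1

/-- The solution of `P'(x) = Q(x) P(x)`, `P(0) = I`
(it is determined on `[0, π]` only). -/
def cauchySolution {m : ℕ} (Q : ℝ → Matrix (Fin m) (Fin m) ℂ) :
    ℝ → Matrix (Fin m) (Fin m) ℂ :=
  Classical.epsilon fun P => IsCauchySolution Q P

namespace MatrixPencil

variable {m : ℕ}

/-- `Y` is a solution on `[0, π]`, with derivative `Y'`, of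
`Y'' + (ρ² I + 2 i ρ Q₁(x) + Q₀(x)) Y = 0`: `Y'` is absolutely continuous and the equation
holds almost everywhere. The columns of `Y` are indexed by `κ`. -/
structure IsSolution (L : MatrixPencil m) (ρ : ℂ) {κ : Type} (Y Y' : ℝ → Matrix (Fin m) κ ℂ) :
    Prop where
  hasDeriv : ∀ x ∈ Set.Icc 0 Real.pi, ∀ j k,
    HasDerivWithinAt (fun t => Y t j k) (Y' x j k) (Set.Icc 0 Real.pi) x
  absCont : ∀ j k, AbsolutelyContinuousOnInterval (fun t => Y' t j k) 0 Real.pi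
  equation : ∀ᵐ x ∂volume.restrict (Set.Icc 0 Real.pi),
    ∃ Y'' : Matrix (Fin m) κ ℂ, (∀ j k, HasDerivAt (fun t => Y' t j k) (Y'' j k) x) ∧
      Y'' + (ρ ^ 2 • (1 : Matrix (Fin m) (Fin m) ℂ) + (2 * Complex.I * ρ) • L.Q₁ x + L.Q₀ x) * Y x
        = 0

/-- The boundary form `U(Y) = Y'(0) + (i ρ h₁ + h₀) Y(0)`. -/
def U (L : MatrixPencil m) (ρ : ℂ) {κ : Type} (Y Y' : ℝ → Matrix (Fin m) κ ℂ) :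
    Matrix (Fin m) κ ℂ :=
  Y' 0 + ((Complex.I * ρ) • L.h₁ + L.h₀) * Y 0

/-- The boundary form `V(Y) = Y'(π) + (i ρ H₁ + H₀) Y(π)`. -/
def V (L : MatrixPencil m) (ρ : ℂ) {κ : Type} (Y Y' : ℝ → Matrix (Fin m) κ ℂ) :
    Matrix (Fin m) κ ℂ :=
  Y' Real.pi + ((Complex.I * ρ) • L.H₁ + L.H₀) * Y Real.pi

/-- Condition (I). -/
def ConditionI (L : MatrixPencil m) : Prop :=
  (1 + L.h₁).det ≠ 0 ∧ (1 - L.h₁).det ≠ 0 ∧ (1 + L.H₁).det ≠ 0 ∧ (1 - L.H₁).det ≠ 0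

/-- Condition (II). -/
def ConditionII (L : MatrixPencil m) : Prop :=
  (∀ᵐ x ∂volume.restrict (Set.Icc 0 Real.pi), (L.Q₁ x)ᴴ = -L.Q₁ x ∧ (L.Q₀ x)ᴴ = L.Q₀ x) ∧
    L.h₁ᴴ = -L.h₁ ∧ L.H₁ᴴ = -L.H₁ ∧ L.h₀ᴴ = L.h₀ ∧ L.H₀ᴴ = L.H₀

/-- `ρ` is an eigenvalue: the boundary value problem has a nonzero (column vector) solution. -/
def IsEigenvalue (L : MatrixPencil m) (ρ : ℂ) : Prop :=
  ∃ Y Y' : ℝ → Matrix (Fin m) Unit ℂ, L.IsSolution ρ Y Y' ∧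
    L.U ρ Y Y' = 0 ∧ L.V ρ Y Y' = 0 ∧ ∃ x ∈ Set.Icc 0 Real.pi, Y x ≠ 0

/-- The matrix solution `φ(·, ρ)` with `φ(0, ρ) = I`, `U(φ) = 0`, together with `φ'(·, ρ)`. -/
def phi (L : MatrixPencil m) (ρ : ℂ) :
    (ℝ → Matrix (Fin m) (Fin m) ℂ) × (ℝ → Matrix (Fin m) (Fin m) ℂ) :=
  Classical.epsilon fun p => L.IsSolution ρ p.1 p.2 ∧ p.1 0 = 1 ∧ L.U ρ p.1 p.2 = 0

/-- The characteristic function `det V(φ(·, ρ))`. -/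
def charFun (L : MatrixPencil m) (ρ : ℂ) : ℂ :=
  (L.V ρ (L.phi ρ).1 (L.phi ρ).2).det

/-- The Weyl solution `Φ(·, ρ)`, with `U(Φ) = I`, `V(Φ) = 0`, together with `Φ'(·, ρ)`
(it is uniquely determined on `[0, π]` if `ρ` is not an eigenvalue). -/
def weylSolution (L : MatrixPencil m) (ρ : ℂ) :
    (ℝ → Matrix (Fin m) (Fin m) ℂ) × (ℝ → Matrix (Fin m) (Fin m) ℂ) :=
  Classical.epsilon fun p => L.IsSolution ρ p.1 p.2 ∧ L.U ρ p.1 p.2 = 1 ∧ L.V ρ p.1 p.2 = 0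

/-- The Weyl matrix `M(ρ) = Φ(0, ρ)`. -/
def weylMatrix (L : MatrixPencil m) (ρ : ℂ) : Matrix (Fin m) (Fin m) ℂ :=
  (L.weylSolution ρ).1 0

/-- The multiplicity of `z` as a zero of the characteristic function. -/
def multiplicity (L : MatrixPencil m) (z : ℂ) : ℕ :=
  analyticOrderNatAt L.charFun z

/-- The weight matrix: the (entrywise) residue of the Weyl matrix at `z`. -/
def weightMatrix (L : MatrixPencil m) (z : ℂ) : Matrix (Fin m) (Fin m) ℂ :=
  Matrix.of fun j k => residueAt (fun ρ => L.weylMatrix ρ j k) z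

/-- The matrix `A = P₋(π)⁻¹ (I + H₁)⁻¹ (I - H₁) P₊(π) (I + h₁) (I - h₁)⁻¹`, where
`P±' = ± Q₁ P±`, `P±(0) = I`. -/
def monodromy (L : MatrixPencil m) : Matrix (Fin m) (Fin m) ℂ :=
  (cauchySolution (fun x => -L.Q₁ x) Real.pi)⁻¹ * (1 + L.H₁)⁻¹ * (1 - L.H₁) *
    cauchySolution L.Q₁ Real.pi * (1 + L.h₁) * (1 - L.h₁)⁻¹

/-- `ρ_{nq}`, `n ∈ w`, `q = 1, …, m`, is a numbering of all the eigenvalues, counted with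
multiplicities, and `ρ_{nq} = n + ω_q + O(1/n)` as `|n| → ∞`. -/
structure IsNumbering (L : MatrixPencil m) (ω : Fin m → ℝ) (ρ : SignedIndex → Fin m → ℂ) :
    Prop where
  count : ∀ z : ℂ, {p : SignedIndex × Fin m | ρ p.1 p.2 = z}.encard = analyticOrderAt L.charFun z
  asymptotics : ∃ C : ℝ, ∃ N : ℕ, 1 ≤ N ∧ ∀ n : SignedIndex, (N : ℤ) ≤ |n.val| → ∀ q,
    ‖ρ n q - ((n.val : ℂ) + (ω q : ℂ))‖ ≤ C / |(n.val : ℝ)|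

end MatrixPencil

/-- The diagonal matrix `I_q`: its `j`-th diagonal entry is `1` if `ω_j = ω_q`, otherwise `0`. -/
def groupProjection {m : ℕ} (ω : Fin m → ℝ) (q : Fin m) : Matrix (Fin m) (Fin m) ℂ :=
  Matrix.diagonal fun j => if ω j = ω q then 1 else 0

end

/-!
The equation is rewritten as a first order system for `(Y, Y')`, whose coefficient is a quadratic
polynomial in `ρ` with integrable coefficients. The Volterra operator of such a system is
quasinilpotent, so the fundamental matrix and its inverse are entire in `ρ`. With `S` the solution
with `S(0) = 0`, `U(S) = I`, this gives `M = -V(φ)⁻¹ V(S)` (`MatrixPencil.weylMatrix_eq`), and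
`V(φ) B + V(S) C = I` for suitable entire `B`, `C` (`MatrixPencil.bezout_spec`). Hence
`V(φ)⁻¹ = B - M C`: the matrix `M` has a pole wherever `V(φ)` is singular, that is, exactly at the
eigenvalues.

*Asymptotics.* In the variables `Y = α + β`, `Y' = (iρ - Q₁)(α - β)` the system splits, up to
`O(1/ρ)`, into the two transport equations whose solutions are `e^{iρx} P₋(x)` and `e^{-iρx} P₊(x)`;
by (II) the matrices `P_±` are unitary (`MatrixPencil.exists_wave_asymptotics`). The leading part of
`V(φ)` is an invertible multiple of `e^{2πiρ} - A` (`MatrixPencil.mainDelta_eq_mul_sub_monodromy`),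
where `A` is unitary because Cayley transforms of skew-Hermitian matrices are. Away from the numbers
`n + ω_q` the determinant of `V(φ)` is therefore, up to a constant, a small perturbation of
`ρ^m e^{-iπmρ} ∏ (e^{2πiρ} - e^{2πiω_q})` (`MatrixPencil.isComparable_charFun`).

*Numbering.* The zeros of this comparison function are the numbers `n + ω_q`, `n ∈ ℤ`, and `0` with
the additional multiplicity `m`, which explains the additional index `-0`. Rouché's theorem on a large
disc and on small discs about the remaining `n + ω_q` matches them with the eigenvalues
(`IsComparable.exists_numbering`). On the small discs it also shows that in every numbering the
eigenvalues close to `n + ω_q` are exactly the `ρ_{ns}` with `ω_s = ω_q`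
(`IsComparable.mem_ball_iff`).

*Reality and simple poles.* For a solution `Y` with `V(Y) = 0`, Lagrange's identity expresses
`Im ρ` times an energy through `Y(0)` and `U(Y)`. In the strip `|Im ρ| ≤ 1` and for large `|Re ρ|`
the leading term `Re ρ ∫ |Y|²` of the energy dominates its boundary terms: `Y` is close to a sum of two
waves, whose cross term is negligible by the Riemann–Lebesgue lemma. Consequently
`|Im ρ| |Y(0)| ≤ |U(Y)|`, so that there are no eigenvalues off the real axis, and
`|M(ρ)| ≤ 1 / |Im ρ|` (`MatrixPencil.exists_weylMatrix_bound`). The latter only allows simple poles.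

*Weight matrices.* If the inverse of an entire matrix function has a simple pole, the rank of its
residue is the order of the zero of the determinant (`analyticOrderNatAt_det_eq_rank`). Since
`V(φ)⁻¹ = B - M C` and `M = -V(φ)⁻¹ V(S)`, the residue of `V(φ)⁻¹` has the rank of the weight matrix
(`MatrixPencil.rank_weightMatrix`). The sum over `J_q` in the asymptotic formula counts each residue
exactly once, because the multiplicity is the number of its indices; it is the integral of `M` over a
circle of fixed radius about `n + ω_q` (`MatrixPencil.IsNumbering.sum_eq_circleIntegral`). There
`-iρ M(ρ)` is within `O(1/ρ)` of an explicit function of `e^{2πiρ}`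
(`MatrixPencil.exists_weylMatrix_asymptotics`), the residue of which at `n + ω_q` is, up to
the factor `1 / (πi)`, the constant matrix in the formula.
-/

noncomputable section

open Set Filter Topology
open scoped Matrix.Norms.L2Operator Real

/-! ### Absolutely continuous matrix functions -/

namespace AbsolutelyContinuousOnInterval

variable {X Y : Type*} [PseudoMetricSpace X] [PseudoMetricSpace Y] {a b : ℝ}

theorem of_dist_le {f : ℝ → X} {g : ℝ → Y} (hg : AbsolutelyContinuousOnInterval g a b)
    (h : ∀ x ∈ uIcc a b, ∀ y ∈ uIcc a b, dist (f x) (f y) ≤ dist (g x) (g y)) :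
    AbsolutelyContinuousOnInterval f a b := by
  rw [absolutelyContinuousOnInterval_iff] at hg ⊢
  intro ε hε
  obtain ⟨δ, hδ, H⟩ := hg ε hε
  refine ⟨δ, hδ, fun E hE hl => lt_of_le_of_lt (Finset.sum_le_sum fun i hi => ?_) (H E hE hl)⟩
  exact h _ (hE.1 i hi).1 _ (hE.1 i hi).2

theorem congr {f g : ℝ → X} (hf : AbsolutelyContinuousOnInterval f a b)
    (h : ∀ x ∈ uIcc a b, f x = g x) : AbsolutelyContinuousOnInterval g a b :=
  hf.of_dist_le fun x hx y hy => by rw [h x hx, h y hy]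

theorem const (c : X) : AbsolutelyContinuousOnInterval (fun _ => c) a b := by
  rw [absolutelyContinuousOnInterval_iff]
  intro ε hε
  exact ⟨1, one_pos, fun E _ _ => by simpa using hε⟩

theorem finset_sum {E ι : Type*} [SeminormedAddCommGroup E] (s : Finset ι) {f : ι → ℝ → E}
    (h : ∀ i ∈ s, AbsolutelyContinuousOnInterval (f i) a b) :
    AbsolutelyContinuousOnInterval (fun x => ∑ i ∈ s, f i x) a b := by
  classical
  induction s using Finset.induction_on with
  | empty => simpa using const (0 : E)
  | insert i s hi ih =>
    simp only [Finset.sum_insert hi]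
    exact (h i (by simp)).fun_add (ih fun j hj => h j (by simp [hj]))

end AbsolutelyContinuousOnInterval

section

variable {E : Type*} [NormedAddCommGroup E] [NormedSpace ℝ E]

/-- The vector-valued case follows from the scalar one for the primitive of the norm, whose increments
dominate those of the primitive. -/
theorem absolutelyContinuousOnInterval_intervalIntegral {f : ℝ → E} {a b : ℝ}
    (h : IntervalIntegrable f volume a b) :
    AbsolutelyContinuousOnInterval (fun x => ∫ t in a..x, f t) a b := by
  refine (h.norm.absolutelyContinuousOnInterval_intervalIntegral left_mem_uIcc).of_dist_le ?_
  intro x hx y hy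
  have hax : IntervalIntegrable f volume a x := h.mono_set (uIcc_subset_uIcc_left hx)
  have hay : IntervalIntegrable f volume a y := h.mono_set (uIcc_subset_uIcc_left hy)
  rw [dist_eq_norm, dist_eq_norm, intervalIntegral.integral_interval_sub_left hax hay,
    intervalIntegral.integral_interval_sub_left hax.norm hay.norm]
  exact intervalIntegral.norm_integral_le_abs_integral_norm

theorem ae_restrict_Icc_iff {a b : ℝ} {p : ℝ → Prop} :
    (∀ᵐ x ∂volume.restrict (Icc a b), p x) ↔ ∀ᵐ x, x ∈ Icc a b → p x :=
  ae_restrict_iff' measurableSet_Icc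

/-- The fundamental theorem of calculus for vector-valued absolutely continuous functions whose
derivative is known to exist almost everywhere and to be integrable. -/
theorem AbsolutelyContinuousOnInterval.eq_add_integral [CompleteSpace E] {f f' : ℝ → E} {a b : ℝ}
    (hf : AbsolutelyContinuousOnInterval f a b)
    (hab : a ≤ b) (hd : ∀ᵐ x ∂volume.restrict (Icc a b), HasDerivAt f (f' x) x)
    (hi : IntervalIntegrable f' volume a b) {x : ℝ} (hx : x ∈ Icc a b) :
    f x = f a + ∫ t in a..x, f' t := by
  have h := (hf.fun_sub (absolutelyContinuousOnInterval_intervalIntegral hi)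
    ).const_of_ae_hasDerivAt_zero (by
      filter_upwards [hi.ae_hasDerivAt_integral, ae_restrict_Icc_iff.1 hd] with x h1 h2 hx
      have := (h2 (by rwa [uIcc_of_le hab] at hx)).fun_sub (h1 hx a left_mem_uIcc)
      rwa [sub_self] at this)
  obtain ⟨C, hC⟩ := h
  rw [uIcc_of_le hab] at hC
  have h1 := hC x hx
  have h2 := hC a (left_mem_Icc.2 hab)
  simp only [intervalIntegral.integral_same, sub_zero] at h2
  rw [h2, ← h1]; abel

/-- Mathlib differentiates real absolutely continuous functions almost everywhere; the complex case
follows by taking real and imaginary parts. -/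
theorem AbsolutelyContinuousOnInterval.exists_hasDerivAt_complex {f : ℝ → ℂ} {a b : ℝ}
    (hf : AbsolutelyContinuousOnInterval f a b) (hab : a ≤ b) :
    ∃ f' : ℝ → ℂ, IntervalIntegrable f' volume a b ∧
      ∀ᵐ x ∂volume.restrict (Icc a b), HasDerivAt f (f' x) x := by
  have hre : AbsolutelyContinuousOnInterval (fun x => (f x).re) a b :=
    hf.of_dist_le fun x _ y _ => by
      rw [dist_eq_norm, dist_eq_norm, ← Complex.sub_re]; exact Complex.abs_re_le_norm _
  have him : AbsolutelyContinuousOnInterval (fun x => (f x).im) a b :=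
    hf.of_dist_le fun x _ y _ => by
      rw [dist_eq_norm, dist_eq_norm, ← Complex.sub_im]; exact Complex.abs_im_le_norm _
  refine ⟨fun x => ((deriv (fun t => (f t).re) x : ℝ) : ℂ) + ((deriv (fun t => (f t).im) x : ℝ) : ℂ) *
    Complex.I, ?_, ?_⟩
  · have h1 := hre.intervalIntegrable_deriv
    have h2 := him.intervalIntegrable_deriv
    exact (IntervalIntegrable.add ⟨h1.1.ofReal, h1.2.ofReal⟩
      (IntervalIntegrable.mul_const ⟨h2.1.ofReal, h2.2.ofReal⟩ _))
  · rw [ae_restrict_Icc_iff]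
    filter_upwards [hre.ae_differentiableAt, him.ae_differentiableAt] with x h1 h2 hx
    rw [uIcc_of_le hab] at h1 h2
    have := ((h1 hx).hasDerivAt.ofReal_comp).add (((h2 hx).hasDerivAt.ofReal_comp).mul_const
      Complex.I)
    refine this.congr_of_eventuallyEq (Eventually.of_forall fun t => ?_)
    simp [Complex.re_add_im]

end

theorem ContinuousOn.matrix_apply {X r c : Type*} [TopologicalSpace X] {F : X → Matrix r c ℂ}
    {s : Set X} (h : ContinuousOn F s) (j : r) (k : c) : ContinuousOn (fun x => F x j k) s :=
  (continuous_id.matrix_elem j k).comp_continuousOn h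

/-- `F` is absolutely continuous on `[0, π]` (entrywise), with a.e. derivative `F'`. -/
structure MatAC {r c : Type*} (F F' : ℝ → Matrix r c ℂ) : Prop where
  ac : ∀ j k, AbsolutelyContinuousOnInterval (fun x => F x j k) 0 π
  deriv : ∀ᵐ x ∂volume.restrict (Icc 0 π), ∀ j k, HasDerivAt (fun t => F t j k) (F' x j k) x

namespace MatAC

variable {r c d : Type*} {F F' G G' : ℝ → Matrix r c ℂ}

theorem congr_deriv (hF : MatAC F F')
    (h : ∀ᵐ x ∂volume.restrict (Icc 0 π), F' x = G' x) : MatAC F G' :=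
  ⟨hF.ac, by filter_upwards [hF.deriv, h] with x h1 h2; rwa [← h2]⟩

theorem continuousOn [Finite r] [Finite c] (hF : MatAC F F') : ContinuousOn F (Icc 0 π) := by
  refine continuousOn_pi.2 fun j => continuousOn_pi.2 fun k => ?_
  have := (hF.ac j k).continuousOn
  rwa [uIcc_of_le Real.pi_pos.le] at this

theorem const (A : Matrix r c ℂ) : MatAC (fun _ => A) (fun _ => 0) :=
  ⟨fun _ _ => .const _, Eventually.of_forall fun _ _ _ => hasDerivAt_const _ _⟩

theorem neg (hF : MatAC F F') : MatAC (fun x => -F x) (fun x => -F' x) :=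
  ⟨fun j k => (hF.ac j k).fun_neg, by
    filter_upwards [hF.deriv] with x h1 j k using (h1 j k).neg⟩

theorem sub (hF : MatAC F F') (hG : MatAC G G') :
    MatAC (fun x => F x - G x) (fun x => F' x - G' x) :=
  ⟨fun j k => (hF.ac j k).fun_sub (hG.ac j k), by
    filter_upwards [hF.deriv, hG.deriv] with x h1 h2 j k
    exact (h1 j k).sub (h2 j k)⟩

theorem mul [Fintype c] {H H' : ℝ → Matrix c d ℂ} (hF : MatAC F F') (hH : MatAC H H') :
    MatAC (fun x => F x * H x) (fun x => F' x * H x + F x * H' x) := by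
  refine ⟨fun j k => ?_, ?_⟩
  · simp only [Matrix.mul_apply]
    exact .finset_sum _ fun i _ => (hF.ac j i).fun_smul (hH.ac i k)
  · filter_upwards [hF.deriv, hH.deriv] with x h1 h2 j k
    simp only [Matrix.mul_apply, Matrix.add_apply, ← Finset.sum_add_distrib]
    exact HasDerivAt.fun_sum fun i _ => (h1 j i).mul (h2 i k)

theorem smul {f f' : ℝ → ℂ} (hf : AbsolutelyContinuousOnInterval f 0 π)
    (hf' : ∀ᵐ x ∂volume.restrict (Icc 0 π), HasDerivAt f (f' x) x) (hF : MatAC F F') :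
    MatAC (fun x => f x • F x) (fun x => f' x • F x + f x • F' x) := by
  refine ⟨fun j k => hf.fun_smul (hF.ac j k), ?_⟩
  filter_upwards [hf', hF.deriv] with x h1 h2 j k
  exact h1.mul (h2 j k)

theorem transpose (hF : MatAC F F') : MatAC (fun x => (F x)ᵀ) (fun x => (F' x)ᵀ) :=
  ⟨fun j k => hF.ac k j, by filter_upwards [hF.deriv] with x h1 j k using h1 k j⟩

theorem conjTranspose (hF : MatAC F F') : MatAC (fun x => (F x)ᴴ) (fun x => (F' x)ᴴ) :=
  ⟨fun j k => (hF.ac k j).of_dist_le fun x _ y _ => by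
      simp only [conjTranspose_apply]; exact (dist_star_star _ _).le, by
    filter_upwards [hF.deriv] with x h1 j k
    simpa using (h1 k j).star⟩

theorem fromBlocks {r₁ r₂ c₁ c₂ : Type*} {A A' : ℝ → Matrix r₁ c₁ ℂ} {B B' : ℝ → Matrix r₁ c₂ ℂ}
    {C C' : ℝ → Matrix r₂ c₁ ℂ} {D D' : ℝ → Matrix r₂ c₂ ℂ} (hA : MatAC A A') (hB : MatAC B B')
    (hC : MatAC C C') (hD : MatAC D D') :
    MatAC (fun x => Matrix.fromBlocks (A x) (B x) (C x) (D x))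
      (fun x => Matrix.fromBlocks (A' x) (B' x) (C' x) (D' x)) := by
  constructor
  · rintro (j | j) (k | k)
    exacts [hA.ac j k, hB.ac j k, hC.ac j k, hD.ac j k]
  · filter_upwards [hA.deriv, hB.deriv, hC.deriv, hD.deriv] with x h1 h2 h3 h4
    rintro (j | j) (k | k)
    exacts [h1 j k, h2 j k, h3 j k, h4 j k]

theorem fromRows {r₁ r₂ : Type*} {A A' : ℝ → Matrix r₁ c ℂ} {B B' : ℝ → Matrix r₂ c ℂ}
    (hA : MatAC A A') (hB : MatAC B B') :
    MatAC (fun x => Matrix.fromRows (A x) (B x)) (fun x => Matrix.fromRows (A' x) (B' x)) := by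
  constructor
  · rintro (j | j) k
    exacts [hA.ac j k, hB.ac j k]
  · filter_upwards [hA.deriv, hB.deriv] with x h1 h2
    rintro (j | j) k
    exacts [h1 j k, h2 j k]

theorem submatrix {r' c' : Type*} (hF : MatAC F F') (e : r' → r) (f : c' → c) :
    MatAC (fun x => (F x).submatrix e f) (fun x => (F' x).submatrix e f) :=
  ⟨fun j k => hF.ac (e j) (f k), by filter_upwards [hF.deriv] with x h j k using h (e j) (f k)⟩

theorem eq_of_deriv_zero (hF : MatAC F F')
    (h : ∀ᵐ x ∂volume.restrict (Icc 0 π), F' x = 0) {x : ℝ} (hx : x ∈ Icc 0 π) : F x = F 0 := by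
  ext j k
  obtain ⟨C, hC⟩ := (hF.ac j k).const_of_ae_hasDerivAt_zero (by
    filter_upwards [ae_restrict_Icc_iff.1 hF.deriv, ae_restrict_Icc_iff.1 h] with x h1 h2 hx
    rw [uIcc_of_le Real.pi_pos.le] at hx
    simpa [h2 hx] using h1 hx j k)
  rw [uIcc_of_le Real.pi_pos.le] at hC
  exact (hC x hx).trans (hC 0 (left_mem_Icc.2 Real.pi_pos.le)).symm

theorem congr (hF : MatAC F F') (h : ∀ x ∈ Icc 0 π, F x = G x) : MatAC G F' := by
  refine ⟨fun j k => (hF.ac j k).congr fun x hx => by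
    rw [uIcc_of_le Real.pi_pos.le] at hx; simp only [h x hx], ?_⟩
  have : ∀ᵐ x ∂volume.restrict (Icc 0 π), x ∈ Ioo 0 π := by
    rw [← restrict_Ioo_eq_restrict_Icc]
    exact ae_restrict_mem measurableSet_Ioo
  filter_upwards [hF.deriv, this] with x h1 hx j k
  refine (h1 j k).congr_of_eventuallyEq ?_
  filter_upwards [Ioo_mem_nhds hx.1 hx.2] with y hy
  rw [h y (Ioo_subset_Icc_self hy)]

theorem apply_eq_add_integral (hF : MatAC F F') (j : r) (k : c)
    (hi : IntervalIntegrable (fun x => F' x j k) volume 0 π) {x : ℝ} (hx : x ∈ Icc 0 π) :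
    F x j k = F 0 j k + ∫ t in (0)..x, F' t j k :=
  (hF.ac j k).eq_add_integral Real.pi_pos.le
    (by filter_upwards [hF.deriv] with x h using h j k) hi hx

theorem of_integral {f : ℝ → Matrix r c ℂ} (A : Matrix r c ℂ)
    (hf : ∀ j k, IntervalIntegrable (fun x => f x j k) volume 0 π) [Finite r] [Finite c] :
    MatAC (fun x => A + Matrix.of fun j k => ∫ t in (0)..x, f t j k) f := by
  refine ⟨fun j k => (AbsolutelyContinuousOnInterval.const _).fun_add
    (absolutelyContinuousOnInterval_intervalIntegral (hf j k)), ?_⟩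
  have h : ∀ j k, ∀ᵐ x ∂volume.restrict (Icc 0 π),
      HasDerivAt (fun x => ∫ t in (0)..x, f t j k) (f x j k) x := fun j k => by
    rw [ae_restrict_Icc_iff]
    filter_upwards [(hf j k).ae_hasDerivAt_integral] with x h1 hx
    rw [uIcc_of_le Real.pi_pos.le] at h1
    exact h1 hx 0 (left_mem_Icc.2 Real.pi_pos.le)
  have h' := ae_all_iff.2 fun j => ae_all_iff.2 fun k => h j k
  filter_upwards [h'] with x hx j k
  simpa using (hx j k).const_add (A j k)

/-- If the a.e. derivative of an absolutely continuous function is continuous, it is the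
derivative everywhere. -/
theorem hasDerivWithinAt (hF : MatAC F F') (hc : ContinuousOn F' (Icc 0 π)) {x : ℝ}
    (hx : x ∈ Icc 0 π) (j : r) (k : c) :
    HasDerivWithinAt (fun t => F t j k) (F' x j k) (Icc 0 π) x := by
  have hjk : ContinuousOn (fun x => F' x j k) (Icc 0 π) := hc.matrix_apply j k
  have hi : IntervalIntegrable (fun x => F' x j k) volume 0 π :=
    hjk.intervalIntegrable_of_Icc Real.pi_pos.le
  set g : ℝ → ℂ := IccExtend Real.pi_pos.le (domRestrict (Icc 0 π) fun x => F' x j k)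
  have hg : Continuous g := (continuousOn_iff_continuous_domRestrict.1 hjk).Icc_extend'
  have hgF : ∀ t ∈ Icc 0 π, g t = F' t j k := fun t ht => IccExtend_of_mem _ _ ht
  have h1 := ((hg.integral_hasStrictDerivAt 0 x).hasDerivAt.const_add (F 0 j k)).hasDerivWithinAt
    (s := Icc 0 π)
  rw [hgF x hx] at h1
  have key : ∀ t ∈ Icc 0 π, F t j k = F 0 j k + ∫ s in (0)..t, g s := fun t ht => by
    rw [hF.apply_eq_add_integral j k hi ht]
    congr 1
    refine intervalIntegral.integral_congr fun s hs => (hgF s ?_).symm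
    rw [uIcc_of_le ht.1] at hs
    exact ⟨hs.1, hs.2.trans ht.2⟩
  exact h1.congr key (key x hx)

theorem of_hasDerivWithinAt [Finite r] [Finite c]
    (h : ∀ x ∈ Icc 0 π, ∀ j k, HasDerivWithinAt (fun t => F t j k) (F' x j k) (Icc 0 π) x)
    (hc : ContinuousOn F' (Icc 0 π)) : MatAC F F' := by
  constructor
  · intro j k
    have hjk : ContinuousOn (fun x => F' x j k) (Icc 0 π) := hc.matrix_apply j k
    obtain ⟨C, hC⟩ := isCompact_Icc.exists_bound_of_continuousOn hjk
    refine LipschitzOnWith.absolutelyContinuousOnInterval (K := ⟨max C 0, le_max_right _ _⟩) ?_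
    rw [uIcc_of_le Real.pi_pos.le]
    refine (convex_Icc 0 π).lipschitzOnWith_of_nnnorm_hasDerivWithin_le
      (fun x hx => h x hx j k) fun x hx => ?_
    exact NNReal.coe_le_coe.1 ((hC x hx).trans (le_max_left _ _))
  · have : ∀ᵐ x ∂volume.restrict (Icc 0 π), x ∈ Ioo 0 π := by
      rw [← restrict_Ioo_eq_restrict_Icc]
      exact ae_restrict_mem measurableSet_Ioo
    filter_upwards [this] with x hx j k
    exact (h x (Ioo_subset_Icc_self hx) j k).hasDerivAt (Icc_mem_nhds hx.1 hx.2)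

end MatAC

/-! ### Linear differential systems with integrable coefficients -/

section Volterra

variable {𝔸 : Type*} [NormedRing 𝔸]

theorem intervalIntegrable_mul_projIcc {a : ℝ → 𝔸} (ha : IntervalIntegrable a volume 0 π)
    (f : C(Icc (0 : ℝ) π, 𝔸)) :
    IntervalIntegrable (fun t => a t * f (projIcc 0 π Real.pi_pos.le t)) volume 0 π :=
  ha.mul_continuousOn (f.continuous.comp continuous_projIcc).continuousOn

theorem IntervalIntegrable.mono_Icc {E : Type*} [NormedAddCommGroup E] {f : ℝ → E} {b x : ℝ}
    (hf : IntervalIntegrable f volume 0 b)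
    (hx : x ∈ Icc 0 b) : IntervalIntegrable f volume 0 x :=
  hf.mono_set (uIcc_subset_uIcc_left (Icc_subset_uIcc hx))

variable [NormedAlgebra ℂ 𝔸]

/-- The Volterra operator `f ↦ (x ↦ ∫₀ˣ a(t) f(t) dt)` on `C([0, π], 𝔸)`. -/
def volterra (a : ℝ → 𝔸) (ha : IntervalIntegrable a volume 0 π) :
    C(Icc (0 : ℝ) π, 𝔸) →L[ℂ] C(Icc (0 : ℝ) π, 𝔸) :=
  LinearMap.mkContinuous
    { toFun := fun f => ⟨fun x => ∫ t in (0)..(x : ℝ), a t * f (projIcc 0 π Real.pi_pos.le t), by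
        have := (intervalIntegral.continuousOn_primitive_interval'
          (intervalIntegrable_mul_projIcc ha f) left_mem_uIcc)
        rw [uIcc_of_le Real.pi_pos.le] at this
        exact continuousOn_iff_continuous_domRestrict.1 this⟩
      map_add' := fun f g => by
        ext x
        simp only [ContinuousMap.add_apply, mul_add, ContinuousMap.coe_mk]
        exact intervalIntegral.integral_add
          ((intervalIntegrable_mul_projIcc ha f).mono_Icc x.2)
          ((intervalIntegrable_mul_projIcc ha g).mono_Icc x.2)
      map_smul' := fun c f => by
        ext x
        simp only [ContinuousMap.smul_apply, mul_smul_comm, ContinuousMap.coe_mk, RingHom.id_apply]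
        exact intervalIntegral.integral_smul _ _ }
    (∫ t in (0)..π, ‖a t‖) fun f => by
      rw [ContinuousMap.norm_le _ (mul_nonneg
        (intervalIntegral.integral_nonneg Real.pi_pos.le fun _ _ => norm_nonneg _) (norm_nonneg _))]
      intro x
      have h1 : ‖∫ t in (0)..(x : ℝ), a t * f (projIcc 0 π Real.pi_pos.le t)‖ ≤
          ∫ t in (0)..(x : ℝ), ‖a t‖ * ‖f‖ := by
        refine intervalIntegral.norm_integral_le_of_norm_le x.2.1
          (Eventually.of_forall fun t _ => ?_) ((ha.norm.mono_Icc x.2).mul_const _)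
        exact (norm_mul_le _ _).trans (by gcongr; exact f.norm_coe_le_norm _)
      refine h1.trans ?_
      rw [intervalIntegral.integral_mul_const]
      gcongr
      exact intervalIntegral.integral_mono_interval le_rfl x.2.1 x.2.2
        (Eventually.of_forall fun t => norm_nonneg _) ha.norm

theorem volterra_apply {a : ℝ → 𝔸} (ha : IntervalIntegrable a volume 0 π)
    (f : C(Icc (0 : ℝ) π, 𝔸)) (x : Icc (0 : ℝ) π) :
    volterra a ha f x = ∫ t in (0)..(x : ℝ), a t * f (projIcc 0 π Real.pi_pos.le t) := rfl

/-- The integrand is the a.e. derivative of a power of the primitive of `g`, which is absolutely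
continuous but in general not differentiable everywhere. -/
theorem integral_pow_primitive {g : ℝ → ℝ} (hg : IntervalIntegrable g volume 0 π) (n : ℕ)
    {x : ℝ} (hx : x ∈ Icc 0 π) :
    ∫ t in (0)..x, g t * (∫ s in (0)..t, g s) ^ n = (∫ s in (0)..x, g s) ^ (n + 1) / (n + 1) := by
  have hac := hg.absolutelyContinuousOnInterval_intervalIntegral (c := 0) left_mem_uIcc
  have hpow : ∀ k : ℕ, AbsolutelyContinuousOnInterval (fun x => (∫ s in (0)..x, g s) ^ k) 0 π := by
    intro k
    induction k with
    | zero => simpa using AbsolutelyContinuousOnInterval.const (1 : ℝ)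
    | succ k ih => simpa only [pow_succ] using ih.fun_mul hac
  have h := (hpow (n + 1)).eq_add_integral
    (f' := fun t => (n + 1 : ℝ) * (g t * (∫ s in (0)..t, g s) ^ n)) Real.pi_pos.le ?_ ?_ hx
  · rw [intervalIntegral.integral_same, zero_pow n.succ_ne_zero, zero_add,
      intervalIntegral.integral_const_mul] at h
    rw [h]; field_simp
  · rw [ae_restrict_Icc_iff]
    filter_upwards [hg.ae_hasDerivAt_integral] with t ht htI
    rw [uIcc_of_le Real.pi_pos.le] at ht
    have := (ht htI 0 (left_mem_Icc.2 Real.pi_pos.le)).fun_pow (n + 1)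
    refine this.congr_deriv ?_
    push_cast
    ring
  · exact (hg.mul_continuousOn (hpow n).continuousOn).const_mul _

/-- The `n`-th iterate of a Volterra operator is bounded by the `n`-th term of an exponential series.
This is what makes the operator quasinilpotent without any smallness of the coefficient. -/
theorem norm_volterra_pow_apply_le {a : ℝ → 𝔸} (ha : IntervalIntegrable a volume 0 π) (n : ℕ)
    (f : C(Icc (0 : ℝ) π, 𝔸)) (x : Icc (0 : ℝ) π) :
    ‖(volterra a ha ^ n) f x‖ ≤ (∫ t in (0)..(x : ℝ), ‖a t‖) ^ n / n.factorial * ‖f‖ := by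
  induction n generalizing x with
  | zero => simpa using f.norm_coe_le_norm x
  | succ n ih =>
    rw [pow_succ', mul_apply_eq_comp, volterra_apply]
    have hac := ha.norm.absolutelyContinuousOnInterval_intervalIntegral (c := 0) left_mem_uIcc
    have hi : IntervalIntegrable (fun t => ‖a t‖ * (∫ s in (0)..t, ‖a s‖) ^ n) volume 0 π :=
      ha.norm.mul_continuousOn (hac.continuousOn.pow n)
    have h1 : ‖∫ t in (0)..(x : ℝ), a t * ((volterra a ha ^ n) f)
        (projIcc 0 π Real.pi_pos.le t)‖ ≤ ∫ t in (0)..(x : ℝ),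
          (‖a t‖ * (∫ s in (0)..t, ‖a s‖) ^ n) * (‖f‖ / n.factorial) := by
      refine intervalIntegral.norm_integral_le_of_norm_le x.2.1
        (Eventually.of_forall fun t ht => ?_) ((hi.mono_Icc x.2).mul_const _)
      have ht' : t ∈ Icc 0 π := ⟨ht.1.le, ht.2.trans x.2.2⟩
      refine (norm_mul_le _ _).trans ?_
      rw [projIcc_of_mem _ ht']
      calc _ ≤ ‖a t‖ * ((∫ s in (0)..t, ‖a s‖) ^ n / n.factorial * ‖f‖) := by
            gcongr; exact ih ⟨t, ht'⟩
        _ = _ := by ring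
    refine h1.trans (le_of_eq ?_)
    rw [intervalIntegral.integral_mul_const, integral_pow_primitive ha.norm n x.2,
      Nat.factorial_succ]
    push_cast
    field_simp

theorem isUnit_one_sub_of_norm_pow_lt_one {B : Type*} [NormedRing B] [CompleteSpace B] {T : B}
    {n : ℕ} (h : ‖T ^ n‖ < 1) : IsUnit (1 - T) := by
  have hu : IsUnit (1 - T ^ n) := isUnit_one_sub_of_norm_lt_one h
  rw [← mul_neg_geom_sum] at hu
  refine ((Commute.isUnit_mul_iff ?_).1 hu).1
  exact (mul_neg_geom_sum _ n).trans (geom_sum_mul_neg _ n).symm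

/-- A Volterra operator is quasinilpotent, so that `1 - K` is invertible. -/
theorem isUnit_one_sub_volterra [CompleteSpace 𝔸] {a : ℝ → 𝔸}
    (ha : IntervalIntegrable a volume 0 π) : IsUnit (1 - volterra a ha) := by
  set c := ∫ t in (0)..π, ‖a t‖ with hc
  have hc0 : 0 ≤ c := intervalIntegral.integral_nonneg Real.pi_pos.le fun _ _ => norm_nonneg _
  obtain ⟨n, hn⟩ := ((FloorSemiring.tendsto_pow_div_factorial_atTop c).eventually
    (gt_mem_nhds (zero_lt_one' ℝ))).exists
  have hK : ‖volterra a ha ^ n‖ < 1 := by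
    refine lt_of_le_of_lt (ContinuousLinearMap.opNorm_le_bound _ (by positivity) fun f => ?_) hn
    rw [ContinuousMap.norm_le _ (by positivity)]
    intro x
    refine (norm_volterra_pow_apply_le ha n f x).trans ?_
    have h0 : 0 ≤ ∫ t in (0)..(x : ℝ), ‖a t‖ :=
      intervalIntegral.integral_nonneg x.2.1 fun _ _ => norm_nonneg _
    have : ∫ t in (0)..(x : ℝ), ‖a t‖ ≤ c :=
      intervalIntegral.integral_mono_interval le_rfl x.2.1 x.2.2
        (Eventually.of_forall fun t => norm_nonneg _) ha.norm
    gcongr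
  exact isUnit_one_sub_of_norm_pow_lt_one
    (B := C(Icc (0 : ℝ) π, 𝔸) →L[ℂ] C(Icc (0 : ℝ) π, 𝔸)) hK

theorem differentiable_inverse_one_sub {B : Type*} [NormedRing B] [NormedAlgebra ℂ B]
    [CompleteSpace B] (K₀ K₁ K₂ : B) (hu : ∀ ρ : ℂ, IsUnit (1 - (K₀ + ρ • K₁ + ρ ^ 2 • K₂))) :
    Differentiable ℂ fun ρ : ℂ => Ring.inverse (1 - (K₀ + ρ • K₁ + ρ ^ 2 • K₂)) := fun ρ => by
  have hd : DifferentiableAt ℂ (fun ρ : ℂ => 1 - (K₀ + ρ • K₁ + ρ ^ 2 • K₂)) ρ :=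
    (((differentiableAt_const K₀).add (differentiableAt_id.smul_const K₁)).add
      ((differentiableAt_id.pow 2).smul_const K₂)).const_sub 1
  exact (differentiableAt_inverse (𝕜 := ℂ) (hu ρ)).comp ρ hd

/-- The solution of a linear Volterra equation whose coefficient depends polynomially on a
parameter is an entire function of the parameter. -/
theorem exists_volterra_solution [CompleteSpace 𝔸] {a₀ a₁ a₂ : ℝ → 𝔸}
    (h₀ : IntervalIntegrable a₀ volume 0 π) (h₁ : IntervalIntegrable a₁ volume 0 π)
    (h₂ : IntervalIntegrable a₂ volume 0 π) :
    ∃ Ψ : ℂ → C(Icc (0 : ℝ) π, 𝔸), Differentiable ℂ Ψ ∧ ∀ ρ (x : Icc (0 : ℝ) π),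
      Ψ ρ x = 1 + ∫ t in (0)..(x : ℝ), (a₀ t + ρ • a₁ t + ρ ^ 2 • a₂ t) *
        Ψ ρ (projIcc 0 π Real.pi_pos.le t) := by
  set K : ℂ → C(Icc (0 : ℝ) π, 𝔸) →L[ℂ] C(Icc (0 : ℝ) π, 𝔸) := fun ρ =>
    volterra a₀ h₀ + ρ • volterra a₁ h₁ + ρ ^ 2 • volterra a₂ h₂ with hK
  have hK' : ∀ ρ, K ρ = volterra (fun t => a₀ t + ρ • a₁ t + ρ ^ 2 • a₂ t)
      ((h₀.add (h₁.smul ρ)).add (h₂.smul (ρ ^ 2))) := by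
    intro ρ
    ext f x
    simp only [hK, _root_.add_apply, _root_.smul_apply,
      ContinuousMap.add_apply, ContinuousMap.smul_apply, volterra_apply, add_mul, smul_mul_assoc]
    have i₀ := (intervalIntegrable_mul_projIcc h₀ f).mono_Icc x.2
    have i₁ := (intervalIntegrable_mul_projIcc h₁ f).mono_Icc x.2
    have i₂ := (intervalIntegrable_mul_projIcc h₂ f).mono_Icc x.2
    have j₁ : IntervalIntegrable (fun t => ρ • (a₁ t * f (projIcc 0 π Real.pi_pos.le t))) volume
        0 x := i₁.smul ρ
    have j₂ : IntervalIntegrable (fun t => ρ ^ 2 • (a₂ t * f (projIcc 0 π Real.pi_pos.le t))) volume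
        0 x := i₂.smul (ρ ^ 2)
    rw [intervalIntegral.integral_add (i₀.add j₁) j₂, intervalIntegral.integral_add i₀ j₁, intervalIntegral.integral_smul,
      intervalIntegral.integral_smul]
  have hu : ∀ ρ, IsUnit (1 - K ρ) := fun ρ => by rw [hK']; exact isUnit_one_sub_volterra _
  refine ⟨fun ρ => Ring.inverse (1 - K ρ) 1, fun ρ => ?_, fun ρ x => ?_⟩
  · have := differentiable_inverse_one_sub (volterra a₀ h₀) (volterra a₁ h₁) (volterra a₂ h₂) hu
    exact (this ρ).clm_apply (differentiableAt_const _)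
  · have h := congrArg (fun T => T (1 : C(Icc (0 : ℝ) π, 𝔸)) x) (Ring.mul_inverse_cancel _ (hu ρ))
    simp only [mul_apply_eq_comp, _root_.sub_apply,
      one_apply_eq_self, ContinuousMap.sub_apply, ContinuousMap.one_apply] at h
    rw [sub_eq_iff_eq_add] at h
    refine h.trans (congrArg (1 + ·) ?_)
    exact (congrArg (fun T => T (Ring.inverse (1 - K ρ) 1) x) (hK' ρ)).trans
      (volterra_apply _ _ _)

end Volterra

section Fundamental

variable {n : Type*} [Fintype n] [DecidableEq n]

theorem intervalIntegrable_matrix {r c : Type*} [Fintype r] [Fintype c] [DecidableEq c]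
    {f : ℝ → Matrix r c ℂ} {a b : ℝ} :
    IntervalIntegrable f volume a b ↔ ∀ j k, IntervalIntegrable (fun x => f x j k) volume a b := by
  classical
  constructor
  · intro h j k
    let e : Matrix r c ℂ →L[ℂ] ℂ := LinearMap.toContinuousLinearMap (Matrix.entryLinearMap ℂ ℂ j k)
    exact ⟨e.integrable_comp h.1, e.integrable_comp h.2⟩
  · intro h
    have : f = fun x => ∑ j, ∑ k, f x j k • Matrix.single j k (1 : ℂ) := by
      ext1 x
      conv_lhs => rw [Matrix.matrix_eq_sum_single (f x)]
      simp
    rw [this]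
    have h' : ∀ j k, IntervalIntegrable (fun x => f x j k • Matrix.single j k (1 : ℂ))
        volume a b := fun j k =>
      ⟨Integrable.smul_const (h j k).1 _, Integrable.smul_const (h j k).2 _⟩
    simpa only [Finset.sum_apply, Finset.sum_fn] using IntervalIntegrable.sum Finset.univ
      (fun j _ => IntervalIntegrable.sum Finset.univ fun k _ => h' j k)

theorem integral_matrix_apply {r c : Type*} [Fintype r] [Fintype c] [DecidableEq c]
    {f : ℝ → Matrix r c ℂ} {a b : ℝ}
    (h : IntervalIntegrable f volume a b) (j : r) (k : c) :
    (∫ x in a..b, f x) j k = ∫ x in a..b, f x j k :=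
  ((LinearMap.toContinuousLinearMap (Matrix.entryLinearMap ℂ ℂ j k)).intervalIntegral_comp_comm
    h).symm

theorem MatAC.eq_add_integral {r c : Type*} [Fintype r] [Fintype c] [DecidableEq c]
    {F F' : ℝ → Matrix r c ℂ} (hF : MatAC F F')
    (hi : IntervalIntegrable F' volume 0 π) {x : ℝ} (hx : x ∈ Icc 0 π) :
    F x = F 0 + ∫ t in (0)..x, F' t := by
  ext j k
  rw [Matrix.add_apply, integral_matrix_apply (hi.mono_Icc hx),
    hF.apply_eq_add_integral j k (intervalIntegrable_matrix.1 hi j k) hx]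

theorem Differentiable.matrix_apply {r c : Type*} [Fintype r] [Fintype c] [DecidableEq c]
    {F : ℂ → Matrix r c ℂ} (h : Differentiable ℂ F) (j : r) (k : c) :
    Differentiable ℂ fun z => F z j k :=
  (LinearMap.toContinuousLinearMap (Matrix.entryLinearMap ℂ ℂ j k)).differentiable.comp h

/-- The fundamental matrix as the solution of the Volterra integral equation, constantly extended
beyond `[0, π]`. -/
theorem exists_fundamental_aux {a₀ a₁ a₂ : ℝ → Matrix n n ℂ}
    (h₀ : IntervalIntegrable a₀ volume 0 π) (h₁ : IntervalIntegrable a₁ volume 0 π)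
    (h₂ : IntervalIntegrable a₂ volume 0 π) :
    ∃ Ψ : ℂ → ℝ → Matrix n n ℂ,
      (∀ ρ, MatAC (Ψ ρ) (fun x => (a₀ x + ρ • a₁ x + ρ ^ 2 • a₂ x) * Ψ ρ x)) ∧
      (∀ ρ, Ψ ρ 0 = 1) ∧ ∀ x, Differentiable ℂ (fun ρ => Ψ ρ x) := by
  have : CompleteSpace (Matrix n n ℂ) := FiniteDimensional.complete ℂ _
  obtain ⟨Ψ, hd, hΨ⟩ := exists_volterra_solution h₀ h₁ h₂
  refine ⟨fun ρ x => Ψ ρ (projIcc 0 π Real.pi_pos.le x), fun ρ => ?_, fun ρ => ?_, fun x => ?_⟩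
  · have hi : IntervalIntegrable (fun t => (a₀ t + ρ • a₁ t + ρ ^ 2 • a₂ t) *
        Ψ ρ (projIcc 0 π Real.pi_pos.le t)) volume 0 π :=
      intervalIntegrable_mul_projIcc ((h₀.add (h₁.smul ρ)).add (h₂.smul (ρ ^ 2))) (Ψ ρ)
    refine (MatAC.of_integral 1 (intervalIntegrable_matrix.1 hi)).congr fun x hx => ?_
    ext j k
    have h := congrFun₂ (hΨ ρ ⟨x, hx⟩) j k
    simp only [projIcc_of_mem _ hx]
    exact (h.trans (congrArg (_ + ·) (integral_matrix_apply (hi.mono_Icc hx) j k))).symm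
  · exact (hΨ ρ _).trans (by simp only [projIcc_left, intervalIntegral.integral_same, add_zero])
  · exact ((ContinuousMap.evalCLM ℂ (projIcc 0 π Real.pi_pos.le x)).differentiable).comp hd

/-- Fundamental matrices of the system `Ψ' = (a₀ + ρ a₁ + ρ² a₂) Ψ` with integrable coefficients:
`Ψ(0) = 1`, `Ψ` is invertible, and `Ψ` and its inverse `Θ` are entire in `ρ`. -/
theorem exists_fundamental {a₀ a₁ a₂ : ℝ → Matrix n n ℂ}
    (h₀ : ∀ j k, IntervalIntegrable (fun x => a₀ x j k) volume 0 π)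
    (h₁ : ∀ j k, IntervalIntegrable (fun x => a₁ x j k) volume 0 π)
    (h₂ : ∀ j k, IntervalIntegrable (fun x => a₂ x j k) volume 0 π) :
    ∃ Ψ Θ : ℂ → ℝ → Matrix n n ℂ,
      (∀ ρ, MatAC (Ψ ρ) (fun x => (a₀ x + ρ • a₁ x + ρ ^ 2 • a₂ x) * Ψ ρ x)) ∧
      (∀ ρ, MatAC (Θ ρ) (fun x => -(Θ ρ x * (a₀ x + ρ • a₁ x + ρ ^ 2 • a₂ x)))) ∧
      (∀ ρ, Ψ ρ 0 = 1) ∧ (∀ ρ, Θ ρ 0 = 1) ∧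
      (∀ ρ, ∀ x ∈ Icc 0 π, Θ ρ x * Ψ ρ x = 1) ∧
      (∀ x, Differentiable ℂ (fun ρ => Ψ ρ x)) ∧
      ∀ x j k, Differentiable ℂ (fun ρ => Θ ρ x j k) := by
  obtain ⟨Ψ, hΨ, hΨ0, hΨd⟩ := exists_fundamental_aux (intervalIntegrable_matrix.2 h₀)
    (intervalIntegrable_matrix.2 h₁) (intervalIntegrable_matrix.2 h₂)
  -- the inverse solves the adjoint system, written for the transpose
  obtain ⟨Φ, hΦ, hΦ0, hΦd⟩ := exists_fundamental_aux (a₀ := fun x => -(a₀ x)ᵀ)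
    (a₁ := fun x => -(a₁ x)ᵀ) (a₂ := fun x => -(a₂ x)ᵀ)
    (intervalIntegrable_matrix.2 fun j k => (h₀ k j).neg)
    (intervalIntegrable_matrix.2 fun j k => (h₁ k j).neg)
    (intervalIntegrable_matrix.2 fun j k => (h₂ k j).neg)
  have hΘ : ∀ ρ, MatAC (fun x => (Φ ρ x)ᵀ)
      (fun x => -((Φ ρ x)ᵀ * (a₀ x + ρ • a₁ x + ρ ^ 2 • a₂ x))) := fun ρ => by
    convert (hΦ ρ).transpose using 2 with x
    rw [transpose_mul, transpose_add, transpose_add, transpose_smul, transpose_smul,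
      transpose_neg, transpose_neg, transpose_neg, transpose_transpose, transpose_transpose,
      transpose_transpose, smul_neg, smul_neg, ← neg_add, ← neg_add, mul_neg]
  refine ⟨Ψ, fun ρ x => (Φ ρ x)ᵀ, hΨ, hΘ, hΨ0, fun ρ => by simp [hΦ0], fun ρ x hx => ?_, hΨd,
    fun x j k => (hΦd x).matrix_apply k j⟩
  have := ((hΘ ρ).mul (hΨ ρ)).eq_of_deriv_zero (Eventually.of_forall fun x => by
    simp only [neg_mul, Matrix.mul_assoc, neg_add_cancel]) hx
  simpa [hΨ0, hΦ0] using this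

/-- Uniqueness for linear systems: every solution is the fundamental matrix times its initial
value. -/
theorem MatAC.eq_fundamental_mul {c : Type*} {B Ψ Θ : ℝ → Matrix n n ℂ}
    (hΘ : MatAC Θ (fun x => -(Θ x * B x))) (h1 : ∀ x ∈ Icc 0 π, Θ x * Ψ x = 1)
    (hΘ0 : Θ 0 = 1) {Z : ℝ → Matrix n c ℂ} (hZ : MatAC Z (fun x => B x * Z x)) {x : ℝ}
    (hx : x ∈ Icc 0 π) : Z x = Ψ x * Z 0 := by
  have h := (hΘ.mul hZ).eq_of_deriv_zero (Eventually.of_forall fun x => by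
    simp only [Matrix.neg_mul, Matrix.mul_assoc, neg_add_cancel]) hx
  simp only [hΘ0, Matrix.one_mul] at h
  rw [← h, ← Matrix.mul_assoc, mul_eq_one_comm.1 (h1 x hx), Matrix.one_mul]

end Fundamental

/-! ### The fundamental matrix of the pencil and the Weyl matrix -/

namespace MatrixPencil

variable {m : ℕ} (L : MatrixPencil m)

/-- The coefficient matrix of the first order system for the stacked vector `(Y, Y')`. -/
def sysMatrix (ρ : ℂ) (x : ℝ) : Matrix (Fin m ⊕ Fin m) (Fin m ⊕ Fin m) ℂ :=
  fromBlocks 0 1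
    (-(ρ ^ 2 • (1 : Matrix (Fin m) (Fin m) ℂ) + (2 * Complex.I * ρ) • L.Q₁ x + L.Q₀ x)) 0

theorem intervalIntegrable_Q₀ (j k : Fin m) :
    IntervalIntegrable (fun x => L.Q₀ x j k) volume 0 π :=
  (intervalIntegrable_iff_integrableOn_Icc_of_le Real.pi_pos.le).2 (L.integrable_Q₀ j k)

theorem continuousOn_Q₁ : ContinuousOn L.Q₁ (Icc 0 π) := by
  refine continuousOn_pi.2 fun j => continuousOn_pi.2 fun k => ?_
  have := (L.absCont_Q₁ j k).continuousOn
  rwa [uIcc_of_le Real.pi_pos.le] at this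

theorem intervalIntegrable_Q₁ (j k : Fin m) :
    IntervalIntegrable (fun x => L.Q₁ x j k) volume 0 π :=
  (L.continuousOn_Q₁.matrix_apply j k).intervalIntegrable_of_Icc Real.pi_pos.le

/-- The coefficient matrix of the pencil is a quadratic polynomial in `ρ` with integrable
coefficients. -/
theorem exists_fund : ∃ Ψ Θ : ℂ → ℝ → Matrix (Fin m ⊕ Fin m) (Fin m ⊕ Fin m) ℂ,
      (∀ ρ, MatAC (Ψ ρ) (fun x => L.sysMatrix ρ x * Ψ ρ x)) ∧
      (∀ ρ, MatAC (Θ ρ) (fun x => -(Θ ρ x * L.sysMatrix ρ x))) ∧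
      (∀ ρ, Ψ ρ 0 = 1) ∧ (∀ ρ, Θ ρ 0 = 1) ∧
      (∀ ρ, ∀ x ∈ Icc 0 π, Θ ρ x * Ψ ρ x = 1) ∧
      (∀ x, Differentiable ℂ (fun ρ => Ψ ρ x)) ∧
      ∀ x j k, Differentiable ℂ (fun ρ => Θ ρ x j k) := by
  have h : ∀ ρ x, L.sysMatrix ρ x = fromBlocks 0 1 (-(L.Q₀ x)) 0 +
      ρ • fromBlocks 0 0 (-(2 * Complex.I) • L.Q₁ x) 0 + ρ ^ 2 • fromBlocks 0 0 (-1) 0 := by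
    intro ρ x
    rw [sysMatrix, fromBlocks_smul, fromBlocks_smul, fromBlocks_add, fromBlocks_add]
    simp only [smul_zero, add_zero]
    congr 1
    ext j k
    simp only [Matrix.add_apply, Matrix.neg_apply, Matrix.smul_apply, smul_eq_mul]
    ring
  simp only [h]
  refine exists_fundamental ?_ ?_ ?_
  · rintro (j | j) (k | k)
    · exact intervalIntegrable_const
    · exact intervalIntegrable_const
    · exact (L.intervalIntegrable_Q₀ j k).neg
    · exact intervalIntegrable_const
  · rintro (j | j) (k | k)
    · exact intervalIntegrable_const
    · exact intervalIntegrable_const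
    · exact (L.intervalIntegrable_Q₁ j k).const_mul _
    · exact intervalIntegrable_const
  · exact fun j k => intervalIntegrable_const

/-- The fundamental matrix `Ψ(x, ρ)` of the first order system, with `Ψ(0, ρ) = 1`. -/
def fund : ℂ → ℝ → Matrix (Fin m ⊕ Fin m) (Fin m ⊕ Fin m) ℂ := L.exists_fund.choose

/-- The inverse of the fundamental matrix. -/
def fundInv : ℂ → ℝ → Matrix (Fin m ⊕ Fin m) (Fin m ⊕ Fin m) ℂ :=
  L.exists_fund.choose_spec.choose

theorem fund_ac (ρ : ℂ) : MatAC (L.fund ρ) (fun x => L.sysMatrix ρ x * L.fund ρ x) :=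
  L.exists_fund.choose_spec.choose_spec.1 ρ

theorem fundInv_ac (ρ : ℂ) : MatAC (L.fundInv ρ) (fun x => -(L.fundInv ρ x * L.sysMatrix ρ x)) :=
  L.exists_fund.choose_spec.choose_spec.2.1 ρ

theorem fund_zero (ρ : ℂ) : L.fund ρ 0 = 1 := L.exists_fund.choose_spec.choose_spec.2.2.1 ρ

theorem fundInv_zero (ρ : ℂ) : L.fundInv ρ 0 = 1 := L.exists_fund.choose_spec.choose_spec.2.2.2.1 ρ

theorem fundInv_mul_fund (ρ : ℂ) {x : ℝ} (hx : x ∈ Icc 0 π) : L.fundInv ρ x * L.fund ρ x = 1 :=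
  L.exists_fund.choose_spec.choose_spec.2.2.2.2.1 ρ x hx

theorem fund_mul_fundInv (ρ : ℂ) {x : ℝ} (hx : x ∈ Icc 0 π) : L.fund ρ x * L.fundInv ρ x = 1 :=
  mul_eq_one_comm.1 (L.fundInv_mul_fund ρ hx)

theorem differentiable_fund (x : ℝ) (j k) : Differentiable ℂ fun ρ => L.fund ρ x j k :=
  (L.exists_fund.choose_spec.choose_spec.2.2.2.2.2.1 x).matrix_apply j k

theorem differentiable_fundInv (x : ℝ) (j k) : Differentiable ℂ fun ρ => L.fundInv ρ x j k :=
  L.exists_fund.choose_spec.choose_spec.2.2.2.2.2.2 x j k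

theorem eq_fund_mul {c : Type*} {ρ : ℂ} {Z : ℝ → Matrix (Fin m ⊕ Fin m) c ℂ}
    (hZ : MatAC Z (fun x => L.sysMatrix ρ x * Z x)) {x : ℝ} (hx : x ∈ Icc 0 π) :
    Z x = L.fund ρ x * Z 0 :=
  MatAC.eq_fundamental_mul (L.fundInv_ac ρ) (fun _ hx => L.fundInv_mul_fund ρ hx)
    (L.fundInv_zero ρ) hZ hx

theorem sysMatrix_mul_fromRows {c : Type*} (ρ : ℂ) (x : ℝ) (Y Y' : Matrix (Fin m) c ℂ) :
    L.sysMatrix ρ x * fromRows Y Y' = fromRows Y'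
      (-((ρ ^ 2 • (1 : Matrix (Fin m) (Fin m) ℂ) + (2 * Complex.I * ρ) • L.Q₁ x + L.Q₀ x) * Y)) := by
  rw [sysMatrix, fromBlocks_mul_fromRows]
  simp [-neg_add_rev]

variable {L}

theorem IsSolution.matAC {κ : Type} {ρ : ℂ} {Y Y' : ℝ → Matrix (Fin m) κ ℂ} [Finite κ]
    (h : L.IsSolution ρ Y Y') :
    MatAC (fun x => fromRows (Y x) (Y' x))
      (fun x => L.sysMatrix ρ x * fromRows (Y x) (Y' x)) := by
  have hc : ContinuousOn Y' (Icc 0 π) := by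
    refine continuousOn_pi.2 fun j => continuousOn_pi.2 fun k => ?_
    have := (h.absCont j k).continuousOn
    rwa [uIcc_of_le Real.pi_pos.le] at this
  have h1 : MatAC Y Y' := .of_hasDerivWithinAt h.hasDeriv hc
  have h2 : MatAC Y' (fun x => -((ρ ^ 2 • (1 : Matrix (Fin m) (Fin m) ℂ) +
      (2 * Complex.I * ρ) • L.Q₁ x + L.Q₀ x) * Y x)) := by
    refine ⟨h.absCont, ?_⟩
    filter_upwards [h.equation] with x ⟨Y'', h3, h4⟩ j k
    rw [← eq_neg_of_add_eq_zero_left h4]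
    exact h3 j k
  simpa only [sysMatrix_mul_fromRows] using h1.fromRows h2

theorem isSolution_of_matAC {κ : Type} [Finite κ] {ρ : ℂ} {Z : ℝ → Matrix (Fin m ⊕ Fin m) κ ℂ}
    (hZ : MatAC Z (fun x => L.sysMatrix ρ x * Z x)) :
    L.IsSolution ρ (fun x => (Z x).toRows₁) (fun x => (Z x).toRows₂) := by
  have e : ∀ x, L.sysMatrix ρ x * Z x = fromRows (Z x).toRows₂
      (-((ρ ^ 2 • (1 : Matrix (Fin m) (Fin m) ℂ) + (2 * Complex.I * ρ) • L.Q₁ x + L.Q₀ x) *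
        (Z x).toRows₁)) := fun x => by
    rw [← sysMatrix_mul_fromRows, fromRows_toRows]
  simp only [e] at hZ
  have h1 : MatAC (fun x => (Z x).toRows₁) (fun x => (Z x).toRows₂) :=
    hZ.submatrix Sum.inl id
  have h2 := hZ.submatrix Sum.inr id
  refine ⟨fun x hx j k => h1.hasDerivWithinAt ?_ hx j k, h2.ac, ?_⟩
  · exact h2.continuousOn
  · filter_upwards [h2.deriv] with x h3
    exact ⟨_, h3, neg_add_cancel _⟩

theorem IsSolution.eq_fund_mul {κ : Type} [Finite κ] {ρ : ℂ} {Y Y' : ℝ → Matrix (Fin m) κ ℂ}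
    (h : L.IsSolution ρ Y Y') {x : ℝ} (hx : x ∈ Icc 0 π) :
    fromRows (Y x) (Y' x) = L.fund ρ x * fromRows (Y 0) (Y' 0) :=
  L.eq_fund_mul h.matAC hx

variable (L)

theorem fund_mul_ac {c : Type*} (ρ : ℂ) (C : Matrix (Fin m ⊕ Fin m) c ℂ) :
    MatAC (fun x => L.fund ρ x * C) (fun x => L.sysMatrix ρ x * (L.fund ρ x * C)) := by
  simpa only [Matrix.mul_zero, add_zero, Matrix.mul_assoc] using
    (L.fund_ac ρ).mul (MatAC.const C)

/-- The matrix of the linear boundary form `V` acting on `(Y(π), Y'(π))`. -/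
def formV (ρ : ℂ) : Matrix (Fin m) (Fin m ⊕ Fin m) ℂ :=
  fromCols ((Complex.I * ρ) • L.H₁ + L.H₀) 1

/-- The initial data `(φ(0), φ'(0))`. -/
def initPhi (ρ : ℂ) : Matrix (Fin m ⊕ Fin m) (Fin m) ℂ :=
  fromRows 1 (-((Complex.I * ρ) • L.h₁ + L.h₀))

/-- The initial data `(S(0), S'(0)) = (0, I)`, so that `U(S) = I`. -/
def initS (m : ℕ) : Matrix (Fin m ⊕ Fin m) (Fin m) ℂ := fromRows 0 1

/-- The characteristic matrix `V(φ)`. -/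
def charMatrix (ρ : ℂ) : Matrix (Fin m) (Fin m) ℂ :=
  L.formV ρ * (L.fund ρ π * L.initPhi ρ)

/-- The matrix `V(S)`. -/
def matrixVS (ρ : ℂ) : Matrix (Fin m) (Fin m) ℂ :=
  L.formV ρ * (L.fund ρ π * initS m)

theorem V_eq {κ : Type} (ρ : ℂ) (Y Y' : ℝ → Matrix (Fin m) κ ℂ) :
    L.V ρ Y Y' = L.formV ρ * fromRows (Y π) (Y' π) := by
  rw [formV, fromCols_mul_fromRows, V, Matrix.one_mul, add_comm]

/-- The initial data of a solution are determined by `Y(0)` and `U(Y)`; accordingly, every solution is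
`φ Y(0) + S U(Y)`. -/
theorem init_eq_of_U_eq {κ : Type} {ρ : ℂ} {Y Y' : ℝ → Matrix (Fin m) κ ℂ}
    {C : Matrix (Fin m) κ ℂ} (h : L.U ρ Y Y' = C) :
    fromRows (Y 0) (Y' 0) = L.initPhi ρ * Y 0 + initS m * C := by
  rw [initPhi, initS, fromRows_mul, fromRows_mul, ← h, U]
  ext (j | j) k <;> simp [-neg_add_rev]

/-- The solution with `Y(0) = A` and `U(Y) = C`. -/
def solY {κ : Type} (ρ : ℂ) (A C : Matrix (Fin m) κ ℂ) : ℝ → Matrix (Fin m) κ ℂ :=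
  fun x => (L.fund ρ x * (L.initPhi ρ * A + initS m * C)).toRows₁

/-- The derivative of the solution with `Y(0) = A` and `U(Y) = C`. -/
def solY' {κ : Type} (ρ : ℂ) (A C : Matrix (Fin m) κ ℂ) : ℝ → Matrix (Fin m) κ ℂ :=
  fun x => (L.fund ρ x * (L.initPhi ρ * A + initS m * C)).toRows₂

theorem isSolution_solY {κ : Type} [Finite κ] (ρ : ℂ) (A C : Matrix (Fin m) κ ℂ) :
    L.IsSolution ρ (L.solY ρ A C) (L.solY' ρ A C) :=
  isSolution_of_matAC (L.fund_mul_ac ρ _)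

theorem stack_solY_zero {κ : Type} (ρ : ℂ) (A C : Matrix (Fin m) κ ℂ) :
    L.fund ρ 0 * (L.initPhi ρ * A + initS m * C) =
      fromRows A (-(((Complex.I * ρ) • L.h₁ + L.h₀) * A) + C) := by
  rw [fund_zero, Matrix.one_mul, initPhi, initS, fromRows_mul, fromRows_mul]
  ext (j | j) k <;> simp [-neg_add_rev, Matrix.neg_mul]

theorem solY_zero {κ : Type} (ρ : ℂ) (A C : Matrix (Fin m) κ ℂ) : L.solY ρ A C 0 = A := by
  rw [solY, stack_solY_zero, toRows₁_fromRows]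

theorem U_solY {κ : Type} (ρ : ℂ) (A C : Matrix (Fin m) κ ℂ) :
    L.U ρ (L.solY ρ A C) (L.solY' ρ A C) = C := by
  rw [U, solY_zero, solY', stack_solY_zero, toRows₂_fromRows]
  abel

theorem V_solY {κ : Type} (ρ : ℂ) (A C : Matrix (Fin m) κ ℂ) :
    L.V ρ (L.solY ρ A C) (L.solY' ρ A C) = L.charMatrix ρ * A + L.matrixVS ρ * C := by
  rw [V_eq, solY, solY', fromRows_toRows, charMatrix, matrixVS]
  simp only [Matrix.mul_add, Matrix.mul_assoc]

theorem V_eq_of_U_eq {κ : Type} [Finite κ] {ρ : ℂ} {Y Y' : ℝ → Matrix (Fin m) κ ℂ}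
    (hs : L.IsSolution ρ Y Y') {C : Matrix (Fin m) κ ℂ} (h : L.U ρ Y Y' = C) :
    L.V ρ Y Y' = L.charMatrix ρ * Y 0 + L.matrixVS ρ * C := by
  rw [V_eq, hs.eq_fund_mul (right_mem_Icc.2 Real.pi_pos.le), L.init_eq_of_U_eq h, charMatrix,
    matrixVS]
  simp only [Matrix.mul_add, Matrix.mul_assoc]

theorem phi_spec (ρ : ℂ) : L.IsSolution ρ (L.phi ρ).1 (L.phi ρ).2 ∧ (L.phi ρ).1 0 = 1 ∧
    L.U ρ (L.phi ρ).1 (L.phi ρ).2 = 0 := by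
  refine Classical.epsilon_spec (p := fun p : (ℝ → Matrix (Fin m) (Fin m) ℂ) ×
    (ℝ → Matrix (Fin m) (Fin m) ℂ) => L.IsSolution ρ p.1 p.2 ∧ p.1 0 = 1 ∧ L.U ρ p.1 p.2 = 0)
    ⟨⟨L.solY ρ 1 0, L.solY' ρ 1 0⟩, L.isSolution_solY ρ 1 0, L.solY_zero ρ 1 0, L.U_solY ρ 1 0⟩

theorem charFun_eq (ρ : ℂ) : L.charFun ρ = (L.charMatrix ρ).det := by
  obtain ⟨h1, h2, h3⟩ := L.phi_spec ρ
  rw [charFun, L.V_eq_of_U_eq h1 h3, h2, Matrix.mul_one, Matrix.mul_zero, add_zero]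

theorem weylSolution_spec {ρ : ℂ} (h : L.charFun ρ ≠ 0) :
    L.IsSolution ρ (L.weylSolution ρ).1 (L.weylSolution ρ).2 ∧
      L.U ρ (L.weylSolution ρ).1 (L.weylSolution ρ).2 = 1 ∧
      L.V ρ (L.weylSolution ρ).1 (L.weylSolution ρ).2 = 0 := by
  rw [charFun_eq] at h
  refine Classical.epsilon_spec (p := fun p : (ℝ → Matrix (Fin m) (Fin m) ℂ) ×
    (ℝ → Matrix (Fin m) (Fin m) ℂ) => L.IsSolution ρ p.1 p.2 ∧ L.U ρ p.1 p.2 = 1 ∧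
      L.V ρ p.1 p.2 = 0) ⟨⟨L.solY ρ (-((L.charMatrix ρ)⁻¹ * L.matrixVS ρ)) 1,
      L.solY' ρ (-((L.charMatrix ρ)⁻¹ * L.matrixVS ρ)) 1⟩, L.isSolution_solY ρ _ 1,
      L.U_solY ρ _ 1, ?_⟩
  rw [L.V_solY, Matrix.mul_neg, ← Matrix.mul_assoc, Matrix.mul_nonsing_inv _ h.isUnit,
    Matrix.one_mul, Matrix.mul_one, neg_add_cancel]

/-- The Weyl solution is `φ M + S`, so that `V(φ) M + V(S) = 0`. -/
theorem weylMatrix_eq {ρ : ℂ} (h : L.charFun ρ ≠ 0) :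
    L.weylMatrix ρ = -((L.charMatrix ρ)⁻¹ * L.matrixVS ρ) := by
  obtain ⟨h1, h2, h3⟩ := L.weylSolution_spec h
  have hu : IsUnit (L.charMatrix ρ).det := by rw [← charFun_eq]; exact h.isUnit
  have h4 : (0 : Matrix (Fin m) (Fin m) ℂ) =
      L.charMatrix ρ * L.weylMatrix ρ + L.matrixVS ρ := by
    rw [← h3, L.V_eq_of_U_eq h1 h2, Matrix.mul_one, weylMatrix]
  have h5 := congrArg ((L.charMatrix ρ)⁻¹ * ·) h4
  simp only [Matrix.mul_zero, Matrix.mul_add, ← Matrix.mul_assoc, Matrix.nonsing_inv_mul _ hu,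
    Matrix.one_mul] at h5
  exact eq_neg_of_add_eq_zero_left h5.symm

/-- An eigenfunction is `φ` applied to a kernel vector of `V(φ)`. -/
theorem isEigenvalue_iff (ρ : ℂ) : L.IsEigenvalue ρ ↔ L.charFun ρ = 0 := by
  constructor
  · rintro ⟨Y, Y', hs, hU, hV, x, hx, hne⟩
    by_contra h
    rw [charFun_eq] at h
    have h1 := L.V_eq_of_U_eq hs hU
    rw [hV, Matrix.mul_zero, add_zero] at h1
    have h2 : Y 0 = 0 := by
      rw [← Matrix.one_mul (Y 0), ← Matrix.nonsing_inv_mul _ (Ne.isUnit h), Matrix.mul_assoc, ← h1,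
        Matrix.mul_zero]
    have h3 := hs.eq_fund_mul hx
    rw [L.init_eq_of_U_eq hU, h2, Matrix.mul_zero, Matrix.mul_zero, add_zero, Matrix.mul_zero] at h3
    refine hne ?_
    ext j k
    exact congrFun₂ h3 (Sum.inl j) k
  · intro h
    rw [charFun_eq] at h
    obtain ⟨v, hv, hv'⟩ := Matrix.exists_mulVec_eq_zero_iff.2 h
    have hv'' : L.charMatrix ρ * replicateCol Unit v = 0 := by
      rw [← replicateCol_mulVec, hv']
      rfl
    refine ⟨L.solY ρ (replicateCol Unit v) 0, L.solY' ρ (replicateCol Unit v) 0,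
      L.isSolution_solY ρ _ 0, L.U_solY ρ _ 0, ?_, 0, left_mem_Icc.2 Real.pi_pos.le, ?_⟩
    · rw [L.V_solY, hv'', Matrix.mul_zero, add_zero]
    · rw [solY_zero]
      exact fun h0 => hv (funext fun j => congrFun₂ h0 j ())

theorem differentiable_formV (j k) : Differentiable ℂ fun ρ => L.formV ρ j k := by
  rcases k with k | k
  · simp only [formV, fromCols_apply_inl, Matrix.add_apply, Matrix.smul_apply, smul_eq_mul]
    fun_prop
  · simp only [formV, fromCols_apply_inr]
    fun_prop

theorem differentiable_initPhi (j k) : Differentiable ℂ fun ρ => L.initPhi ρ j k := by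
  rcases j with j | j
  · simp only [initPhi, fromRows_apply_inl]
    fun_prop
  · simp only [initPhi, fromRows_apply_inr, Matrix.neg_apply, Matrix.add_apply, Matrix.smul_apply,
      smul_eq_mul]
    fun_prop

theorem differentiable_charMatrix (j k) : Differentiable ℂ fun ρ => L.charMatrix ρ j k := by
  simp only [charMatrix, Matrix.mul_apply]
  have h1 := L.differentiable_formV
  have h2 := L.differentiable_fund π
  have h3 := L.differentiable_initPhi
  fun_prop

theorem differentiable_matrixVS (j k) : Differentiable ℂ fun ρ => L.matrixVS ρ j k := by
  simp only [matrixVS, Matrix.mul_apply]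
  have h1 := L.differentiable_formV
  have h2 := L.differentiable_fund π
  fun_prop

theorem differentiable_charFun : Differentiable ℂ L.charFun := by
  have h : L.charFun = fun ρ => (L.charMatrix ρ).det := funext L.charFun_eq
  have h1 := L.differentiable_charMatrix
  rw [h]
  simp only [Matrix.det_apply]
  fun_prop

/-- The stacked matrix `(B; C)` with `V(φ) B + V(S) C = 1`. -/
def bezout (ρ : ℂ) : Matrix (Fin m ⊕ Fin m) (Fin m) ℂ :=
  (fromBlocks 1 0 ((Complex.I * ρ) • L.h₁ + L.h₀) 1 :
    Matrix (Fin m ⊕ Fin m) (Fin m ⊕ Fin m) ℂ) * (L.fundInv ρ π * initS m)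

/-- The pair `(B; C)` consists of initial data, relative to `φ` and `S`, of the solution with `Y(π) = 0`
and `V(Y) = 1`. -/
theorem bezout_spec (ρ : ℂ) :
    L.charMatrix ρ * (L.bezout ρ).toRows₁ + L.matrixVS ρ * (L.bezout ρ).toRows₂ = 1 := by
  have h1 : L.initPhi ρ * (L.bezout ρ).toRows₁ + initS m * (L.bezout ρ).toRows₂ =
      L.fundInv ρ π * initS m := by
    have : fromCols (L.initPhi ρ) (initS m) = fromBlocks 1 0
        (-((Complex.I * ρ) • L.h₁ + L.h₀)) 1 := by
      ext (j | j) (k | k) <;> simp [initPhi, initS]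
    rw [← fromCols_mul_fromRows, fromRows_toRows, this, bezout, ← Matrix.mul_assoc,
      fromBlocks_multiply]
    simp
  rw [charMatrix, matrixVS, Matrix.mul_assoc, Matrix.mul_assoc, Matrix.mul_assoc, Matrix.mul_assoc,
    ← Matrix.mul_add, ← Matrix.mul_add, h1, ← Matrix.mul_assoc (L.fund ρ π),
    L.fund_mul_fundInv ρ (right_mem_Icc.2 Real.pi_pos.le), Matrix.one_mul, formV, initS,
    fromCols_mul_fromRows]
  simp

theorem differentiable_bezout (j k) : Differentiable ℂ fun ρ => L.bezout ρ j k := by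
  simp only [bezout, Matrix.mul_apply]
  have h1 : ∀ j k, Differentiable ℂ fun ρ : ℂ => fromBlocks (1 : Matrix (Fin m) (Fin m) ℂ) 0
      ((Complex.I * ρ) • L.h₁ + L.h₀) (1 : Matrix (Fin m) (Fin m) ℂ) j k := by
    rintro (j | j) (k | k)
    · simp only [fromBlocks_apply₁₁]; fun_prop
    · simp only [fromBlocks_apply₁₂]; fun_prop
    · simp only [fromBlocks_apply₂₁, Matrix.add_apply, Matrix.smul_apply, smul_eq_mul]; fun_prop
    · simp only [fromBlocks_apply₂₂]; fun_prop
  have h2 := L.differentiable_fundInv π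
  fun_prop

/-- Since `V(φ)` and `V(S)` have no common left kernel, `V(φ)⁻¹` is controlled by the Weyl
matrix. -/
theorem inv_charMatrix_eq {ρ : ℂ} (h : L.charFun ρ ≠ 0) :
    (L.charMatrix ρ)⁻¹ = (L.bezout ρ).toRows₁ - L.weylMatrix ρ * (L.bezout ρ).toRows₂ := by
  have hu : IsUnit (L.charMatrix ρ).det := by rw [← charFun_eq]; exact h.isUnit
  rw [L.weylMatrix_eq h, Matrix.neg_mul, sub_neg_eq_add, Matrix.mul_assoc,
    ← Matrix.one_mul (L.bezout ρ).toRows₁, ← Matrix.nonsing_inv_mul _ hu, Matrix.mul_assoc,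
    ← Matrix.mul_add, L.bezout_spec, Matrix.mul_one]

end MatrixPencil

/-! ### The transport matrices `P₊` and `P₋` -/

section Cauchy

variable {m : ℕ} {Q : ℝ → Matrix (Fin m) (Fin m) ℂ}

theorem isCauchySolution_cauchySolution (hQ : ContinuousOn Q (Icc 0 π)) :
    IsCauchySolution Q (cauchySolution Q) := by
  have h0 : ∀ j k : Fin m, IntervalIntegrable (fun x : ℝ => (0 : ℝ → Matrix (Fin m) (Fin m) ℂ) x j k)
    volume 0 π := fun j k => intervalIntegrable_const
  obtain ⟨Ψ, -, hΨ, -, hΨ0, -⟩ := exists_fundamental (a₀ := Q)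
    (fun j k => (hQ.matrix_apply j k).intervalIntegrable_of_Icc Real.pi_pos.le) h0 h0
  refine Classical.epsilon_spec (p := fun P => IsCauchySolution Q P) ⟨Ψ 0, ?_, hΨ0 0⟩
  have h1 := hΨ 0
  simp only [Pi.zero_apply, smul_zero, add_zero] at h1
  exact fun x hx j k => h1.hasDerivWithinAt (hQ.mul h1.continuousOn) hx j k

theorem IsCauchySolution.continuousOn {P : ℝ → Matrix (Fin m) (Fin m) ℂ}
    (h : IsCauchySolution Q P) : ContinuousOn P (Icc 0 π) :=
  continuousOn_pi.2 fun j => continuousOn_pi.2 fun k x hx => (h.hasDeriv x hx j k).continuousWithinAt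

theorem IsCauchySolution.matAC {P : ℝ → Matrix (Fin m) (Fin m) ℂ} (h : IsCauchySolution Q P)
    (hQ : ContinuousOn Q (Icc 0 π)) : MatAC P (fun x => Q x * P x) :=
  .of_hasDerivWithinAt h.hasDeriv (hQ.mul h.continuousOn)

/-- A skew-Hermitian coefficient generates unitary transport matrices. -/
theorem IsCauchySolution.conjTranspose_mul_self {P : ℝ → Matrix (Fin m) (Fin m) ℂ}
    (h : IsCauchySolution Q P) (hQ : ContinuousOn Q (Icc 0 π))
    (hskew : ∀ᵐ x ∂volume.restrict (Icc 0 π), (Q x)ᴴ = -Q x) {x : ℝ} (hx : x ∈ Icc 0 π) :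
    (P x)ᴴ * P x = 1 := by
  have h1 := ((h.matAC hQ).conjTranspose.mul (h.matAC hQ)).eq_of_deriv_zero (by
    filter_upwards [hskew] with x hx
    rw [Matrix.conjTranspose_mul, hx, Matrix.mul_assoc, Matrix.neg_mul, Matrix.mul_neg,
      neg_add_cancel]) hx
  rw [h1, h.init]; simp

end Cauchy

/-! ### Block matrices and the operator norm -/

section BlockNorm

variable {n p q r s : Type*} [Fintype n] [Fintype p] [Fintype q] [Fintype r] [Fintype s]
  [DecidableEq n] [DecidableEq p] [DecidableEq q] [DecidableEq r] [DecidableEq s]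

theorem l2_opNorm_one_le : ‖(1 : Matrix n n ℂ)‖ ≤ 1 := by
  rw [← Matrix.diagonal_one, Matrix.l2_opNorm_diagonal]
  exact (pi_norm_le_iff_of_nonneg zero_le_one).2 fun _ => by simp

theorem l2_opNorm_le_one_of_isometry {A : Matrix p n ℂ} (h : Aᴴ * A = 1) : ‖A‖ ≤ 1 := by
  have h1 := Matrix.l2_opNorm_conjTranspose_mul_self A
  rw [h] at h1
  nlinarith [l2_opNorm_one_le (n := n), norm_nonneg A]

theorem l2_opNorm_fromRows_le (A : Matrix p r ℂ) (B : Matrix q r ℂ) :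
    ‖fromRows A B‖ ≤ ‖A‖ + ‖B‖ := by
  have h1 : ‖(fromRows 1 0 : Matrix (p ⊕ q) p ℂ)‖ ≤ 1 := l2_opNorm_le_one_of_isometry (by
    rw [conjTranspose_fromRows_eq_fromCols_conjTranspose, fromCols_mul_fromRows]; simp)
  have h2 : ‖(fromRows 0 1 : Matrix (p ⊕ q) q ℂ)‖ ≤ 1 := l2_opNorm_le_one_of_isometry (by
    rw [conjTranspose_fromRows_eq_fromCols_conjTranspose, fromCols_mul_fromRows]; simp)
  have h3 : fromRows A B = (fromRows 1 0 : Matrix (p ⊕ q) p ℂ) * A +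
      (fromRows 0 1 : Matrix (p ⊕ q) q ℂ) * B := by
    rw [fromRows_mul, fromRows_mul]
    ext (j | j) k <;> simp
  rw [h3]
  refine (norm_add_le _ _).trans (add_le_add ?_ ?_)
  · exact (Matrix.l2_opNorm_mul _ _).trans (mul_le_of_le_one_left (norm_nonneg _) h1)
  · exact (Matrix.l2_opNorm_mul _ _).trans (mul_le_of_le_one_left (norm_nonneg _) h2)

theorem l2_opNorm_fromCols_le (A : Matrix r p ℂ) (B : Matrix r q ℂ) :
    ‖fromCols A B‖ ≤ ‖A‖ + ‖B‖ := by
  rw [← l2_opNorm_conjTranspose, conjTranspose_fromCols_eq_fromRows_conjTranspose,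
    ← l2_opNorm_conjTranspose A, ← l2_opNorm_conjTranspose B]
  exact l2_opNorm_fromRows_le _ _

theorem l2_opNorm_fromBlocks_le (A : Matrix p r ℂ) (B : Matrix p s ℂ) (C : Matrix q r ℂ)
    (D : Matrix q s ℂ) : ‖fromBlocks A B C D‖ ≤ ‖A‖ + ‖B‖ + ‖C‖ + ‖D‖ := by
  rw [← fromRows_fromCols_eq_fromBlocks]
  linarith [l2_opNorm_fromRows_le (fromCols A B) (fromCols C D), l2_opNorm_fromCols_le A B,
    l2_opNorm_fromCols_le C D]

theorem norm_nonsing_inv_one_sub_le {X : Matrix n n ℂ} (h : ‖X‖ ≤ 1 / 2) :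
    IsUnit (1 - X) ∧ ‖(1 - X)⁻¹‖ ≤ 2 := by
  have : CompleteSpace (Matrix n n ℂ) := FiniteDimensional.complete ℂ _
  have hu : IsUnit (1 - X) := isUnit_one_sub_of_norm_lt_one (by linarith)
  refine ⟨hu, ?_⟩
  have h1 := Matrix.mul_nonsing_inv _ ((Matrix.isUnit_iff_isUnit_det _).1 hu)
  rw [sub_mul, one_mul, sub_eq_iff_eq_add] at h1
  have h2 : ‖(1 - X)⁻¹‖ ≤ 1 + 1 / 2 * ‖(1 - X)⁻¹‖ := by
    calc ‖(1 - X)⁻¹‖ = ‖1 + X * (1 - X)⁻¹‖ := by rw [← h1]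
      _ ≤ 1 + ‖X‖ * ‖(1 - X)⁻¹‖ := (norm_add_le _ _).trans
          (add_le_add l2_opNorm_one_le (norm_mul_le _ _))
      _ ≤ _ := by gcongr
  linarith

theorem ContinuousOn.nonsing_inv {X : Type*} [TopologicalSpace X] {F : X → Matrix n n ℂ}
    {t : Set X} (hF : ContinuousOn F t) (hu : ∀ x ∈ t, IsUnit (F x)) :
    ContinuousOn (fun x => (F x)⁻¹) t := by
  have : CompleteSpace (Matrix n n ℂ) := FiniteDimensional.complete ℂ _
  intro x hx
  have h := NormedRing.inverse_continuousAt (hu x hx).unit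
  simp only [Matrix.nonsing_inv_eq_ringInverse]
  exact ContinuousAt.comp_continuousWithinAt (f := F) h (hF x hx)

theorem intervalIntegrable_fromBlocks {A : ℝ → Matrix p r ℂ} {B : ℝ → Matrix p s ℂ}
    {C : ℝ → Matrix q r ℂ} {D : ℝ → Matrix q s ℂ} {a b : ℝ} (hA : IntervalIntegrable A volume a b)
    (hB : IntervalIntegrable B volume a b) (hC : IntervalIntegrable C volume a b)
    (hD : IntervalIntegrable D volume a b) :
    IntervalIntegrable (fun x => fromBlocks (A x) (B x) (C x) (D x)) volume a b := by
  rw [intervalIntegrable_matrix] at *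
  rintro (j | j) (k | k)
  exacts [hA j k, hB j k, hC j k, hD j k]

end BlockNorm

/-! ### Asymptotics of the fundamental matrix -/

theorem norm_cexp_mul_I_le (ρ : ℂ) {x : ℝ} (hx : 0 ≤ x) :
    ‖Complex.exp (Complex.I * ρ * x)‖ ≤ Real.exp (|ρ.im| * x) ∧
      ‖Complex.exp (-(Complex.I * ρ * x))‖ ≤ Real.exp (|ρ.im| * x) := by
  rw [Complex.norm_exp, Complex.norm_exp]
  constructor <;> apply Real.exp_le_exp.2 <;> simp
  · nlinarith [neg_le_abs ρ.im]
  · nlinarith [le_abs_self ρ.im]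

namespace MatrixPencil

variable {m : ℕ} (L : MatrixPencil m)

/-- The transport matrix `P₋`. -/
def Pm : ℝ → Matrix (Fin m) (Fin m) ℂ := cauchySolution fun x => -L.Q₁ x

/-- The transport matrix `P₊`. -/
def Pp : ℝ → Matrix (Fin m) (Fin m) ℂ := cauchySolution L.Q₁

theorem isCauchySolution_Pm : IsCauchySolution (fun x => -L.Q₁ x) L.Pm :=
  isCauchySolution_cauchySolution L.continuousOn_Q₁.neg

theorem isCauchySolution_Pp : IsCauchySolution L.Q₁ L.Pp :=
  isCauchySolution_cauchySolution L.continuousOn_Q₁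

variable {L}

theorem ConditionII.Pm_unitary (h : L.ConditionII) {x : ℝ} (hx : x ∈ Icc 0 π) :
    (L.Pm x)ᴴ * L.Pm x = 1 :=
  L.isCauchySolution_Pm.conjTranspose_mul_self L.continuousOn_Q₁.neg (by
    filter_upwards [h.1] with x hx
    rw [conjTranspose_neg, hx.1]) hx

theorem ConditionII.Pp_unitary (h : L.ConditionII) {x : ℝ} (hx : x ∈ Icc 0 π) :
    (L.Pp x)ᴴ * L.Pp x = 1 :=
  L.isCauchySolution_Pp.conjTranspose_mul_self L.continuousOn_Q₁ (by
    filter_upwards [h.1] with x hx using hx.1) hx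

theorem exists_deriv_Q₁ (L : MatrixPencil m) : ∃ Q₁' : ℝ → Matrix (Fin m) (Fin m) ℂ,
    IntervalIntegrable Q₁' volume 0 π ∧ MatAC L.Q₁ Q₁' := by
  choose f hf hd using fun j k => (L.absCont_Q₁ j k).exists_hasDerivAt_complex Real.pi_pos.le
  refine ⟨fun x => Matrix.of fun j k => f j k x, intervalIntegrable_matrix.2 hf, L.absCont_Q₁, ?_⟩
  have := ae_all_iff.2 fun j => ae_all_iff.2 fun k => hd j k
  filter_upwards [this] with x hx j k using hx j k

variable (L)

/-- The matrix `iρ - Q₁(x)`. -/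
def symb (ρ : ℂ) (x : ℝ) : Matrix (Fin m) (Fin m) ℂ := (Complex.I * ρ) • 1 - L.Q₁ x

/-- The change of variables `Y = α + β`, `Y' = (iρ - Q₁)(α - β)` splitting a solution into waves
running in opposite directions. -/
def waveT (ρ : ℂ) (x : ℝ) : Matrix (Fin m ⊕ Fin m) (Fin m ⊕ Fin m) ℂ :=
  fromBlocks 1 1 (L.symb ρ x) (-L.symb ρ x)

/-- The leading part of the propagator in the wave variables. -/
def waveF (ρ : ℂ) (x : ℝ) : Matrix (Fin m ⊕ Fin m) (Fin m ⊕ Fin m) ℂ :=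
  fromBlocks (Complex.exp (Complex.I * ρ * x) • L.Pm x) 0 0
    (Complex.exp (-(Complex.I * ρ * x)) • L.Pp x)

/-- The inverse of `waveF`. -/
def waveFinv (ρ : ℂ) (x : ℝ) : Matrix (Fin m ⊕ Fin m) (Fin m ⊕ Fin m) ℂ :=
  fromBlocks (Complex.exp (-(Complex.I * ρ * x)) • (L.Pm x)ᴴ) 0 0
    (Complex.exp (Complex.I * ρ * x) • (L.Pp x)ᴴ)

theorem exists_bound_Q₁ : ∃ q : ℝ, 0 ≤ q ∧ ∀ x ∈ Icc 0 π, ‖L.Q₁ x‖ ≤ q := by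
  obtain ⟨q, hq⟩ := isCompact_Icc.exists_bound_of_continuousOn L.continuousOn_Q₁
  exact ⟨max q 0, le_max_right _ _, fun x hx => (hq x hx).trans (le_max_left _ _)⟩

/-- For large `|ρ|` the term `iρ` dominates `Q₁`, so that `iρ - Q₁(x)` is invertible with an inverse of
order `1 / |ρ|`. -/
theorem symb_inv {q : ℝ} {ρ : ℂ} (hρ : 2 * q + 1 ≤ ‖ρ‖) {x : ℝ} (hx : ‖L.Q₁ x‖ ≤ q) :
    IsUnit (L.symb ρ x) ∧ ‖(L.symb ρ x)⁻¹‖ ≤ 2 / ‖ρ‖ := by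
  have hq : 0 ≤ q := (norm_nonneg _).trans hx
  have hρ0 : 0 < ‖ρ‖ := by linarith
  have hne : Complex.I * ρ ≠ 0 := mul_ne_zero Complex.I_ne_zero (norm_pos_iff.1 hρ0)
  have hn : ‖Complex.I * ρ‖ = ‖ρ‖ := by simp
  have h1 : ‖(Complex.I * ρ)⁻¹ • L.Q₁ x‖ ≤ 1 / 2 := by
    rw [norm_smul, norm_inv, hn, inv_mul_le_iff₀ hρ0]
    linarith
  obtain ⟨h2, h3⟩ := norm_nonsing_inv_one_sub_le h1
  have h4 : L.symb ρ x = (Complex.I * ρ) • (1 - (Complex.I * ρ)⁻¹ • L.Q₁ x) := by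
    rw [smul_sub, smul_smul, mul_inv_cancel₀ hne, one_smul, symb]
  have h6 : (1 - (Complex.I * ρ)⁻¹ • L.Q₁ x) * (1 - (Complex.I * ρ)⁻¹ • L.Q₁ x)⁻¹ = 1 :=
    Matrix.mul_nonsing_inv _ ((Matrix.isUnit_iff_isUnit_det _).1 h2)
  have h5 : L.symb ρ x * ((Complex.I * ρ)⁻¹ • (1 - (Complex.I * ρ)⁻¹ • L.Q₁ x)⁻¹) = 1 := by
    rw [h4, smul_mul_smul_comm, mul_inv_cancel₀ hne, one_smul, h6]
  refine ⟨(Matrix.isUnit_iff_isUnit_det _).2 (Matrix.isUnit_det_of_right_inverse h5), ?_⟩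
  rw [Matrix.inv_eq_right_inv h5, norm_smul, norm_inv, hn, ← div_eq_inv_mul]
  gcongr

theorem symb_mul_self (ρ : ℂ) (x : ℝ) : L.symb ρ x * L.symb ρ x =
    -(ρ ^ 2 • (1 : Matrix (Fin m) (Fin m) ℂ) + (2 * Complex.I * ρ) • L.Q₁ x) +
      L.Q₁ x * L.Q₁ x := by
  simp only [symb, mul_sub, sub_mul, one_mul, mul_one, smul_mul_assoc, mul_smul_comm]
  match_scalars
  · linear_combination ρ ^ 2 * Complex.I_sq
  · ring
  · ring

theorem hasDerivAt_cexp_mul (c : ℂ) (x : ℝ) :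
    HasDerivAt (fun t : ℝ => Complex.exp (c * t)) (c * Complex.exp (c * x)) x := by
  have := (((hasDerivAt_id (x : ℂ)).const_mul c).cexp).comp_ofReal
  simpa [mul_comm] using this

theorem absolutelyContinuousOnInterval_cexp (c : ℂ) :
    AbsolutelyContinuousOnInterval (fun t : ℝ => Complex.exp (c * t)) 0 π := by
  refine ContDiffOn.absolutelyContinuousOnInterval (ContDiff.contDiffOn ?_)
  exact (contDiff_const.mul Complex.ofRealCLM.contDiff).cexp

theorem waveF_ac (ρ : ℂ) : MatAC (L.waveF ρ)
    (fun x => fromBlocks (L.symb ρ x) 0 0 (-L.symb ρ x) * L.waveF ρ x) := by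
  have h1 := MatAC.smul (absolutelyContinuousOnInterval_cexp (Complex.I * ρ))
    (Eventually.of_forall (hasDerivAt_cexp_mul (Complex.I * ρ)))
    (L.isCauchySolution_Pm.matAC L.continuousOn_Q₁.neg)
  have h2 := MatAC.smul (absolutelyContinuousOnInterval_cexp (-(Complex.I * ρ)))
    (Eventually.of_forall (hasDerivAt_cexp_mul (-(Complex.I * ρ))))
    (L.isCauchySolution_Pp.matAC L.continuousOn_Q₁)
  have h3 := h1.fromBlocks (MatAC.const 0) (MatAC.const 0) h2
  simp only [neg_mul] at h3
  refine h3.congr_deriv (Eventually.of_forall fun x => ?_)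
  simp only [waveF, fromBlocks_multiply, symb, Matrix.mul_zero, Matrix.zero_mul, add_zero, zero_add,
    sub_mul, smul_mul_assoc, one_mul, Matrix.neg_mul, mul_smul_comm]
  congr 1 <;> module

theorem waveF_mul_waveFinv {L : MatrixPencil m} (hII : L.ConditionII) (ρ : ℂ) {x : ℝ}
    (hx : x ∈ Icc 0 π) : L.waveF ρ x * L.waveFinv ρ x = 1 := by
  rw [waveF, waveFinv, fromBlocks_multiply]
  simp only [smul_mul_smul_comm, ← Complex.exp_add, Matrix.mul_zero, Matrix.zero_mul, add_zero,
    zero_add, add_neg_cancel, neg_add_cancel, Complex.exp_zero, one_smul,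
    mul_eq_one_comm.1 (hII.Pm_unitary hx), mul_eq_one_comm.1 (hII.Pp_unitary hx),
    fromBlocks_one]

theorem ConditionII.norm_Pm_le {L : MatrixPencil m} (hII : L.ConditionII) {x : ℝ}
    (hx : x ∈ Icc 0 π) : ‖L.Pm x‖ ≤ 1 :=
  l2_opNorm_le_one_of_isometry (hII.Pm_unitary hx)

theorem ConditionII.norm_Pp_le {L : MatrixPencil m} (hII : L.ConditionII) {x : ℝ}
    (hx : x ∈ Icc 0 π) : ‖L.Pp x‖ ≤ 1 :=
  l2_opNorm_le_one_of_isometry (hII.Pp_unitary hx)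

theorem norm_waveF_le {L : MatrixPencil m} (hII : L.ConditionII) (ρ : ℂ) {x : ℝ}
    (hx : x ∈ Icc 0 π) : ‖L.waveF ρ x‖ ≤ 2 * Real.exp (|ρ.im| * x) := by
  refine (l2_opNorm_fromBlocks_le _ _ _ _).trans ?_
  simp only [norm_smul, norm_zero, add_zero, two_mul]
  obtain ⟨h1, h2⟩ := norm_cexp_mul_I_le ρ hx.1
  exact add_le_add ((mul_le_of_le_one_right (norm_nonneg _) (hII.norm_Pm_le hx)).trans h1)
    ((mul_le_of_le_one_right (norm_nonneg _) (hII.norm_Pp_le hx)).trans h2)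

/-- The propagator from `t` to `x ≥ t` grows at most like the exponential of `|Im ρ| (x - t)`, and not
just `|Im ρ| (x + t)`: the two waves do not mix, and the transport matrices are unitary. -/
theorem norm_waveF_mul_waveFinv_le {L : MatrixPencil m} (hII : L.ConditionII) (ρ : ℂ) {x t : ℝ}
    (hx : x ∈ Icc 0 π) (ht : t ∈ Icc 0 x) :
    ‖L.waveF ρ x * L.waveFinv ρ t‖ ≤ 2 * Real.exp (|ρ.im| * (x - t)) := by
  have ht' : t ∈ Icc 0 π := ⟨ht.1, ht.2.trans hx.2⟩
  obtain ⟨h1, h2⟩ := norm_cexp_mul_I_le ρ (sub_nonneg.2 ht.2)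
  have e : L.waveF ρ x * L.waveFinv ρ t =
      fromBlocks (Complex.exp (Complex.I * ρ * (x - t : ℝ)) • (L.Pm x * (L.Pm t)ᴴ)) 0 0
        (Complex.exp (-(Complex.I * ρ * (x - t : ℝ))) • (L.Pp x * (L.Pp t)ᴴ)) := by
    rw [waveF, waveFinv, fromBlocks_multiply]
    simp only [smul_mul_smul_comm, ← Complex.exp_add, Matrix.mul_zero, Matrix.zero_mul, add_zero,
      zero_add]
    congr 3 <;> push_cast <;> ring
  rw [e]
  refine (l2_opNorm_fromBlocks_le _ _ _ _).trans ?_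
  simp only [norm_smul, norm_zero, add_zero, two_mul]
  have h3 : ‖L.Pm x * (L.Pm t)ᴴ‖ ≤ 1 := (norm_mul_le _ _).trans (mul_le_one₀ (hII.norm_Pm_le hx)
    (norm_nonneg _) ((l2_opNorm_conjTranspose _).trans_le (hII.norm_Pm_le ht')))
  have h4 : ‖L.Pp x * (L.Pp t)ᴴ‖ ≤ 1 := (norm_mul_le _ _).trans (mul_le_one₀ (hII.norm_Pp_le hx)
    (norm_nonneg _) ((l2_opNorm_conjTranspose _).trans_le (hII.norm_Pp_le ht')))
  exact add_le_add ((mul_le_of_le_one_right (norm_nonneg _) h3).trans h1)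
    ((mul_le_of_le_one_right (norm_nonneg _) h4).trans h2)

end MatrixPencil

namespace MatrixPencil

variable {m : ℕ} (L : MatrixPencil m)

/-- The perturbation in the wave variables: `(α, β)' = (diag(iρ - Q₁, -iρ + Q₁) - S)(α, β)`,
with `s∓ = Q₀ + Q₁² ∓ Q₁'`. -/
def waveS (Q₁' : ℝ → Matrix (Fin m) (Fin m) ℂ) (ρ : ℂ) (x : ℝ) :
    Matrix (Fin m ⊕ Fin m) (Fin m ⊕ Fin m) ℂ :=
  (2⁻¹ : ℂ) • fromBlocks
    ((L.symb ρ x)⁻¹ * (L.Q₀ x + L.Q₁ x * L.Q₁ x - Q₁' x))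
    ((L.symb ρ x)⁻¹ * (L.Q₀ x + L.Q₁ x * L.Q₁ x + Q₁' x))
    (-((L.symb ρ x)⁻¹ * (L.Q₀ x + L.Q₁ x * L.Q₁ x - Q₁' x)))
    (-((L.symb ρ x)⁻¹ * (L.Q₀ x + L.Q₁ x * L.Q₁ x + Q₁' x)))

variable {L} in
/-- The algebraic identity expressing that `T` conjugates the system of the pencil to the wave
system. -/
theorem wave_conjugation (Q₁' : ℝ → Matrix (Fin m) (Fin m) ℂ) {ρ : ℂ} {x : ℝ}
    (hu : IsUnit (L.symb ρ x)) :
    fromBlocks 0 0 (-Q₁' x) (Q₁' x) + L.waveT ρ x * fromBlocks (L.symb ρ x) 0 0 (-L.symb ρ x) -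
      L.waveT ρ x * L.waveS Q₁' ρ x = L.sysMatrix ρ x * L.waveT ρ x := by
  have hR : ∀ X, L.symb ρ x * ((L.symb ρ x)⁻¹ * X) = X := fun X => by
    rw [← Matrix.mul_assoc, Matrix.mul_nonsing_inv _ ((Matrix.isUnit_iff_isUnit_det _).1 hu),
      Matrix.one_mul]
  have h2 := L.symb_mul_self ρ x
  rw [waveT, waveS, sysMatrix, Matrix.mul_smul, fromBlocks_multiply, fromBlocks_multiply,
    fromBlocks_multiply, fromBlocks_smul, fromBlocks_add, sub_eq_add_neg, fromBlocks_neg,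
    fromBlocks_add]
  simp only [Matrix.mul_zero, Matrix.zero_mul, add_zero, zero_add, Matrix.one_mul, Matrix.mul_one,
    Matrix.mul_neg, Matrix.neg_mul, neg_neg, hR, h2, add_neg_cancel, smul_zero, neg_zero]
  congr 1 <;> module

variable {L}

theorem intervalIntegrable_waveS {Q₁' : ℝ → Matrix (Fin m) (Fin m) ℂ}
    (hQ : IntervalIntegrable Q₁' volume 0 π) {ρ : ℂ}
    (hu : ∀ x ∈ Icc 0 π, IsUnit (L.symb ρ x)) :
    IntervalIntegrable (L.waveS Q₁' ρ) volume 0 π := by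
  have hsymb : ContinuousOn (L.symb ρ) (Icc 0 π) := continuousOn_const.sub L.continuousOn_Q₁
  have hinv : ContinuousOn (fun x => (L.symb ρ x)⁻¹) (uIcc 0 π) := by
    rw [uIcc_of_le Real.pi_pos.le]; exact hsymb.nonsing_inv hu
  have h0 : IntervalIntegrable L.Q₀ volume 0 π := intervalIntegrable_matrix.2 L.intervalIntegrable_Q₀
  have h1 : IntervalIntegrable (fun x => L.Q₁ x * L.Q₁ x) volume 0 π :=
    (L.continuousOn_Q₁.mul L.continuousOn_Q₁).intervalIntegrable_of_Icc Real.pi_pos.le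
  have ha := ((h0.add h1).sub hQ).continuousOn_mul hinv
  have hb := ((h0.add h1).add hQ).continuousOn_mul hinv
  exact (intervalIntegrable_fromBlocks ha hb ha.neg hb.neg).smul (2⁻¹ : ℂ)

theorem norm_waveS_le (Q₁' : ℝ → Matrix (Fin m) (Fin m) ℂ) {q : ℝ} {ρ : ℂ}
    (hρ : 2 * q + 1 ≤ ‖ρ‖) {x : ℝ} (hx : ‖L.Q₁ x‖ ≤ q) : ‖L.waveS Q₁' ρ x‖ ≤
      (2 * (‖L.Q₀ x + L.Q₁ x * L.Q₁ x - Q₁' x‖ + ‖L.Q₀ x + L.Q₁ x * L.Q₁ x + Q₁' x‖)) / ‖ρ‖ := by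
  obtain ⟨-, h⟩ := L.symb_inv hρ hx
  have h1 : ∀ X : Matrix (Fin m) (Fin m) ℂ, ‖(L.symb ρ x)⁻¹ * X‖ ≤ 2 / ‖ρ‖ * ‖X‖ := fun X =>
    (norm_mul_le _ _).trans (by gcongr)
  rw [waveS, norm_smul]
  have h2 := l2_opNorm_fromBlocks_le ((L.symb ρ x)⁻¹ * (L.Q₀ x + L.Q₁ x * L.Q₁ x - Q₁' x))
    ((L.symb ρ x)⁻¹ * (L.Q₀ x + L.Q₁ x * L.Q₁ x + Q₁' x))
    (-((L.symb ρ x)⁻¹ * (L.Q₀ x + L.Q₁ x * L.Q₁ x - Q₁' x)))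
    (-((L.symb ρ x)⁻¹ * (L.Q₀ x + L.Q₁ x * L.Q₁ x + Q₁' x)))
  rw [norm_neg, norm_neg] at h2
  have h3 := h1 (L.Q₀ x + L.Q₁ x * L.Q₁ x - Q₁' x)
  have h4 := h1 (L.Q₀ x + L.Q₁ x * L.Q₁ x + Q₁' x)
  have h5 : ‖(2⁻¹ : ℂ)‖ = 2⁻¹ := by norm_num
  rw [h5]
  calc _ ≤ 2⁻¹ * (2 * (2 / ‖ρ‖ * ‖L.Q₀ x + L.Q₁ x * L.Q₁ x - Q₁' x‖ +
        2 / ‖ρ‖ * ‖L.Q₀ x + L.Q₁ x * L.Q₁ x + Q₁' x‖)) := by linarith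
    _ = _ := by ring

theorem continuousOn_waveF (ρ : ℂ) : ContinuousOn (L.waveF ρ) (Icc 0 π) := (L.waveF_ac ρ).continuousOn

theorem continuousOn_waveFinv (hII : L.ConditionII) (ρ : ℂ) :
    ContinuousOn (L.waveFinv ρ) (Icc 0 π) := by
  have h : ∀ x ∈ Icc 0 π, (L.waveF ρ x)⁻¹ = L.waveFinv ρ x := fun x hx =>
    Matrix.inv_eq_right_inv (waveF_mul_waveFinv hII ρ hx)
  refine ((L.continuousOn_waveF ρ).nonsing_inv fun x hx => ?_).congr fun x hx => (h x hx).symm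
  exact (Matrix.isUnit_iff_isUnit_det _).2
    (Matrix.isUnit_det_of_right_inverse (waveF_mul_waveFinv hII ρ hx))

/-- In the wave variables the solution `Z` satisfies
`Z(x) = F(x) - ∫₀ˣ F(x) F(t)⁻¹ S(t) Z(t) dt`. -/
theorem exists_wave_solution (hII : L.ConditionII) {Q₁' : ℝ → Matrix (Fin m) (Fin m) ℂ}
    (hQi : IntervalIntegrable Q₁' volume 0 π) (hQ : MatAC L.Q₁ Q₁') {ρ : ℂ}
    (hu : ∀ x ∈ Icc 0 π, IsUnit (L.symb ρ x)) :
    ∃ Z : ℝ → Matrix (Fin m ⊕ Fin m) (Fin m ⊕ Fin m) ℂ, ContinuousOn Z (Icc 0 π) ∧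
      (∀ x ∈ Icc 0 π, L.fund ρ x * L.waveT ρ 0 = L.waveT ρ x * Z x) ∧
      ∀ x ∈ Icc 0 π, Z x = L.waveF ρ x -
        ∫ t in (0)..x, L.waveF ρ x * (L.waveFinv ρ t * (L.waveS Q₁' ρ t * Z t)) := by
  have hSi := intervalIntegrable_waveS hQi hu
  have hFc := L.continuousOn_waveF ρ
  have hGc := continuousOn_waveFinv hII ρ
  rw [← uIcc_of_le Real.pi_pos.le] at hFc hGc
  have hai : IntervalIntegrable (fun t => -(L.waveFinv ρ t * (L.waveS Q₁' ρ t * L.waveF ρ t)))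
      volume 0 π := ((hSi.mul_continuousOn hFc).continuousOn_mul hGc).neg
  have h0 : ∀ j k, IntervalIntegrable (fun x : ℝ =>
      (0 : ℝ → Matrix (Fin m ⊕ Fin m) (Fin m ⊕ Fin m) ℂ) x j k) volume 0 π :=
    fun j k => intervalIntegrable_const
  -- the propagator in the interaction picture
  obtain ⟨N, -, hN, -, hN0, -⟩ := exists_fundamental
    (fun j k => intervalIntegrable_matrix.1 hai j k) h0 h0
  have hN' := hN 0
  simp only [Pi.zero_apply, smul_zero, add_zero] at hN'
  have hF0 : L.waveF ρ 0 = 1 := by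
    simp [waveF, L.isCauchySolution_Pm.init, L.isCauchySolution_Pp.init]
  have hT : MatAC (L.waveT ρ) (fun x => fromBlocks 0 0 (-Q₁' x) (Q₁' x)) := by
    have h1 : MatAC (L.symb ρ) (fun x => -Q₁' x) := by
      have := (MatAC.const ((Complex.I * ρ) • 1)).sub hQ
      simp only [zero_sub] at this
      exact this
    have h2 := (MatAC.const (1 : Matrix (Fin m) (Fin m) ℂ)).fromBlocks
      (MatAC.const (1 : Matrix (Fin m) (Fin m) ℂ)) h1 h1.neg
    simp only [neg_neg] at h2
    exact h2
  have hZ := (L.waveF_ac ρ).mul hN'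
  refine ⟨fun x => L.waveF ρ x * N 0 x, hZ.continuousOn, fun x hx => ?_, fun x hx => ?_⟩
  · have h1 := hT.mul hZ
    have h2 := L.eq_fund_mul (h1.congr_deriv (G' := fun x => L.sysMatrix ρ x *
      (L.waveT ρ x * (L.waveF ρ x * N 0 x))) ?_) hx
    · rw [h2, hN0, hF0, Matrix.mul_one, Matrix.mul_one]
    · filter_upwards [ae_restrict_mem measurableSet_Icc] with x hx
      have e := wave_conjugation Q₁' (hu x hx)
      have e2 : L.waveF ρ x * (L.waveFinv ρ x * (L.waveS Q₁' ρ x * L.waveF ρ x)) =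
          L.waveS Q₁' ρ x * L.waveF ρ x := by
        rw [← Matrix.mul_assoc, waveF_mul_waveFinv hII ρ hx, Matrix.one_mul]
      rw [← Matrix.mul_assoc (L.sysMatrix ρ x), ← e, neg_mul, mul_neg, ← mul_assoc (L.waveF ρ x),
        e2]
      noncomm_ring
  · have hNi : IntervalIntegrable (fun t => -(L.waveFinv ρ t * (L.waveS Q₁' ρ t * L.waveF ρ t)) *
        N 0 t) volume 0 π := hai.mul_continuousOn (by
          rw [uIcc_of_le Real.pi_pos.le]; exact hN'.continuousOn)
    have h1 := hN'.eq_add_integral hNi hx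
    have h2 : ∀ t, L.waveF ρ x * (L.waveFinv ρ t * (L.waveS Q₁' ρ t * (L.waveF ρ t * N 0 t))) =
        -(L.waveF ρ x * (-(L.waveFinv ρ t * (L.waveS Q₁' ρ t * L.waveF ρ t)) * N 0 t)) := by
      intro t; noncomm_ring
    have : CompleteSpace (Matrix (Fin m ⊕ Fin m) (Fin m ⊕ Fin m) ℂ) := FiniteDimensional.complete ℂ _
    simp only [h2]
    rw [intervalIntegral.integral_neg, sub_neg_eq_add, h1, hN0, Matrix.mul_add, Matrix.mul_one]
    congr 1
    exact ((ContinuousLinearMap.mul ℂ (Matrix (Fin m ⊕ Fin m) (Fin m ⊕ Fin m) ℂ)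
      (L.waveF ρ x)).intervalIntegral_comp_comm (hNi.mono_Icc hx)).symm

/-- The asymptotics of the fundamental matrix in the wave variables, uniformly in `x` and in the
argument of `ρ`. -/
theorem exists_wave_asymptotics (hII : L.ConditionII) : ∃ C R : ℝ, 0 < C ∧ 1 ≤ R ∧ ∀ ρ : ℂ, R ≤ ‖ρ‖ →
    (∀ x ∈ Icc 0 π, IsUnit (L.symb ρ x) ∧ ‖(L.symb ρ x)⁻¹‖ ≤ 2 / ‖ρ‖) ∧
    ∃ Z : ℝ → Matrix (Fin m ⊕ Fin m) (Fin m ⊕ Fin m) ℂ, ContinuousOn Z (Icc 0 π) ∧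
      (∀ x ∈ Icc 0 π, L.fund ρ x * L.waveT ρ 0 = L.waveT ρ x * Z x) ∧
      ∀ x ∈ Icc 0 π, ‖Z x - L.waveF ρ x‖ ≤ C / ‖ρ‖ * Real.exp (|ρ.im| * x) := by
  obtain ⟨q, hq0, hq⟩ := L.exists_bound_Q₁
  obtain ⟨Q₁', hQi, hQ⟩ := L.exists_deriv_Q₁
  set σ : ℝ → ℝ := fun x =>
    2 * (‖L.Q₀ x + L.Q₁ x * L.Q₁ x - Q₁' x‖ + ‖L.Q₀ x + L.Q₁ x * L.Q₁ x + Q₁' x‖) with hσ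
  have hσ0 : ∀ x, 0 ≤ σ x := fun x => by positivity
  have hσi : IntervalIntegrable σ volume 0 π := by
    have h0 : IntervalIntegrable L.Q₀ volume 0 π :=
      intervalIntegrable_matrix.2 L.intervalIntegrable_Q₀
    have h1 : IntervalIntegrable (fun x => L.Q₁ x * L.Q₁ x) volume 0 π :=
      (L.continuousOn_Q₁.mul L.continuousOn_Q₁).intervalIntegrable_of_Icc Real.pi_pos.le
    exact (((h0.add h1).sub hQi).norm.add ((h0.add h1).add hQi).norm).const_mul 2
  set A := ∫ t in (0)..π, σ t with hA
  have hA0 : 0 ≤ A := intervalIntegral.integral_nonneg Real.pi_pos.le fun x _ => hσ0 x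
  refine ⟨8 * A + 1, 2 * q + 1 + 4 * A, by positivity, by linarith, fun ρ hρ => ?_⟩
  have hρq : 2 * q + 1 ≤ ‖ρ‖ := by linarith
  have hρ0 : 0 < ‖ρ‖ := by linarith
  have hu : ∀ x ∈ Icc 0 π, IsUnit (L.symb ρ x) ∧ ‖(L.symb ρ x)⁻¹‖ ≤ 2 / ‖ρ‖ := fun x hx =>
    L.symb_inv hρq (hq x hx)
  have hS : ∀ t ∈ Icc 0 π, ‖L.waveS Q₁' ρ t‖ ≤ σ t / ‖ρ‖ := fun t ht =>
    norm_waveS_le Q₁' hρq (hq t ht)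
  clear_value σ
  obtain ⟨Z, hZc, hZ1, hZ2⟩ := exists_wave_solution hII hQi hQ fun x hx => (hu x hx).1
  refine ⟨hu, Z, hZc, hZ1, ?_⟩
  -- the maximum `W` of `‖Z‖` relative to the exponential growth rate
  obtain ⟨x₀, hx₀, hmax⟩ := isCompact_Icc.exists_isMaxOn (nonempty_Icc.2 Real.pi_pos.le)
    (f := fun x => ‖Z x‖ * Real.exp (-(|ρ.im| * x))) (hZc.norm.mul (by fun_prop))
  set W := ‖Z x₀‖ * Real.exp (-(|ρ.im| * x₀)) with hW
  have hW0 : 0 ≤ W := by positivity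
  have hZW : ∀ t ∈ Icc 0 π, ‖Z t‖ ≤ W * Real.exp (|ρ.im| * t) := fun t ht => by
    have h1 : ‖Z t‖ * Real.exp (-(|ρ.im| * t)) ≤ W := hmax ht
    rwa [Real.exp_neg, ← div_eq_mul_inv, div_le_iff₀ (Real.exp_pos _)] at h1
  -- the integral equation bounds the deviation from the leading part by `W`
  have key : ∀ x ∈ Icc 0 π,
      ‖Z x - L.waveF ρ x‖ ≤ 2 * A / ‖ρ‖ * W * Real.exp (|ρ.im| * x) := fun x hx => by
    rw [hZ2 x hx, sub_sub_cancel_left, norm_neg]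
    have h1 : ‖∫ t in (0)..x, L.waveF ρ x * (L.waveFinv ρ t * (L.waveS Q₁' ρ t * Z t))‖ ≤
        ∫ t in (0)..x, σ t * (2 / ‖ρ‖ * W * Real.exp (|ρ.im| * x)) := by
      refine intervalIntegral.norm_integral_le_of_norm_le hx.1
        (Eventually.of_forall fun t ht => ?_) ((hσi.mono_Icc hx).mul_const _)
      have ht' : t ∈ Icc 0 x := ⟨ht.1.le, ht.2⟩
      have ht'' : t ∈ Icc 0 π := ⟨ht.1.le, ht.2.trans hx.2⟩
      have e : Real.exp (|ρ.im| * (x - t)) * Real.exp (|ρ.im| * t) = Real.exp (|ρ.im| * x) := by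
        rw [← Real.exp_add]; congr 1; ring
      calc _ = ‖L.waveF ρ x * L.waveFinv ρ t * (L.waveS Q₁' ρ t * Z t)‖ := by rw [mul_assoc]
        _ ≤ ‖L.waveF ρ x * L.waveFinv ρ t‖ * (‖L.waveS Q₁' ρ t‖ * ‖Z t‖) :=
            (norm_mul_le _ _).trans (mul_le_mul_of_nonneg_left (norm_mul_le _ _) (norm_nonneg _))
        _ ≤ 2 * Real.exp (|ρ.im| * (x - t)) * (σ t / ‖ρ‖ * (W * Real.exp (|ρ.im| * t))) :=
            mul_le_mul (norm_waveF_mul_waveFinv_le hII ρ hx ht')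
              (mul_le_mul (hS t ht'') (hZW t ht'') (norm_nonneg _)
                (div_nonneg (hσ0 t) hρ0.le)) (by positivity) (by positivity)
        _ = _ := by rw [← e]; ring
    refine h1.trans ?_
    rw [intervalIntegral.integral_mul_const]
    have h2 : ∫ t in (0)..x, σ t ≤ A := intervalIntegral.integral_mono_interval le_rfl hx.1 hx.2
      (Eventually.of_forall hσ0) hσi
    calc _ ≤ A * (2 / ‖ρ‖ * W * Real.exp (|ρ.im| * x)) := by gcongr
      _ = _ := by ring
  -- evaluating the bound at `x₀` gives `W ≤ 2 + W / 2` as soon as `4 A ≤ |ρ|`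
  have hW4 : W ≤ 4 := by
    have h1 : ‖Z x₀‖ ≤ (2 + 2 * A / ‖ρ‖ * W) * Real.exp (|ρ.im| * x₀) := by
      have := norm_waveF_le hII ρ hx₀
      have h2 := key x₀ hx₀
      have h3 : ‖Z x₀‖ ≤ ‖L.waveF ρ x₀‖ + ‖Z x₀ - L.waveF ρ x₀‖ := by
        simpa using norm_add_le (L.waveF ρ x₀) (Z x₀ - L.waveF ρ x₀)
      nlinarith
    have h2 : W ≤ 2 + 2 * A / ‖ρ‖ * W := by
      rw [hW, Real.exp_neg, ← div_eq_mul_inv, div_le_iff₀ (Real.exp_pos _)]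
      rwa [hW, Real.exp_neg, ← div_eq_mul_inv] at h1
    have h3 : 2 * A / ‖ρ‖ ≤ 1 / 2 := by
      rw [div_le_iff₀ hρ0]; linarith
    nlinarith
  intro x hx
  refine (key x hx).trans ?_
  gcongr
  calc 2 * A / ‖ρ‖ * W ≤ 2 * A / ‖ρ‖ * 4 := by gcongr
    _ = 8 * A / ‖ρ‖ := by ring
    _ ≤ _ := by gcongr; linarith

end MatrixPencil

/-! ### Asymptotics of the characteristic matrix -/

/-- Stability of a triple product whose factors are perturbed by a relative error `ε`; the middle factor
is allowed to be of the size `G`. -/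
theorem norm_mul_mul_sub_le {n p q r : Type*} [Fintype n] [Fintype p] [Fintype q] [Fintype r]
    [DecidableEq n] [DecidableEq p] [DecidableEq q] [DecidableEq r]
    {A A₁ : Matrix n p ℂ} {F E : Matrix p q ℂ} {B B₁ : Matrix q r ℂ} {a ε G : ℝ} (hε : 0 ≤ ε)
    (hε1 : ε ≤ 1) (hA : ‖A‖ ≤ a) (hA₁ : ‖A₁‖ ≤ a * ε) (hF : ‖F‖ ≤ a * G) (hE : ‖E‖ ≤ a * ε * G)
    (hB : ‖B‖ ≤ a) (hB₁ : ‖B₁‖ ≤ a * ε) :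
    ‖(A + A₁) * ((F + E) * (B + B₁)) - A * (F * B)‖ ≤ 7 * a ^ 3 * ε * G := by
  have ha : 0 ≤ a := (norm_nonneg _).trans hA
  have hG : 0 ≤ a * G := (norm_nonneg _).trans hF
  have hmul : ∀ {x y z : ℝ} (X : Matrix n p ℂ) (Y : Matrix p q ℂ) (Z : Matrix q r ℂ),
      ‖X‖ ≤ x → ‖Y‖ ≤ y → ‖Z‖ ≤ z → ‖X * (Y * Z)‖ ≤ x * (y * z) := by
    intro x y z X Y Z hx hy hz
    have hx0 : 0 ≤ x := (norm_nonneg _).trans hx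
    have hy0 : 0 ≤ y := (norm_nonneg _).trans hy
    exact (Matrix.l2_opNorm_mul _ _).trans (mul_le_mul hx ((Matrix.l2_opNorm_mul _ _).trans
      (mul_le_mul hy hz (norm_nonneg _) hy0)) (norm_nonneg _) hx0)
  have e : (A + A₁) * ((F + E) * (B + B₁)) - A * (F * B) = A₁ * (F * B) + A * (E * B) +
      A * (F * B₁) + A₁ * (E * B) + A₁ * (F * B₁) + A * (E * B₁) + A₁ * (E * B₁) := by
    simp only [Matrix.add_mul, Matrix.mul_add]; abel
  rw [e]
  have hεε : ε * ε ≤ ε := mul_le_of_le_one_left hε hε1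
  have hεεε : ε * ε * ε ≤ ε := (mul_le_mul_of_nonneg_right hεε hε).trans hεε
  have h3 : 0 ≤ a ^ 3 * G := by have := mul_nonneg (mul_nonneg ha ha) hG; nlinarith
  have h1 := hmul A₁ F B hA₁ hF hB
  have h2 := hmul A E B hA hE hB
  have h4 := hmul A F B₁ hA hF hB₁
  have h5 := hmul A₁ E B hA₁ hE hB
  have h6 := hmul A₁ F B₁ hA₁ hF hB₁
  have h7 := hmul A E B₁ hA hE hB₁
  have h8 := hmul A₁ E B₁ hA₁ hE hB₁
  have m2 := mul_le_mul_of_nonneg_left hεε h3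
  have m3 := mul_le_mul_of_nonneg_left hεεε h3
  refine (norm_add_le_of_le (norm_add_le_of_le (norm_add_le_of_le (norm_add_le_of_le
    (norm_add_le_of_le (norm_add_le_of_le h1 h2) h4) h5) h6) h7) h8).trans ?_
  linarith

namespace MatrixPencil

variable {m : ℕ} (L : MatrixPencil m)

/-- The leading part of `V(φ)`, up to the factor `iρ/2`. -/
def mainDelta (ρ : ℂ) : Matrix (Fin m) (Fin m) ℂ :=
  Complex.exp (Complex.I * ρ * π) • ((1 + L.H₁) * (L.Pm π * (1 - L.h₁))) -
    Complex.exp (-(Complex.I * ρ * π)) • ((1 - L.H₁) * (L.Pp π * (1 + L.h₁)))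

/-- The leading part of `V(S)`, up to the factor `1/2`. -/
def mainS (ρ : ℂ) : Matrix (Fin m) (Fin m) ℂ :=
  Complex.exp (Complex.I * ρ * π) • ((1 + L.H₁) * L.Pm π) +
    Complex.exp (-(Complex.I * ρ * π)) • ((1 - L.H₁) * L.Pp π)

theorem mainDelta_eq (ρ : ℂ) : L.mainDelta ρ = fromCols (1 + L.H₁) (L.H₁ - 1) *
    (L.waveF ρ π * fromRows (1 - L.h₁) (1 + L.h₁)) := by
  rw [waveF, fromBlocks_mul_fromRows, fromCols_mul_fromRows, mainDelta]
  simp only [Matrix.zero_mul, add_zero, zero_add, Matrix.smul_mul, Matrix.mul_smul]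
  rw [sub_eq_add_neg, ← smul_neg, ← Matrix.neg_mul, neg_sub]

theorem mainS_eq (ρ : ℂ) : L.mainS ρ = fromCols (1 + L.H₁) (L.H₁ - 1) *
    (L.waveF ρ π * fromRows (1 : Matrix (Fin m) (Fin m) ℂ) (-1 : Matrix (Fin m) (Fin m) ℂ)) := by
  rw [waveF, fromBlocks_mul_fromRows, fromCols_mul_fromRows, mainS]
  simp only [neg_zero, add_zero, zero_add, Matrix.mul_smul, Matrix.mul_one, Matrix.mul_neg]
  rw [← smul_neg, ← Matrix.neg_mul, neg_sub]

theorem symb_mul_inv {ρ : ℂ} {x : ℝ} (h : IsUnit (L.symb ρ x)) :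
    L.symb ρ x * (L.symb ρ x)⁻¹ = 1 :=
  Matrix.mul_nonsing_inv _ ((Matrix.isUnit_iff_isUnit_det _).1 h)

/-- The initial data of `φ` in the wave variables: the leading amplitudes are `(1 ∓ h₁)/2`. -/
theorem waveT_mul_eq_initPhi {ρ : ℂ} (h : IsUnit (L.symb ρ 0)) :
    L.waveT ρ 0 * ((2⁻¹ : ℂ) • (fromRows (1 - L.h₁) (1 + L.h₁) +
      fromRows (-((L.symb ρ 0)⁻¹ * (L.Q₁ 0 * L.h₁ + L.h₀)))
        ((L.symb ρ 0)⁻¹ * (L.Q₁ 0 * L.h₁ + L.h₀)))) = L.initPhi ρ := by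
  have hR : ∀ X, L.symb ρ 0 * ((L.symb ρ 0)⁻¹ * X) = X := fun X => by
    rw [← Matrix.mul_assoc, L.symb_mul_inv h, Matrix.one_mul]
  rw [Matrix.mul_smul, Matrix.mul_add, waveT, fromBlocks_mul_fromRows, fromBlocks_mul_fromRows,
    initPhi]
  simp only [Matrix.one_mul, Matrix.mul_neg, Matrix.neg_mul, hR, Matrix.mul_add, Matrix.mul_sub,
    Matrix.mul_one]
  have e : L.symb ρ 0 * L.h₁ = (Complex.I * ρ) • L.h₁ - L.Q₁ 0 * L.h₁ := by
    rw [symb, Matrix.sub_mul, Matrix.smul_mul, Matrix.one_mul]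
  rw [e]
  ext (j | j) k
  · simp only [Matrix.smul_apply, Matrix.add_apply, fromRows_apply_inl, Matrix.neg_apply,
      Matrix.sub_apply, smul_eq_mul]
    ring
  · simp only [Matrix.smul_apply, Matrix.add_apply, fromRows_apply_inr, Matrix.neg_apply,
      Matrix.sub_apply, smul_eq_mul]
    ring

/-- The initial data of `S` in the wave variables: the leading amplitudes are `±1/(2iρ)`. -/
theorem waveT_mul_eq_initS {ρ : ℂ} (hρ : ρ ≠ 0) (h : IsUnit (L.symb ρ 0)) :
    L.waveT ρ 0 * ((2 * (Complex.I * ρ))⁻¹ • (fromRows 1 (-1) +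
      fromRows ((L.symb ρ 0)⁻¹ * L.Q₁ 0) (-((L.symb ρ 0)⁻¹ * L.Q₁ 0)))) = initS m := by
  have hR : ∀ X, L.symb ρ 0 * ((L.symb ρ 0)⁻¹ * X) = X := fun X => by
    rw [← Matrix.mul_assoc, L.symb_mul_inv h, Matrix.one_mul]
  have hne : Complex.I * ρ ≠ 0 := mul_ne_zero Complex.I_ne_zero hρ
  rw [Matrix.mul_smul, Matrix.mul_add, waveT, fromBlocks_mul_fromRows, fromBlocks_mul_fromRows,
    initS]
  simp only [Matrix.one_mul, Matrix.mul_neg, Matrix.neg_mul, hR, Matrix.mul_one, neg_neg]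
  rw [symb]
  ext (j | j) k
  · simp only [Matrix.smul_apply, Matrix.add_apply, fromRows_apply_inl, Matrix.neg_apply,
      Matrix.zero_apply, smul_eq_mul]
    ring
  · simp only [Matrix.smul_apply, Matrix.add_apply, fromRows_apply_inr,
      Matrix.sub_apply, smul_eq_mul]
    field_simp
    ring

/-- The boundary form `V` in the wave variables, up to the factor `iρ`: its leading coefficients are
`H₁ ± 1`. -/
theorem formV_mul_waveT {ρ : ℂ} (hρ : ρ ≠ 0) : L.formV ρ * L.waveT ρ π =
    (Complex.I * ρ) • (fromCols (1 + L.H₁) (L.H₁ - 1) +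
      (Complex.I * ρ)⁻¹ • fromCols (L.H₀ - L.Q₁ π) (L.H₀ + L.Q₁ π)) := by
  have hne : Complex.I * ρ ≠ 0 := mul_ne_zero Complex.I_ne_zero hρ
  rw [formV, waveT, fromCols_mul_fromBlocks, smul_add, smul_smul, mul_inv_cancel₀ hne, one_smul]
  simp only [Matrix.mul_one, Matrix.one_mul, Matrix.mul_neg, symb]
  ext j (k | k)
  · simp only [Matrix.smul_apply, Matrix.add_apply, fromCols_apply_inl,
      Matrix.sub_apply, smul_eq_mul]
    ring
  · simp only [Matrix.smul_apply, Matrix.add_apply, fromCols_apply_inr, Matrix.neg_apply,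
      Matrix.sub_apply, smul_eq_mul]
    ring

variable {L}

/-- The asymptotics of `V(φ)` and `V(S)`: both are triple products of the boundary form, the
propagator and the initial data, all of which are known in the wave variables to leading order. -/
theorem exists_char_asymptotics (hII : L.ConditionII) : ∃ C R : ℝ, 0 < C ∧ 1 ≤ R ∧
    ∀ ρ : ℂ, R ≤ ‖ρ‖ →
      ‖L.charMatrix ρ - (Complex.I * ρ / 2) • L.mainDelta ρ‖ ≤ C * Real.exp (|ρ.im| * π) ∧
      ‖L.matrixVS ρ - (2⁻¹ : ℂ) • L.mainS ρ‖ ≤ C / ‖ρ‖ * Real.exp (|ρ.im| * π) := by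
  obtain ⟨C, R, hC, hR, H⟩ := exists_wave_asymptotics hII
  obtain ⟨a, ha2, haC, hA, hA', hB, hBS, hX, hXS⟩ : ∃ a : ℝ, 2 ≤ a ∧ C ≤ a ∧
      ‖fromCols (1 + L.H₁) (L.H₁ - 1)‖ ≤ a ∧
      ‖fromCols (L.H₀ - L.Q₁ π) (L.H₀ + L.Q₁ π)‖ ≤ a ∧ ‖fromRows (1 - L.h₁) (1 + L.h₁)‖ ≤ a ∧
      ‖fromRows (1 : Matrix (Fin m) (Fin m) ℂ) (-1 : Matrix (Fin m) (Fin m) ℂ)‖ ≤ a ∧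
      4 * ‖L.Q₁ 0 * L.h₁ + L.h₀‖ ≤ a ∧ 4 * ‖L.Q₁ 0‖ ≤ a := by
    have h : ∀ b : ℝ, ∀ᶠ a in atTop, b ≤ a := eventually_ge_atTop
    exact ((h _).and ((h _).and ((h _).and ((h _).and ((h _).and ((h _).and
      ((h _).and (h _)))))))).exists
  refine ⟨7 * a ^ 3, R, by positivity, hR, fun ρ hρ => ?_⟩
  obtain ⟨hu, Z, -, hZ1, hZ2⟩ := H ρ hρ
  have hρ1 : 1 ≤ ‖ρ‖ := hR.trans hρ
  have hρ0 : 0 < ‖ρ‖ := by linarith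
  have hne : ρ ≠ 0 := norm_pos_iff.1 hρ0
  have hIρ : ‖Complex.I * ρ‖ = ‖ρ‖ := by simp
  have hne' : Complex.I * ρ ≠ 0 := mul_ne_zero Complex.I_ne_zero hne
  have h0 : (0 : ℝ) ∈ Icc 0 π := left_mem_Icc.2 Real.pi_pos.le
  have hπ : π ∈ Icc 0 π := right_mem_Icc.2 Real.pi_pos.le
  obtain ⟨hu0, hinv⟩ := hu 0 h0
  have hE : ‖Z π - L.waveF ρ π‖ ≤ a * ‖ρ‖⁻¹ * Real.exp (|ρ.im| * π) := by
    refine (hZ2 π hπ).trans ?_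
    rw [div_eq_mul_inv]
    gcongr
  have hF : ‖L.waveF ρ π‖ ≤ a * Real.exp (|ρ.im| * π) :=
    (norm_waveF_le hII ρ hπ).trans (by gcongr)
  have hε0 : (0 : ℝ) ≤ ‖ρ‖⁻¹ := by positivity
  have hε1 : ‖ρ‖⁻¹ ≤ 1 := inv_le_one_of_one_le₀ hρ1
  have hA1 : ‖(Complex.I * ρ)⁻¹ • fromCols (L.H₀ - L.Q₁ π) (L.H₀ + L.Q₁ π)‖ ≤ a * ‖ρ‖⁻¹ := by
    rw [norm_smul, norm_inv, hIρ, mul_comm]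
    gcongr
  have hd : ∀ X : Matrix (Fin m) (Fin m) ℂ, 4 * ‖X‖ ≤ a →
      ‖(L.symb ρ 0)⁻¹ * X‖ + ‖(L.symb ρ 0)⁻¹ * X‖ ≤ a * ‖ρ‖⁻¹ := fun X hX => by
    have h1 : ‖(L.symb ρ 0)⁻¹ * X‖ ≤ 2 / ‖ρ‖ * ‖X‖ := (norm_mul_le _ _).trans (by gcongr)
    calc _ ≤ 2 / ‖ρ‖ * ‖X‖ + 2 / ‖ρ‖ * ‖X‖ := add_le_add h1 h1
      _ = 4 * ‖X‖ * ‖ρ‖⁻¹ := by rw [div_eq_mul_inv]; ring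
      _ ≤ _ := by gcongr
  have hfund : ∀ (X : Matrix (Fin m ⊕ Fin m) (Fin m) ℂ) (c : ℂ),
      L.formV ρ * (L.fund ρ π * (L.waveT ρ 0 * (c • X))) = (Complex.I * ρ * c) •
        ((fromCols (1 + L.H₁) (L.H₁ - 1) +
          (Complex.I * ρ)⁻¹ • fromCols (L.H₀ - L.Q₁ π) (L.H₀ + L.Q₁ π)) *
          ((L.waveF ρ π + (Z π - L.waveF ρ π)) * X)) := fun X c => by
    rw [← Matrix.mul_assoc (L.fund ρ π), hZ1 π hπ, Matrix.mul_assoc, ← Matrix.mul_assoc (L.formV ρ),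
      L.formV_mul_waveT hne, add_sub_cancel, Matrix.mul_smul, Matrix.mul_smul, Matrix.smul_mul,
      smul_smul, mul_comm c]
  constructor
  · have hB1 : ‖fromRows (-((L.symb ρ 0)⁻¹ * (L.Q₁ 0 * L.h₁ + L.h₀)))
        ((L.symb ρ 0)⁻¹ * (L.Q₁ 0 * L.h₁ + L.h₀))‖ ≤ a * ‖ρ‖⁻¹ := by
      refine (l2_opNorm_fromRows_le _ _).trans ?_
      rw [norm_neg]
      exact hd _ hX
    have h1 := norm_mul_mul_sub_le hε0 hε1 hA hA1 hF hE hB hB1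
    rw [charMatrix, ← L.waveT_mul_eq_initPhi hu0, hfund, L.mainDelta_eq, ← div_eq_mul_inv,
      ← smul_sub, norm_smul, norm_div, hIρ, Complex.norm_two]
    calc _ ≤ ‖ρ‖ / 2 * (7 * a ^ 3 * ‖ρ‖⁻¹ * Real.exp (|ρ.im| * π)) := by gcongr
      _ = 7 * a ^ 3 * Real.exp (|ρ.im| * π) / 2 := by field_simp
      _ ≤ _ := by
        have : 0 ≤ 7 * a ^ 3 * Real.exp (|ρ.im| * π) := by positivity
        linarith
  · have hB1 : ‖fromRows ((L.symb ρ 0)⁻¹ * L.Q₁ 0) (-((L.symb ρ 0)⁻¹ * L.Q₁ 0))‖ ≤ a * ‖ρ‖⁻¹ := by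
      refine (l2_opNorm_fromRows_le _ _).trans ?_
      rw [norm_neg]
      exact hd _ hXS
    have h1 := norm_mul_mul_sub_le hε0 hε1 hA hA1 hF hE hBS hB1
    have e : Complex.I * ρ * (2 * (Complex.I * ρ))⁻¹ = 2⁻¹ := by
      rw [_root_.mul_inv_rev, ← mul_assoc, mul_inv_cancel₀ hne', one_mul]
    rw [matrixVS, ← L.waveT_mul_eq_initS hne hu0, hfund, L.mainS_eq, e, ← smul_sub, norm_smul,
      norm_inv, Complex.norm_two]
    have : 0 ≤ 7 * a ^ 3 / ‖ρ‖ * Real.exp (|ρ.im| * π) := by positivity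
    calc _ ≤ 2⁻¹ * (7 * a ^ 3 * ‖ρ‖⁻¹ * Real.exp (|ρ.im| * π)) := by gcongr
      _ ≤ _ := by rw [← div_eq_mul_inv]; linarith

end MatrixPencil

/-! ### Zeros of entire functions: the argument principle and Rouché's theorem -/

section Rouche

open Metric Complex

theorem Differentiable.dslope_complex {f : ℂ → ℂ} (hf : Differentiable ℂ f) (a : ℂ) :
    Differentiable ℂ (dslope f a) := by
  rw [← differentiableOn_univ] at hf ⊢
  exact (differentiableOn_dslope univ_mem).2 hf

theorem Differentiable.finite_zeros {f : ℂ → ℂ} (hf : Differentiable ℂ f) {a : ℂ} (ha : f a ≠ 0)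
    (c : ℂ) (R : ℝ) : {z | z ∈ closedBall c R ∧ f z = 0}.Finite := by
  by_contra h
  obtain ⟨z, -, hz⟩ := Set.Infinite.exists_accPt_of_subset_isCompact h
    (isCompact_closedBall c R) (fun z hz => hz.1)
  rw [accPt_iff_frequently_nhdsNE] at hz
  have h1 : AnalyticOnNhd ℂ f univ := fun w _ => hf.analyticAt w
  exact ha (h1.eqOn_zero_of_preconnected_of_frequently_eq_zero isPreconnected_univ (mem_univ z)
    (hz.mono fun w hw => hw.2) (mem_univ a))

theorem Differentiable.exists_eq_pow_mul {f : ℂ → ℂ} (hf : Differentiable ℂ f) (a : ℂ) {n : ℕ}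
    (hn : analyticOrderAt f a = n) :
    ∃ g : ℂ → ℂ, Differentiable ℂ g ∧ g a ≠ 0 ∧ ∀ z, f z = (z - a) ^ n * g z := by
  induction n generalizing f with
  | zero => exact ⟨f, hf, ((hf.analyticAt a).analyticOrderAt_eq_zero).1 (by simpa using hn),
      by simp⟩
  | succ n ih =>
    have h0 : f a = 0 := apply_eq_zero_of_analyticOrderAt_ne_zero (by rw [hn]; simp)
    have hd := hf.dslope_complex a
    have h1 : ∀ z, f z = (z - a) * dslope f a z := fun z => by
      have := sub_smul_dslope f a z
      rw [h0, sub_zero, smul_eq_mul] at this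
      exact this.symm
    have h2 : analyticOrderAt (dslope f a) a = n := by
      have h3 : analyticOrderAt f a = 1 + analyticOrderAt (dslope f a) a := by
        have : f = (fun z => z - a) * dslope f a := funext h1
        conv_lhs => rw [this]
        rw [analyticOrderAt_mul (by fun_prop) (hd.analyticAt a)]
        congr 1
        exact analyticOrderAt_id_sub_const_self
      rw [hn, add_comm 1] at h3
      have := h3.symm
      push_cast at this
      exact ENat.add_left_injective_of_ne_top (by simp : (1 : ℕ∞) ≠ ⊤) this
    obtain ⟨g, hg, hga, h4⟩ := ih hd h2
    exact ⟨g, hg, hga, fun z => by rw [h1, h4]; ring⟩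

/-- An entire function is, on a closed disc, the product of linear factors and of an entire function
without zeros there. -/
theorem Differentiable.exists_eq_prod_mul {f : ℂ → ℂ} (hf : Differentiable ℂ f) {a : ℂ}
    (ha : f a ≠ 0) (c : ℂ) (R : ℝ) :
    ∃ (s : Multiset ℂ) (g : ℂ → ℂ), Differentiable ℂ g ∧ (∀ z ∈ closedBall c R, g z ≠ 0) ∧
      (∀ z ∈ s, z ∈ closedBall c R ∧ f z = 0) ∧
      ∀ z, f z = (s.map fun w => z - w).prod * g z := by
  obtain ⟨k, hk⟩ : ∃ k, {z | z ∈ closedBall c R ∧ f z = 0}.ncard = k := ⟨_, rfl⟩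
  induction k using Nat.strong_induction_on generalizing f with
  | _ k ih =>
    by_cases h : ∃ z, z ∈ closedBall c R ∧ f z = 0
    · obtain ⟨b, hb, hfb⟩ := h
      have htop : analyticOrderAt f b ≠ ⊤ := fun h => by
        have h1 : AnalyticOnNhd ℂ f univ := fun w _ => hf.analyticAt w
        exact ha (h1.eqOn_zero_of_preconnected_of_frequently_eq_zero isPreconnected_univ
          (mem_univ b) ((analyticOrderAt_eq_top.1 h).filter_mono nhdsWithin_le_nhds).frequently
          (mem_univ a))
      obtain ⟨g, hg, hgb, hfg⟩ := hf.exists_eq_pow_mul b (ENat.natCast_toNat htop).symm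
      have hga : g a ≠ 0 := fun h => ha (by rw [hfg, h, mul_zero])
      have hsub : {z | z ∈ closedBall c R ∧ g z = 0} ⊂ {z | z ∈ closedBall c R ∧ f z = 0} := by
        refine ⟨fun z hz => ⟨hz.1, by rw [hfg, hz.2, mul_zero]⟩, fun h => hgb (h ⟨hb, hfb⟩).2⟩
      obtain ⟨s, q, hq, hq0, hs, hprod⟩ := ih _
        (hk ▸ Set.ncard_lt_ncard hsub (hf.finite_zeros ha c R)) hg hga rfl
      refine ⟨Multiset.replicate (analyticOrderAt f b).toNat b + s, q, hq, hq0, ?_, fun z => ?_⟩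
      · intro z hz
        rcases Multiset.mem_add.1 hz with h | h
        · rw [Multiset.eq_of_mem_replicate h]; exact ⟨hb, hfb⟩
        · exact ⟨(hs z h).1, by rw [hfg, (hs z h).2, mul_zero]⟩
      · rw [hfg, hprod, Multiset.map_add, Multiset.prod_add, Multiset.map_replicate,
          Multiset.prod_replicate, mul_assoc]
    · exact ⟨0, f, hf, fun z hz h0 => h ⟨z, hz, h0⟩, by simp, by simp⟩

theorem differentiable_multiset_prod_sub (s : Multiset ℂ) :
    Differentiable ℂ fun z => (s.map fun w => z - w).prod := by
  induction s using Multiset.induction_on with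
  | empty => simp
  | cons b s ih => simp only [Multiset.map_cons, Multiset.prod_cons]; fun_prop

theorem analyticOrderAt_multiset_prod_sub (s : Multiset ℂ) (z : ℂ) :
    analyticOrderAt (fun z => (s.map fun w => z - w).prod) z = s.count z := by
  induction s using Multiset.induction_on with
  | empty => simp [analyticOrderAt_eq_zero]
  | cons b s ih =>
    simp only [Multiset.map_cons, Multiset.prod_cons]
    have := analyticOrderAt_mul (f := fun z => z - b) (g := fun z => (s.map fun w => z - w).prod)
      (z₀ := z) (by fun_prop) ((differentiable_multiset_prod_sub s).analyticAt z)
    rw [show (fun z => (z - b) * (s.map fun w => z - w).prod) =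
      (fun z => z - b) * fun z => (s.map fun w => z - w).prod from rfl, this, ih]
    by_cases h : z = b
    · subst h
      rw [show analyticOrderAt (fun w => w - z) z = 1 from analyticOrderAt_id_sub_const_self,
        Multiset.count_cons_self, add_comm]
      norm_cast
    · rw [show analyticOrderAt (fun w => w - b) z = 0 from analyticOrderAt_id_sub_const_of_ne h,
        Multiset.count_cons_of_ne h, zero_add]

theorem circleIntegral_logDeriv_of_ne_zero {g : ℂ → ℂ} (hg : Differentiable ℂ g) {c : ℂ} {R : ℝ}
    (hR : 0 ≤ R) (h0 : ∀ z ∈ closedBall c R, g z ≠ 0) : ∮ z in C(c, R), logDeriv g z = 0 := by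
  have hd : Differentiable ℂ (deriv g) := hg.deriv
  refine circleIntegral_eq_zero_of_differentiable_on_off_countable hR countable_empty ?_ ?_
  · exact hd.continuous.continuousOn.div hg.continuous.continuousOn h0
  · exact fun z hz => (hd z).div (hg z) (h0 z (ball_subset_closedBall hz.1))

theorem circleIntegral_logDeriv_prod_mul {g : ℂ → ℂ} (hg : Differentiable ℂ g) {c : ℂ} {R : ℝ}
    (hR : 0 < R) (h0 : ∀ z ∈ closedBall c R, g z ≠ 0) (s : Multiset ℂ) (hs : ∀ z ∈ s, z ∈ ball c R) :
    ContinuousOn (logDeriv fun z => (s.map fun w => z - w).prod * g z) (sphere c R) ∧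
    ∮ z in C(c, R), logDeriv (fun z => (s.map fun w => z - w).prod * g z) z =
      2 * π * I * s.card := by
  induction s using Multiset.induction_on with
  | empty =>
    simp only [Multiset.map_zero, Multiset.prod_zero, one_mul, Multiset.card_zero, Nat.cast_zero,
      mul_zero]
    refine ⟨hg.deriv.continuous.continuousOn.div hg.continuous.continuousOn fun z hz =>
      h0 z (sphere_subset_closedBall hz), circleIntegral_logDeriv_of_ne_zero hg hR.le h0⟩
  | cons b s ih =>
    obtain ⟨hc, hi⟩ := ih fun z hz => hs z (Multiset.mem_cons_of_mem hz)
    have hb : b ∈ ball c R := hs b (Multiset.mem_cons_self b s)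
    set P : ℂ → ℂ := fun z => (s.map fun w => z - w).prod * g z with hP
    have hPd : Differentiable ℂ P := (differentiable_multiset_prod_sub s).mul hg
    have hne : ∀ t : Multiset ℂ, (∀ z ∈ t, z ∈ ball c R) → ∀ z ∈ sphere c R,
        (t.map fun w => z - w).prod ≠ 0 := by
      intro t ht z hz h
      rw [Multiset.prod_eq_zero_iff, Multiset.mem_map] at h
      obtain ⟨w, hw, h⟩ := h
      have := ht w hw
      rw [← sub_eq_zero.1 h, mem_ball, mem_sphere.1 hz] at this
      exact lt_irrefl _ this
    have hbne : ∀ z ∈ sphere c R, z - b ≠ 0 := fun z hz h => by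
      rw [← sub_eq_zero.1 h, mem_ball, mem_sphere.1 hz] at hb
      exact lt_irrefl _ hb
    have heq : EqOn (logDeriv fun z => ((b ::ₘ s).map fun w => z - w).prod * g z)
        (fun z => (z - b)⁻¹ + logDeriv P z) (sphere c R) := by
      intro z hz
      have h1 : (fun z => ((b ::ₘ s).map fun w => z - w).prod * g z) =
          fun z => (z - b) * P z := by
        funext w; simp [hP, mul_assoc]
      rw [h1, logDeriv_mul (f := fun z => z - b) (g := P) z (hbne z hz) (mul_ne_zero
        (hne s (fun z hz => hs z (Multiset.mem_cons_of_mem hz)) z hz)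
        (h0 z (sphere_subset_closedBall hz))) (by fun_prop) (hPd z)]
      simp [logDeriv_apply, P]
    have hcb : ContinuousOn (fun z => (z - b)⁻¹) (sphere c R) :=
      (by fun_prop : Continuous fun z : ℂ => z - b).continuousOn.inv₀ hbne
    refine ⟨(hcb.add hc).congr heq, ?_⟩
    rw [circleIntegral.integral_congr hR.le heq, circleIntegral.integral_add
      (hcb.circleIntegrable hR.le) (hc.circleIntegrable hR.le), hi,
      circleIntegral.integral_sub_inv_of_mem_ball hb]
    push_cast [Multiset.card_cons]; ring

/-- The argument principle: the zeros of `f` in the disc, repeated according to multiplicity, form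
a multiset whose cardinality is the integral of the logarithmic derivative. -/
theorem argument_principle {f : ℂ → ℂ} (hf : Differentiable ℂ f) {c : ℂ} {R : ℝ} (hR : 0 < R)
    (h0 : ∀ z ∈ sphere c R, f z ≠ 0) :
    ∃ s : Multiset ℂ, (∀ z ∈ s, z ∈ ball c R) ∧
      (∀ z ∈ ball c R, analyticOrderAt f z = s.count z) ∧
      ∮ z in C(c, R), logDeriv f z = 2 * π * I * s.card := by
  obtain ⟨a, ha⟩ : (sphere c R).Nonempty := NormedSpace.sphere_nonempty.2 hR.le
  obtain ⟨s, g, hg, hg0, hs, hfg⟩ := hf.exists_eq_prod_mul (h0 a ha) c R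
  have hs' : ∀ z ∈ s, z ∈ ball c R := fun z hz => by
    obtain ⟨h1, h2⟩ := hs z hz
    refine lt_of_le_of_ne (mem_closedBall.1 h1) fun h => h0 z (mem_sphere.2 h) h2
  refine ⟨s, hs', fun z hz => ?_, ?_⟩
  · have h1 : f = (fun z => (s.map fun w => z - w).prod) * g := funext hfg
    rw [h1, analyticOrderAt_mul ((differentiable_multiset_prod_sub s).analyticAt z)
      (hg.analyticAt z), analyticOrderAt_multiset_prod_sub,
      (hg.analyticAt z).analyticOrderAt_eq_zero.2 (hg0 z (ball_subset_closedBall hz)), add_zero]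
  · have h1 : f = fun z => (s.map fun w => z - w).prod * g z := funext hfg
    rw [h1]
    exact (circleIntegral_logDeriv_prod_mul hg hR hg0 s hs').2

/-- On the circle `F / f` stays in the slit plane, so that `log (F / f)` is a primitive of the difference
of the logarithmic derivatives; no homotopy is needed. -/
theorem circleIntegral_logDeriv_eq {f F : ℂ → ℂ} (hf : Differentiable ℂ f)
    (hF : Differentiable ℂ F) {c : ℂ} {R : ℝ} (hR : 0 < R)
    (h : ∀ z ∈ sphere c R, ‖F z - f z‖ < ‖f z‖) :
    ∮ z in C(c, R), logDeriv F z = ∮ z in C(c, R), logDeriv f z := by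
  have hf0 : ∀ z ∈ sphere c R, f z ≠ 0 := fun z hz h0 => by
    have := h z hz
    rw [h0, norm_zero] at this
    exact absurd this (not_lt.2 (norm_nonneg _))
  have hF0 : ∀ z ∈ sphere c R, F z ≠ 0 := fun z hz h0 => by
    have := h z hz
    rw [h0, zero_sub, norm_neg] at this
    exact lt_irrefl _ this
  have hcf : ContinuousOn (logDeriv f) (sphere c R) :=
    hf.deriv.continuous.continuousOn.div hf.continuous.continuousOn hf0
  have hcF : ContinuousOn (logDeriv F) (sphere c R) :=
    hF.deriv.continuous.continuousOn.div hF.continuous.continuousOn hF0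
  rw [← sub_eq_zero, ← circleIntegral.integral_sub (hcF.circleIntegrable hR.le)
    (hcf.circleIntegrable hR.le)]
  refine circleIntegral.integral_eq_zero_of_hasDerivWithinAt (f := fun z => log (F z / f z)) hR.le
    fun z hz => ?_
  have h1 : F z / f z ∈ slitPlane := by
    have : F z / f z = 1 + (F z - f z) / f z := by
      have := hf0 z hz
      field_simp; ring
    rw [this]
    refine mem_slitPlane_of_norm_lt_one ?_
    rw [norm_div, div_lt_one (norm_pos_iff.2 (hf0 z hz))]
    exact h z hz
  have h2 := (((hF z).hasDerivAt.div (hf z).hasDerivAt (hf0 z hz)).clog h1).hasDerivWithinAt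
    (s := sphere c R)
  refine h2.congr_deriv ?_
  have := hf0 z hz
  have := hF0 z hz
  change _ / (F z / f z) = deriv F z / F z - deriv f z / f z
  field_simp

/-- Rouché's theorem. -/
theorem rouche {f F : ℂ → ℂ} (hf : Differentiable ℂ f)
    (hF : Differentiable ℂ F) {c : ℂ} {R : ℝ} (hR : 0 < R)
    (h : ∀ z ∈ sphere c R, ‖F z - f z‖ < ‖f z‖) :
    ∃ s t : Multiset ℂ, s.card = t.card ∧ (∀ z ∈ s, z ∈ ball c R) ∧ (∀ z ∈ t, z ∈ ball c R) ∧
      (∀ z ∈ ball c R, analyticOrderAt f z = s.count z) ∧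
      (∀ z ∈ ball c R, analyticOrderAt F z = t.count z) := by
  have hf0 : ∀ z ∈ sphere c R, f z ≠ 0 := fun z hz h0 => by
    have := h z hz
    rw [h0, norm_zero] at this
    exact absurd this (not_lt.2 (norm_nonneg _))
  have hF0 : ∀ z ∈ sphere c R, F z ≠ 0 := fun z hz h0 => by
    have := h z hz
    rw [h0, zero_sub, norm_neg] at this
    exact lt_irrefl _ this
  obtain ⟨s, hs, hs', hs''⟩ := argument_principle hf hR hf0
  obtain ⟨t, ht, ht', ht''⟩ := argument_principle hF hR hF0
  refine ⟨s, t, ?_, hs, ht, hs', ht'⟩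
  rw [← circleIntegral_logDeriv_eq hf hF hR h, ht''] at hs''
  exact_mod_cast (mul_left_cancel₀ two_pi_I_ne_zero hs'').symm

theorem encard_preimage_finset {ι : Type*} (u : ι → ℂ) (T : Finset ℂ) :
    {p | u p ∈ T}.encard = ∑ z ∈ T, {p | u p = z}.encard := by
  induction T using Finset.induction_on with
  | empty => simp
  | insert a T ha ih =>
    rw [Finset.sum_insert ha, ← ih, ← Set.encard_union_eq]
    · congr 1; ext p; simp
    · rw [Set.disjoint_left]
      rintro p hp h
      exact ha (by rw [← (hp : u p = a)]; exact h)

theorem encard_preimage_of_count {ι : Type*} (u : ι → ℂ) {D : Set ℂ} (t : Multiset ℂ)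
    (ht : ∀ z ∈ t, z ∈ D) (h : ∀ z ∈ D, {p | u p = z}.encard = t.count z) :
    {p | u p ∈ D}.encard = t.card := by
  have h1 : {p | u p ∈ D} = {p | u p ∈ t.toFinset} := by
    ext p
    simp only [mem_ofPred_eq, Multiset.mem_toFinset]
    refine ⟨fun hp => ?_, fun hp => ht _ hp⟩
    by_contra hn
    have := h (u p) hp
    rw [Multiset.count_eq_zero_of_notMem hn, Nat.cast_zero, Set.encard_eq_zero] at this
    exact (this ▸ (rfl : u p = u p) : p ∈ (∅ : Set ι))
  rw [h1, encard_preimage_finset, Finset.sum_congr rfl fun z hz =>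
    h z (ht z (Multiset.mem_toFinset.1 hz)), ← Nat.cast_sum, Multiset.toFinset_sum_count_eq]

/-- Rouché's theorem in terms of enumerations of the zeros of the two functions. -/
theorem rouche_encard {f F : ℂ → ℂ} (hf : Differentiable ℂ f)
    (hF : Differentiable ℂ F) {c : ℂ} {R : ℝ} (hR : 0 < R)
    (h : ∀ z ∈ sphere c R, ‖F z - f z‖ < ‖f z‖) {ι κ : Type*} (u : ι → ℂ) (v : κ → ℂ)
    (hu : ∀ z, {p | u p = z}.encard = analyticOrderAt f z)
    (hv : ∀ z, {p | v p = z}.encard = analyticOrderAt F z) :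
    {p | u p ∈ ball c R}.encard = {p | v p ∈ ball c R}.encard ∧ {p | u p ∈ ball c R}.Finite := by
  obtain ⟨s, t, hst, hs, ht, hs', ht'⟩ := rouche hf hF hR h
  have h1 := encard_preimage_of_count u s hs fun z hz => (hu z).trans (hs' z hz)
  have h2 := encard_preimage_of_count v t ht fun z hz => (hv z).trans (ht' z hz)
  refine ⟨by rw [h1, h2, hst], Set.encard_ne_top_iff.1 (by rw [h1]; simp)⟩

end Rouche

/-! ### The comparison function and the numbering of zeros -/

section Comparison

open Metric Complex

theorem norm_exp_sub_exp_neg_sq (a b : ℝ) :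
    ‖cexp (I * (a + b * I)) - cexp (-(I * (a + b * I)))‖ ^ 2 =
      (Real.exp b - Real.exp (-b)) ^ 2 + 4 * Real.sin a ^ 2 := by
  have h1 : I * (a + b * I) = ((-b : ℝ) : ℂ) + a * I := by
    push_cast; linear_combination (b : ℂ) * I_sq
  have h2 : -(I * (a + b * I)) = (b : ℂ) + ((-a : ℝ) : ℂ) * I := by
    push_cast; linear_combination -(b : ℂ) * I_sq
  rw [h2, h1, ← Complex.normSq_eq_norm_sq, normSq_apply]
  simp only [sub_re, sub_im, exp_re, exp_im, add_re, add_im, ofReal_re, ofReal_im, mul_re, mul_im,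
    I_re, I_im, mul_zero, mul_one, sub_zero, add_zero, zero_add, Real.cos_neg, Real.sin_neg]
  have h3 := Real.cos_sq' a
  have h4 : Real.exp b * Real.exp (-b) = 1 := by rw [← Real.exp_add]; simp
  linear_combination (Real.exp (-b) - Real.exp b) ^ 2 * h3 + 4 * Real.sin a ^ 2 * h4

/-- Away from the integers, `exp (2πiz) - 1` is as large as its larger term. -/
theorem mul_exp_le_norm_exp_sub_one {z : ℂ} {δ : ℝ} (hδ : δ ≤ 1 / 2)
    (h : ∀ n : ℤ, δ ≤ ‖z - n‖) :
    δ * Real.exp (π * |z.im|) * ‖cexp (I * π * z)‖ ≤ ‖cexp (2 * π * I * z) - 1‖ := by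
  set s := z.re - round z.re with hs
  have hs2 : |s| ≤ 1 / 2 := abs_sub_round z.re
  have hz : z = (round z.re : ℂ) + ((s : ℂ) + z.im * I) := by
    apply Complex.ext <;> simp [hs]
  have hδ' : δ ≤ ‖(s : ℂ) + z.im * I‖ := by
    have := h (round z.re)
    rwa [show z - (round z.re : ℂ) = (s : ℂ) + z.im * I by rw [sub_eq_iff_eq_add']; exact hz]
      at this
  have hnorm : ‖(s : ℂ) + z.im * I‖ ^ 2 = s ^ 2 + z.im ^ 2 := by
    rw [← Complex.normSq_eq_norm_sq, normSq_add_mul_I]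
  have h1 : cexp (2 * π * I * z) - 1 = cexp (I * π * z) * (cexp (I * π * z) - cexp (-(I * π * z))) := by
    rw [mul_sub, ← Complex.exp_add, ← Complex.exp_add, add_neg_cancel, Complex.exp_zero]
    congr 2; ring
  rw [h1, norm_mul, mul_comm]
  refine mul_le_mul_of_nonneg_left ?_ (norm_nonneg _)
  have h2 : ‖cexp (I * π * z) - cexp (-(I * π * z))‖ ^ 2 =
      (Real.exp (π * z.im) - Real.exp (-(π * z.im))) ^ 2 + 4 * Real.sin (π * s) ^ 2 := by
    have h3 : Real.sin (π * s) ^ 2 = Real.sin (π * z.re) ^ 2 := by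
      have : π * s = π * z.re - round z.re * π := by rw [hs]; ring
      rw [this, Real.sin_sub_int_mul_pi, mul_pow]
      have h5 : (((-1 : ℝ) ^ (round z.re)) ^ 2) = 1 := by
        rw [← zpow_natCast, ← _root_.zpow_mul, mul_comm, _root_.zpow_mul]; norm_num
      rw [h5, one_mul]
    rw [h3, ← norm_exp_sub_exp_neg_sq]
    have : I * π * z = I * ((π * z.re : ℝ) + (π * z.im : ℝ) * I) := by
      conv_lhs => rw [← re_add_im z]
      push_cast; ring
    rw [this]
  have hsin : 2 * |s| ≤ |Real.sin (π * s)| := by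
    have h4 := Real.mul_abs_le_abs_sin (x := π * s) (by
      rw [abs_mul, abs_of_pos Real.pi_pos]; nlinarith [Real.pi_pos])
    rw [abs_mul, abs_of_pos Real.pi_pos] at h4
    calc 2 * |s| = 2 / π * (π * |s|) := by field_simp
      _ ≤ _ := h4
  set E := Real.exp (π * |z.im|) with hE
  have hE1 : 1 ≤ E := Real.one_le_exp (by positivity)
  have hE2 : 1 + π * |z.im| ≤ E := by rw [hE, add_comm]; exact Real.add_one_le_exp _
  have hEE : (Real.exp (π * z.im) - Real.exp (-(π * z.im))) ^ 2 = (E - E⁻¹) ^ 2 := by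
    rw [hE, ← Real.exp_neg]
    rcases abs_cases z.im with ⟨h, -⟩ | ⟨h, -⟩ <;> rw [h]
    rw [mul_neg, neg_neg]; ring
  have hsinh : 2 * (π * |z.im|) ≤ E - E⁻¹ := by
    have h5 := Real.self_le_sinh_iff.2 (by positivity : (0 : ℝ) ≤ π * |z.im|)
    rw [Real.sinh_eq] at h5
    rw [hE, ← Real.exp_neg]; linarith
  have hEinv : E⁻¹ ≤ 1 := inv_le_one_of_one_le₀ hE1
  rw [hEE] at h2
  rcases le_or_gt δ 0 with h0 | h0
  · exact (mul_nonpos_of_nonpos_of_nonneg h0 (by positivity)).trans (norm_nonneg _)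
  -- for bounded imaginary part compare the sine and the hyperbolic sine with their arguments;
  -- otherwise the hyperbolic sine alone is large enough
  rcases le_or_gt E 4 with h4 | h4
  · refine (mul_le_mul_of_nonneg_left h4 h0.le).trans ?_
    refine le_of_sq_le_sq ?_ (norm_nonneg _)
    rw [h2]
    have hd : δ ^ 2 ≤ s ^ 2 + z.im ^ 2 := by rw [← hnorm]; gcongr
    have e1 : 4 * s ^ 2 ≤ Real.sin (π * s) ^ 2 := by
      rw [← sq_abs s, ← sq_abs (Real.sin _)]; nlinarith [abs_nonneg s]
    have e2 : 16 * z.im ^ 2 ≤ (E - E⁻¹) ^ 2 := by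
      rw [← sq_abs z.im]
      have := mul_le_mul_of_nonneg_right Real.pi_gt_three.le (abs_nonneg z.im)
      have : 4 * |z.im| ≤ E - E⁻¹ := by nlinarith [abs_nonneg z.im]
      nlinarith [abs_nonneg z.im]
    nlinarith
  · refine le_of_sq_le_sq ?_ (norm_nonneg _)
    rw [h2]
    have : δ * E ≤ E - E⁻¹ := by nlinarith
    nlinarith [sq_nonneg (Real.sin (π * s)), mul_nonneg h0.le (zero_le_one.trans hE1)]

theorem analyticOrderAt_finset_prod {ι : Type*} (T : Finset ι) (f : ι → ℂ → ℂ) {z : ℂ}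
    (hf : ∀ i ∈ T, AnalyticAt ℂ (f i) z) :
    analyticOrderAt (fun w => ∏ i ∈ T, f i w) z = ∑ i ∈ T, analyticOrderAt (f i) z := by
  classical
  induction T using Finset.induction_on with
  | empty => simp [analyticOrderAt_eq_zero]
  | insert a T ha ih =>
    have hT : ∀ i ∈ T, AnalyticAt ℂ (f i) z := fun i hi => hf i (Finset.mem_insert_of_mem hi)
    rw [Finset.sum_insert ha, ← ih hT, ← analyticOrderAt_mul (hf a (Finset.mem_insert_self a T))
      (Finset.analyticAt_fun_prod T hT)]
    congr 1; funext w; simp [Finset.prod_insert ha]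

theorem exp_two_pi_mul_eq_iff (z : ℂ) (a : ℝ) :
    cexp (2 * π * I * z) = cexp (2 * π * I * a) ↔ ∃ n : ℤ, (n : ℂ) + a = z := by
  rw [exp_eq_exp_iff_exists_int]
  refine exists_congr fun n => ?_
  have : 2 * π * I * z = 2 * π * I * a + n * (2 * π * I) ↔ (2 * π * I) * z = (2 * π * I) * (n + a) := by
    rw [show 2 * π * I * a + n * (2 * π * I) = (2 * π * I) * (n + a) by ring]
  rw [this, mul_right_inj' two_pi_I_ne_zero, eq_comm]

theorem analyticOrderAt_exp_sub (a : ℝ) (z : ℂ) :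
    analyticOrderAt (fun w => cexp (2 * π * I * w) - cexp (2 * π * I * a)) z =
      {n : ℤ | (n : ℂ) + a = z}.encard := by
  by_cases h : ∃ n : ℤ, (n : ℂ) + a = z
  · have h0 := (exp_two_pi_mul_eq_iff z a).2 h
    obtain ⟨n, hn⟩ := h
    have : {n : ℤ | (n : ℂ) + a = z} = {n} := by
      ext k
      simp only [mem_ofPred_eq, mem_singleton_iff, ← hn, add_left_inj, Int.cast_inj]
    rw [this, encard_singleton]
    refine AnalyticAt.analyticOrderAt_eq_one_of_zero_deriv_ne_zero (by fun_prop)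
      (sub_eq_zero.2 h0) ?_
    have hd : HasDerivAt (fun w => cexp (2 * π * I * w) - cexp (2 * π * I * a))
        (cexp (2 * π * I * z) * (2 * π * I)) z := by
      have := (((hasDerivAt_id z).const_mul (2 * π * I)).cexp).sub_const (cexp (2 * π * I * a))
      simpa using this
    rw [hd.deriv]
    exact mul_ne_zero (exp_ne_zero _) two_pi_I_ne_zero
  · have : {n : ℤ | (n : ℂ) + a = z} = ∅ := by
      ext n; simp only [mem_ofPred_eq, mem_empty_iff_false, iff_false]
      exact fun hn => h ⟨n, hn⟩
    rw [this, encard_empty]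
    refine (AnalyticAt.analyticOrderAt_eq_zero (by fun_prop)).2 fun h0 => h ?_
    exact (exp_two_pi_mul_eq_iff z a).1 (sub_eq_zero.1 h0)

/-- The leading part of the characteristic function, up to a constant factor. It equals `ρ ^ m` times
the product of the functions `2i e^{iπω_q} sin π(ρ - ω_q)`. -/
def comparison {m : ℕ} (ω : Fin m → ℝ) (ρ : ℂ) : ℂ :=
  ρ ^ m * (cexp (-(I * π * ρ)) ^ m * ∏ q, (cexp (2 * π * I * ρ) - cexp (2 * π * I * ω q)))

/-- The zeros of `comparison ω`: `n + ω_q`, where however the index `-0` stands for the zeros of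
the monomial. -/
def comparisonZero {m : ℕ} (ω : Fin m → ℝ) (p : SignedIndex × Fin m) : ℂ :=
  if p.1 = Sum.inr 0 then 0 else (p.1.val : ℂ) + ω p.2

theorem differentiable_comparison {m : ℕ} (ω : Fin m → ℝ) : Differentiable ℂ (comparison ω) := by
  unfold comparison; fun_prop

theorem encard_signedIndex (P : ℤ → Prop) :
    {n : SignedIndex | n ≠ Sum.inr 0 ∧ P n.val}.encard = {k : ℤ | P k}.encard := by
  have hinj : InjOn SignedIndex.val {n : SignedIndex | n ≠ Sum.inr 0 ∧ P n.val} := by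
    rintro (a | a) ⟨ha, -⟩ (b | b) ⟨hb, -⟩ h <;> simp [SignedIndex.val] at * <;> omega
  rw [← hinj.encard_image]
  congr 1
  ext k
  constructor
  · rintro ⟨n, hn, rfl⟩; exact hn.2
  · intro hk
    rcases le_or_gt 0 k with h | h
    · lift k to ℕ using h
      exact ⟨Sum.inl k, ⟨by simp, hk⟩, rfl⟩
    · obtain ⟨j, rfl⟩ : ∃ j : ℕ, k = -(j : ℤ) := ⟨k.natAbs, by omega⟩
      exact ⟨Sum.inr j, ⟨by simpa using by omega, hk⟩, rfl⟩

theorem encard_prod_fin {α : Type*} {m : ℕ} (P : α × Fin m → Prop) :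
    {p | P p}.encard = ∑ q, {a | P (a, q)}.encard := by
  classical
  have key : ∀ T : Finset (Fin m), {p : α × Fin m | P p ∧ p.2 ∈ T}.encard =
      ∑ q ∈ T, {a | P (a, q)}.encard := by
    intro T
    induction T using Finset.induction_on with
    | empty => simp
    | insert b T hb ih =>
      rw [Finset.sum_insert hb, ← ih]
      have h1 : {a | P (a, b)}.encard = {p : α × Fin m | P p ∧ p.2 = b}.encard := by
        have hinj : Function.Injective fun a : α => (a, b) := fun x y h => by simpa using h
        rw [← hinj.encard_image]
        congr 1; ext ⟨a, c⟩
        simp only [mem_image, mem_ofPred_eq, Prod.mk.injEq]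
        constructor
        · rintro ⟨x, hx, rfl, rfl⟩; exact ⟨hx, rfl⟩
        · rintro ⟨h, rfl⟩; exact ⟨a, h, rfl, rfl⟩
      rw [h1, ← encard_union_eq]
      · congr 1; ext p; simp only [Finset.mem_insert, mem_ofPred_eq, mem_union]; tauto
      · rw [Set.disjoint_left]; rintro p ⟨-, rfl⟩ ⟨-, h⟩; exact hb h
  simpa using key Finset.univ

/-- `comparisonZero ω` enumerates the zeros of `comparison ω` with multiplicities: the indices `(-0, q)`
account for the zero of order `m` of the monomial, all others for the zeros of the sines. -/
theorem encard_comparisonZero {m : ℕ} (ω : Fin m → ℝ) (z : ℂ) :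
    {p | comparisonZero ω p = z}.encard = analyticOrderAt (comparison ω) z := by
  rw [encard_prod_fin]
  have h1 : ∀ q, {n : SignedIndex | comparisonZero ω (n, q) = z}.encard =
      analyticOrderAt (fun w : ℂ => w) z +
        analyticOrderAt (fun w => cexp (2 * π * I * w) - cexp (2 * π * I * ω q)) z := by
    intro q
    rw [analyticOrderAt_exp_sub, ← encard_signedIndex fun k => (k : ℂ) + ω q = z]
    have : analyticOrderAt (fun w : ℂ => w) z =
        {n : SignedIndex | n = Sum.inr 0 ∧ z = 0}.encard := by
      by_cases h : z = 0
      · subst h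
        simpa using analyticOrderAt_id_sub_const_self (𝕜 := ℂ) (c := 0)
      · simpa [h] using analyticOrderAt_id_sub_const_of_ne (𝕜 := ℂ) h
    rw [this, ← encard_union_eq]
    · congr 1; ext n
      simp only [comparisonZero, mem_ofPred_eq, mem_union]
      by_cases hn : n = Sum.inr 0 <;> simp [hn, eq_comm]
    · rw [Set.disjoint_left]; rintro n ⟨h, -⟩ ⟨h', -⟩; exact h' h
  simp only [h1, Finset.sum_add_distrib]
  have h2 : comparison ω = (fun w : ℂ => w) ^ m * ((fun w => cexp (-(I * π * w)) ^ m) *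
      fun w => ∏ q, (cexp (2 * π * I * w) - cexp (2 * π * I * ω q))) := rfl
  have h3 : analyticOrderAt (fun w => cexp (-(I * π * w)) ^ m) z = 0 :=
    (AnalyticAt.analyticOrderAt_eq_zero (by fun_prop)).2 (pow_ne_zero m (exp_ne_zero _))
  rw [h2, analyticOrderAt_mul (by fun_prop) (by fun_prop), analyticOrderAt_mul (by fun_prop)
    (by fun_prop), analyticOrderAt_pow (by fun_prop), analyticOrderAt_finset_prod _ _
    (fun i _ => by fun_prop), h3, zero_add]
  simp

/-- Two families that can be sorted by the same keys, with finitely many and equally many members for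
each key, can be matched. -/
theorem exists_equiv_of_encard_fiber_eq {ι κ K : Type*} (a : ι → K) (b : κ → K)
    (h : ∀ k, {p | a p = k}.encard = {s | b s = k}.encard) (hfin : ∀ k, {p | a p = k}.Finite) :
    ∃ e : ι ≃ κ, ∀ p, b (e p) = a p := by
  have hfin' : ∀ k, {s | b s = k}.Finite := fun k =>
    Set.encard_ne_top_iff.1 (by rw [← h k]; exact (hfin k).encard_lt_top.ne)
  have h1 : ∀ k, Nonempty ({p // a p = k} ≃ {s // b s = k}) := by
    intro k
    have : Finite {p // a p = k} := hfin k
    have : Finite {s // b s = k} := hfin' k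
    rw [← Finite.card_eq]
    exact congrArg ENat.toNat (h k)
  have E := fun k => (h1 k).some
  refine ⟨((Equiv.sigmaFiberEquiv a).symm.trans (Equiv.sigmaCongrRight E)).trans
    (Equiv.sigmaFiberEquiv b), fun p => ?_⟩
  exact (E (a p) ⟨p, rfl⟩).2

/-- The real numbers `n + ω_q`, `n ∈ ℤ`. -/
def nodes {m : ℕ} (ω : Fin m → ℝ) : Set ℝ := {x | ∃ (n : ℤ) (q : Fin m), (n : ℝ) + ω q = x}

theorem eventually_eq_zero_or_le_abs (d : ℝ) :
    ∀ᶠ η : ℝ in 𝓝[>] 0, ∀ n : ℤ, (n : ℝ) + d = 0 ∨ 4 * η ≤ |(n : ℝ) + d| := by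
  have hlt : ∀ a : ℝ, 0 < a → ∀ᶠ η : ℝ in 𝓝[>] 0, 4 * η ≤ a := fun a ha => by
    have : ∀ᶠ η : ℝ in 𝓝[>] 0, η < a / 4 := nhdsWithin_le_nhds (eventually_lt_nhds (by linarith))
    filter_upwards [this] with η hη
    linarith
  have h1 := Int.fract_nonneg d
  have h2 := Int.fract_lt_one d
  have h3 := Int.floor_add_fract d
  have hcast : ∀ k : ℤ, (k ≤ -1 → (k : ℝ) ≤ -1) ∧ (0 ≤ k → (0 : ℝ) ≤ k) ∧ (1 ≤ k → (1 : ℝ) ≤ k) :=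
    fun k => ⟨fun h => by exact_mod_cast h, fun h => by exact_mod_cast h,
      fun h => by exact_mod_cast h⟩
  rcases eq_or_lt_of_le h1 with h | h
  · filter_upwards [hlt 1 one_pos] with η hη n
    obtain ⟨c1, -, c2⟩ := hcast (n + ⌊d⌋)
    rcases lt_trichotomy (n + ⌊d⌋) 0 with h0 | h0 | h0
    · right; have := c1 (by omega); push_cast at this
      rw [abs_of_neg (by linarith)]; linarith
    · left; have : ((n + ⌊d⌋ : ℤ) : ℝ) = 0 := by exact_mod_cast h0
      push_cast at this; linarith
    · right; have := c2 (by omega); push_cast at this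
      rw [abs_of_pos (by linarith)]; linarith
  · filter_upwards [hlt _ h, hlt _ (sub_pos.2 h2)] with η hη hη' n
    obtain ⟨c1, c2, -⟩ := hcast (n + ⌊d⌋)
    right
    rcases lt_or_ge (n + ⌊d⌋) 0 with h0 | h0
    · have := c1 (by omega); push_cast at this
      rw [abs_of_neg (by linarith)]; linarith
    · have := c2 h0; push_cast at this
      rw [abs_of_pos (by linarith)]; linarith

/-- The nodes are periodic, so that distinct nodes have a positive distance, as do nodes and integers
that are distinct. The latter allows circles about `0` that avoid all nodes. -/
theorem exists_gap {m : ℕ} (ω : Fin m → ℝ) : ∃ η : ℝ, 0 < η ∧ η ≤ 1 / 8 ∧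
    (∀ x ∈ nodes ω, ∀ y ∈ nodes ω, x = y ∨ 4 * η ≤ |x - y|) ∧
    ∀ x ∈ nodes ω, ∀ k : ℤ, x = k ∨ 4 * η ≤ |x - k| := by
  have h1 : ∀ᶠ η : ℝ in 𝓝[>] 0, ∀ q q', ∀ n : ℤ, (n : ℝ) + (ω q - ω q') = 0 ∨
      4 * η ≤ |(n : ℝ) + (ω q - ω q')| :=
    eventually_all.2 fun q => eventually_all.2 fun q' => eventually_eq_zero_or_le_abs _
  have h2 : ∀ᶠ η : ℝ in 𝓝[>] 0, ∀ q, ∀ n : ℤ, (n : ℝ) + ω q = 0 ∨ 4 * η ≤ |(n : ℝ) + ω q| :=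
    eventually_all.2 fun q => eventually_eq_zero_or_le_abs _
  have h3 : ∀ᶠ η : ℝ in 𝓝[>] 0, η < 1 / 8 := nhdsWithin_le_nhds (eventually_lt_nhds (by norm_num))
  obtain ⟨η, h1, h2, h3, h4⟩ := (h1.and (h2.and (h3.and self_mem_nhdsWithin))).exists
  refine ⟨η, h4, h3.le, ?_, ?_⟩
  · rintro _ ⟨n, q, rfl⟩ _ ⟨n', q', rfl⟩
    have := h1 q q' (n - n')
    rw [show ((n - n' : ℤ) : ℝ) + (ω q - ω q') = (n : ℝ) + ω q - (n' + ω q') by push_cast; ring,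
      sub_eq_zero] at this
    exact this
  · rintro _ ⟨n, q, rfl⟩ k
    have := h2 q (n - k)
    rw [show ((n - k : ℤ) : ℝ) + ω q = (n : ℝ) + ω q - k by push_cast; ring, sub_eq_zero] at this
    exact this

/-- A multiple of `F` is dominated by `comparison ω` away from the nodes, where the distance to the
nodes is allowed to decay as the reciprocal of the modulus. -/
def IsComparable {m : ℕ} (ω : Fin m → ℝ) (F : ℂ → ℂ) : Prop :=
  ∃ (C R : ℝ) (c : ℂ), 0 < C ∧ 1 ≤ R ∧ c ≠ 0 ∧ ∀ (ρ : ℂ) (δ : ℝ), R ≤ ‖ρ‖ → C ≤ δ * ‖ρ‖ →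
    δ ≤ 1 / 2 → (∀ x ∈ nodes ω, δ ≤ ‖ρ - x‖) →
      ‖c * F ρ - comparison ω ρ‖ < ‖comparison ω ρ‖

theorem IsComparable.exists_node_near {m : ℕ} {ω : Fin m → ℝ} {F : ℂ → ℂ}
    (h : IsComparable ω F) : ∃ C R : ℝ, 0 < C ∧ 1 ≤ R ∧ ∀ z, R ≤ ‖z‖ → F z = 0 →
      ∃ x ∈ nodes ω, ‖z - x‖ < C / ‖z‖ := by
  obtain ⟨C, R, c, hC, hR, hc, h⟩ := h
  -- the factor `2` makes the admissible distance `C / |z|` at most `1 / 2`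
  refine ⟨C, max R (2 * C), hC, hR.trans (le_max_left _ _), fun z hz h0 => ?_⟩
  have hz0 : 0 < ‖z‖ := one_pos.trans_le (hR.trans ((le_max_left _ _).trans hz))
  by_contra! hcon
  have := h z (C / ‖z‖) ((le_max_left _ _).trans hz) (by rw [div_mul_cancel₀ _ hz0.ne'])
    (by rw [div_le_iff₀ hz0]; linarith [(le_max_right _ _).trans hz]) hcon
  rw [h0, mul_zero, zero_sub, norm_neg] at this
  exact lt_irrefl _ this

theorem analyticOrderAt_const_mul {F : ℂ → ℂ} (hF : Differentiable ℂ F) {c : ℂ} (hc : c ≠ 0)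
    (z : ℂ) : analyticOrderAt (fun w => c * F w) z = analyticOrderAt F z := by
  rw [show (fun w => c * F w) = (fun _ => c) * F from rfl, analyticOrderAt_mul (by fun_prop)
    (hF.analyticAt z), (AnalyticAt.analyticOrderAt_eq_zero (by fun_prop)).2 hc, zero_add]

/-- Far out, every enumeration of the zeros of `F` has as many members in a disc as
`comparisonZero`, provided that the circle keeps a fixed distance from the nodes. -/
theorem IsComparable.encard_eq {m : ℕ} {ω : Fin m → ℝ} {F : ℂ → ℂ} (h : IsComparable ω F)
    (hF : Differentiable ℂ F) {η : ℝ} (hη : 0 < η) (hη' : η ≤ 1 / 2) :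
    ∃ R : ℝ, ∀ (a : ℂ) (r : ℝ), 0 < r → (∀ z ∈ sphere a r, R ≤ ‖z‖ ∧ ∀ x ∈ nodes ω, η ≤ ‖z - x‖) →
      ∀ {κ : Type} (v : κ → ℂ), (∀ z, {p | v p = z}.encard = analyticOrderAt F z) →
      {p | comparisonZero ω p ∈ ball a r}.encard = {p | v p ∈ ball a r}.encard ∧
        {p | comparisonZero ω p ∈ ball a r}.Finite := by
  obtain ⟨C, R, c, hC, hR, hc, h⟩ := h
  refine ⟨max R (C / η), fun a r hr hs κ v hv => ?_⟩
  refine rouche_encard (differentiable_comparison ω) (hF.const_mul c) hr (fun z hz => ?_) _ v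
    (encard_comparisonZero ω) fun z => (hv z).trans (analyticOrderAt_const_mul hF hc z).symm
  obtain ⟨h1, h2⟩ := hs z hz
  refine h z η ((le_max_left _ _).trans h1) ?_ hη' h2
  have := (le_max_right _ _).trans h1
  rw [div_le_iff₀ hη] at this
  linarith

theorem comparisonZero_eq {m : ℕ} (ω : Fin m → ℝ) {p : SignedIndex × Fin m}
    (h : comparisonZero ω p ≠ 0) :
    comparisonZero ω p = ((p.1.val + ω p.2 : ℝ) : ℂ) ∧ (p.1.val + ω p.2 : ℝ) ∈ nodes ω := by
  unfold comparisonZero at *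
  split_ifs at h with h1
  · exact absurd rfl h
  · rw [if_neg h1]
    exact ⟨by push_cast; rfl, _, _, rfl⟩

end Comparison

section Numbering

open Metric Complex

variable {m : ℕ} {ω : Fin m → ℝ} {F : ℂ → ℂ} {η : ℝ}

theorem le_norm_sub_of_mem_sphere (hη : 0 < η)
    (hgap : ∀ x ∈ nodes ω, ∀ y ∈ nodes ω, x = y ∨ 4 * η ≤ |x - y|) {x : ℝ} (hx : x ∈ nodes ω)
    {z : ℂ} (hz : z ∈ sphere (x : ℂ) η) : ∀ y ∈ nodes ω, η ≤ ‖z - y‖ := by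
  intro y hy
  rw [mem_sphere, dist_eq_norm] at hz
  rcases hgap x hx y hy with rfl | h
  · exact hz.ge
  · have h1 : ‖(x : ℂ) - y‖ = |x - y| := by rw [← ofReal_sub, norm_real, Real.norm_eq_abs]
    have h2 := norm_sub_le_norm_sub_add_norm_sub (x : ℂ) z y
    rw [norm_sub_rev (x : ℂ) z] at h2
    linarith

theorem abs_eq_natCast_or_le (hgap : ∀ x ∈ nodes ω, ∀ k : ℤ, x = k ∨ 4 * η ≤ |x - k|) {x : ℝ}
    (hx : x ∈ nodes ω) (K : ℕ) : |x| = K ∨ 4 * η ≤ |(|x| - K)| := by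
  have h1 := hgap x hx K
  have h2 := hgap x hx (-K)
  push_cast at h1 h2
  have hK : (0 : ℝ) ≤ K := Nat.cast_nonneg K
  rcases abs_cases x with ⟨h, h'⟩ | ⟨h, h'⟩ <;> rw [h]
  · exact h1
  · rw [← abs_neg]
    rcases h2 with h2 | h2
    · left; linarith
    · right; rwa [neg_sub, show (K : ℝ) - -x = x - -K by ring]

theorem le_norm_sub_of_mem_sphere_zero (hη : 0 < η)
    (hgap : ∀ x ∈ nodes ω, ∀ k : ℤ, x = k ∨ 4 * η ≤ |x - k|) (K : ℕ)
    {z : ℂ} (hz : z ∈ sphere (0 : ℂ) (K + 2 * η)) : ∀ y ∈ nodes ω, η ≤ ‖z - y‖ := by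
  intro y hy
  rw [mem_sphere, dist_eq_norm, sub_zero] at hz
  have h1 : |(‖z‖ - |y|)| ≤ ‖z - y‖ := by
    have := abs_norm_sub_norm_le z (y : ℂ)
    rwa [norm_real, Real.norm_eq_abs] at this
  rw [hz] at h1
  refine le_trans ?_ h1
  rcases abs_eq_natCast_or_le hgap hy K with h | h
  · rw [h, abs_of_pos] <;> linarith
  · rcases le_abs.1 h with h | h
    · rw [abs_of_neg] <;> linarith
    · rw [abs_of_pos] <;> linarith

theorem norm_ofReal_sub_lt_iff
    (hgap : ∀ x ∈ nodes ω, ∀ y ∈ nodes ω, x = y ∨ 4 * η ≤ |x - y|) (hη : 0 < η) {x y : ℝ}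
    (hx : x ∈ nodes ω) (hy : y ∈ nodes ω) : (y : ℂ) ∈ ball (x : ℂ) η ↔ y = x := by
  rw [mem_ball, dist_eq_norm, ← ofReal_sub, norm_real, Real.norm_eq_abs]
  constructor
  · intro h
    rcases hgap y hy x hx with h1 | h1
    · exact h1
    · linarith
  · rintro rfl; simpa using hη

/-- The zeros of a function comparable to `comparison ω` can be matched with the numbers
`n + ω_q`, `n ∈ w`: inside a large disc the numbers of zeros agree, and every zero outside is
close to a node, near which the numbers of zeros agree as well. -/
theorem IsComparable.exists_numbering (h : IsComparable ω F) (hF : Differentiable ℂ F)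
    (hω : ∀ q, ω q ∈ Ico (0 : ℝ) 1) {κ : Type} (v : κ → ℂ)
    (hv : ∀ z, {p | v p = z}.encard = analyticOrderAt F z) :
    ∃ e : SignedIndex × Fin m ≃ κ, ∃ (C : ℝ) (N : ℕ), 1 ≤ N ∧ ∀ p : SignedIndex × Fin m,
      (N : ℤ) ≤ |p.1.val| → ‖v (e p) - ((p.1.val : ℂ) + ω p.2)‖ ≤ C / |(p.1.val : ℝ)| := by
  obtain ⟨η, hη, hη8, hgap, hgapZ⟩ := exists_gap ω
  obtain ⟨R, hR⟩ := h.encard_eq hF hη (by linarith)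
  obtain ⟨C, R', hC, hR', hnear⟩ := h.exists_node_near
  obtain ⟨K, hK⟩ := exists_nat_ge (max (R + 1) (max R' (C / η)))
  have hK1 : R + 1 ≤ K := (le_max_left _ _).trans hK
  have hK2 : R' ≤ K := ((le_max_left _ _).trans (le_max_right _ _)).trans hK
  have hK3 : C / η ≤ K := ((le_max_right _ _).trans (le_max_right _ _)).trans hK
  have hK0 : (1 : ℝ) ≤ K := hR'.trans hK2
  -- the radius of the large disc; no node is within `η` of its boundary
  set r := (K : ℝ) + 2 * η with hr
  set u := comparisonZero ω with hu
  have hv0 : ∀ s, F (v s) = 0 := fun s => by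
    refine apply_eq_zero_of_analyticOrderAt_ne_zero (z₀ := v s) ?_
    rw [← hv, Set.encard_ne_zero]
    exact ⟨s, rfl⟩
  have hnd : ∀ s, ∃ x : ℝ, r ≤ ‖v s‖ → x ∈ nodes ω ∧ ‖v s - x‖ < C / ‖v s‖ ∧ ‖v s - x‖ < η := by
    intro s
    by_cases hs : r ≤ ‖v s‖
    · obtain ⟨x, hx, hxs⟩ := hnear (v s) (by linarith) (hv0 s)
      refine ⟨x, fun _ => ⟨hx, hxs, hxs.trans_le ?_⟩⟩
      rw [div_le_iff₀ hη] at hK3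
      rw [div_le_iff₀ (by linarith)]
      nlinarith
    · exact ⟨0, fun h => absurd h hs⟩
  choose nd hnd using hnd
  -- a node that is not inside the large disc is well outside
  have hfar : ∀ x ∈ nodes ω, (K : ℝ) + η ≤ |x| → (K : ℝ) + 4 * η ≤ |x| := by
    intro x hx hxK
    rcases abs_eq_natCast_or_le hgapZ hx K with h1 | h1
    · linarith
    · rw [abs_of_pos (by linarith)] at h1; linarith
  have hure : ∀ p, r ≤ ‖u p‖ → u p = ((u p).re : ℂ) ∧ (u p).re ∈ nodes ω ∧
      ‖u p‖ = |(u p).re| := by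
    intro p hp
    have h0 : u p ≠ 0 := by rw [← norm_pos_iff]; linarith
    obtain ⟨h1, h2⟩ := comparisonZero_eq ω h0
    rw [← hu] at h1
    rw [h1]
    exact ⟨by simp, by simpa using h2, by rw [norm_real, Real.norm_eq_abs, ofReal_re]⟩
  have htri : ∀ (z : ℂ) (x : ℝ), ‖z - x‖ < η → ‖z‖ < |x| + η ∧ |x| < ‖z‖ + η := by
    intro z x hz
    have := abs_norm_sub_norm_le z (x : ℂ)
    rw [norm_real, Real.norm_eq_abs, abs_le] at this
    constructor <;> linarith [this.1, this.2]
  -- sort both families by a key: `none` inside the large disc, and the node close by outside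
  have hab : ∀ k, {p | (if r ≤ ‖u p‖ then some (u p).re else none) = k}.encard =
      {s | (if r ≤ ‖v s‖ then some (nd s) else none) = k}.encard := by
    rintro (_ | x)
    · have := (hR 0 r (by linarith) (fun z hz => ⟨by
        rw [mem_sphere, dist_eq_norm, sub_zero] at hz; linarith,
        le_norm_sub_of_mem_sphere_zero hη hgapZ K hz⟩) v hv).1
      simpa [← not_le] using this
    · by_cases hx : x ∈ nodes ω ∧ (K : ℝ) + 4 * η ≤ |x|
      · obtain ⟨hx, hxK⟩ := hx
        have := (hR x η hη (fun z hz => ⟨by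
          rw [mem_sphere, dist_eq_norm] at hz
          have := abs_norm_sub_norm_le z (x : ℂ)
          rw [norm_real, Real.norm_eq_abs, abs_le] at this
          linarith [this.1], le_norm_sub_of_mem_sphere hη hgap hx hz⟩) v hv).1
        convert this using 3
        · funext p
          rw [Option.ite_none_right_eq_some, Option.some.injEq, eq_iff_iff]
          constructor
          · rintro ⟨h1, h2⟩
            rw [(hure p h1).1, h2]; simpa using hη
          · intro h1
            have h2 : r ≤ ‖u p‖ := by
              have := (htri (u p) x (by rwa [mem_ball, dist_eq_norm] at h1)).2
              linarith
            obtain ⟨h3, h4, -⟩ := hure p h2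
            rw [h3] at h1
            exact ⟨h2, (norm_ofReal_sub_lt_iff hgap hη hx h4).1 h1⟩
        · funext s
          rw [Option.ite_none_right_eq_some, Option.some.injEq, eq_iff_iff]
          constructor
          · rintro ⟨h1, h2⟩
            rw [mem_ball, dist_eq_norm, ← h2]
            exact (hnd s h1).2.2
          · intro h1
            rw [mem_ball, dist_eq_norm] at h1
            have h2 : r ≤ ‖v s‖ := by
              have := (htri (v s) x h1).2
              linarith
            refine ⟨h2, ?_⟩
            obtain ⟨h3, -, h4⟩ := hnd s h2
            rcases hgap _ h3 x hx with h5 | h5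
            · exact h5
            · have h6 : ‖(nd s : ℂ) - x‖ = |nd s - x| := by
                rw [← ofReal_sub, norm_real, Real.norm_eq_abs]
              have h7 := norm_sub_le_norm_sub_add_norm_sub (nd s : ℂ) (v s) x
              rw [norm_sub_rev (nd s : ℂ) (v s)] at h7
              linarith
      · have e1 : {p | (if r ≤ ‖u p‖ then some (u p).re else none) = some x} = ∅ := by
          rw [Set.eq_empty_iff_forall_notMem]
          intro p hp
          simp only [mem_ofPred_eq, Option.ite_none_right_eq_some, Option.some.injEq] at hp
          obtain ⟨h1, h2⟩ := hp
          obtain ⟨-, h4, h5⟩ := hure p h1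
          rw [h2] at h4 h5
          exact hx ⟨h4, hfar x h4 (by linarith)⟩
        have e2 : {s | (if r ≤ ‖v s‖ then some (nd s) else none) = some x} = ∅ := by
          rw [Set.eq_empty_iff_forall_notMem]
          intro s hs
          simp only [mem_ofPred_eq, Option.ite_none_right_eq_some, Option.some.injEq] at hs
          obtain ⟨h1, h2⟩ := hs
          obtain ⟨h4, -, h5⟩ := hnd s h1
          rw [h2] at h4 h5
          exact hx ⟨h4, hfar x h4 (by linarith [(htri _ _ h5).1])⟩
        rw [e1, e2, encard_empty, encard_empty]
  have hfin : ∀ k, {p | (if r ≤ ‖u p‖ then some (u p).re else none) = k}.Finite := by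
    rintro (_ | x)
    · have := (hR 0 r (by linarith) (fun z hz => ⟨by
        rw [mem_sphere, dist_eq_norm, sub_zero] at hz; linarith,
        le_norm_sub_of_mem_sphere_zero hη hgapZ K hz⟩) v hv).2
      simpa [← not_le] using this
    · by_cases hx : x ∈ nodes ω ∧ (K : ℝ) + 4 * η ≤ |x|
      · obtain ⟨hx, hxK⟩ := hx
        refine (hR x η hη (fun z hz => ⟨by
          rw [mem_sphere, dist_eq_norm] at hz
          have := abs_norm_sub_norm_le z (x : ℂ)
          rw [norm_real, Real.norm_eq_abs, abs_le] at this
          linarith [this.1], le_norm_sub_of_mem_sphere hη hgap hx hz⟩) v hv).2.subset ?_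
        intro p hp
        simp only [mem_ofPred_eq, Option.ite_none_right_eq_some, Option.some.injEq] at hp ⊢
        rw [(hure p hp.1).1, hp.2]; simpa using hη
      · refine Set.finite_empty.subset ?_
        intro p hp
        simp only [mem_ofPred_eq, Option.ite_none_right_eq_some, Option.some.injEq] at hp
        obtain ⟨h1, h2⟩ := hp
        obtain ⟨-, h4, h5⟩ := hure p h1
        rw [h2] at h4 h5
        exact hx ⟨h4, hfar x h4 (by linarith)⟩
  obtain ⟨e, he⟩ := exists_equiv_of_encard_fiber_eq _ _ hab hfin
  refine ⟨e, 3 * C, K + 3, by omega, fun p hp => ?_⟩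
  have hp' : (K : ℝ) + 3 ≤ |(p.1.val : ℝ)| := by exact_mod_cast hp
  have hne : p.1 ≠ Sum.inr 0 := by
    intro h0
    rw [h0] at hp'
    simp [SignedIndex.val] at hp'
    linarith
  have hup : u p = ((p.1.val + ω p.2 : ℝ) : ℂ) := by
    rw [hu, comparisonZero, if_neg hne]; push_cast; rfl
  have habs : |(p.1.val : ℝ)| - 1 ≤ |(p.1.val + ω p.2 : ℝ)| := by
    have h1 := abs_sub_abs_le_abs_sub (p.1.val : ℝ) (-ω p.2)
    rw [abs_neg, abs_of_nonneg (hω p.2).1, sub_neg_eq_add] at h1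
    linarith [(hω p.2).2]
  have hun : ‖u p‖ = |(p.1.val + ω p.2 : ℝ)| := by rw [hup, norm_real, Real.norm_eq_abs]
  have h1 := he p
  have h2 : r ≤ ‖u p‖ := by rw [hun]; linarith
  rw [if_pos h2] at h1
  simp only [Option.ite_none_right_eq_some, Option.some.injEq] at h1
  obtain ⟨h3, h4⟩ := h1
  obtain ⟨-, h6, h7⟩ := hnd (e p) h3
  rw [h4, ← (hure p h2).1, hup] at h6
  rw [h4] at h7
  have h8 := (htri _ _ h7).2
  rw [← (hure p h2).2.2, hun] at h8
  have h9 : ((p.1.val : ℂ) + ω p.2) = ((p.1.val + ω p.2 : ℝ) : ℂ) := by push_cast; rfl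
  rw [h9]
  refine h6.le.trans ?_
  rw [div_le_div_iff₀ (by linarith) (by linarith)]
  nlinarith

theorem SignedIndex.eq_of_val_eq {n n' : SignedIndex} (h : n.val = n'.val) (h0 : n.val ≠ 0) :
    n = n' := by
  rcases n with a | a <;> rcases n' with b | b <;> simp [SignedIndex.val] at * <;> omega

/-- In an arbitrary numbering, the zeros near a remote node `n + ω_q` are exactly those with the
same `n` and the same `ω_q`. -/
theorem IsComparable.mem_ball_iff (h : IsComparable ω F) (hF : Differentiable ℂ F)
    (hω : ∀ q, ω q ∈ Ico (0 : ℝ) 1) (hη : 0 < η) (hη8 : η ≤ 1 / 8)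
    (hgap : ∀ x ∈ nodes ω, ∀ y ∈ nodes ω, x = y ∨ 4 * η ≤ |x - y|)
    (ρ : SignedIndex → Fin m → ℂ)
    (hρ : ∀ z, {p : SignedIndex × Fin m | ρ p.1 p.2 = z}.encard = analyticOrderAt F z)
    (has : ∃ C : ℝ, ∃ N : ℕ, 1 ≤ N ∧ ∀ n : SignedIndex, (N : ℤ) ≤ |n.val| → ∀ q,
      ‖ρ n q - ((n.val : ℂ) + (ω q : ℂ))‖ ≤ C / |(n.val : ℝ)|) :
    ∃ N : ℕ, 1 ≤ N ∧ ∀ n : SignedIndex, (N : ℤ) ≤ |n.val| → ∀ q (p : SignedIndex × Fin m),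
      ρ p.1 p.2 ∈ ball ((n.val : ℂ) + ω q) η ↔ p.1 = n ∧ ω p.2 = ω q := by
  obtain ⟨R, hR⟩ := h.encard_eq hF hη (by linarith)
  obtain ⟨C, N, hN, has⟩ := has
  obtain ⟨N', hN'⟩ := exists_nat_gt (max (R + 2) (C / η))
  refine ⟨max N (N' + 2), hN.trans (le_max_left _ _), fun n hn q => ?_⟩
  have hn1 : (N : ℤ) ≤ |n.val| := le_trans (by exact_mod_cast le_max_left _ _) hn
  have hn2' : ((N' + 2 : ℕ) : ℤ) ≤ |n.val| := le_trans (by exact_mod_cast le_max_right _ _) hn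
  have hn2 : (N' : ℝ) + 2 ≤ |(n.val : ℝ)| := by exact_mod_cast hn2'
  have hN0 : (0 : ℝ) ≤ N' := Nat.cast_nonneg N'
  have hRN : R + 2 < N' := (le_max_left _ _).trans_lt hN'
  have hCN : C / η < N' := (le_max_right _ _).trans_lt hN'
  set x : ℝ := n.val + ω q with hx
  have hxm : x ∈ nodes ω := ⟨_, _, rfl⟩
  have hxc : (n.val : ℂ) + ω q = (x : ℂ) := by rw [hx]; push_cast; rfl
  have habs : |(n.val : ℝ)| - 1 ≤ |x| := by
    have h1 := abs_sub_abs_le_abs_sub (n.val : ℝ) (-ω q)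
    rw [abs_neg, abs_of_nonneg (hω q).1, sub_neg_eq_add] at h1
    linarith [(hω q).2]
  have hnv : n.val ≠ 0 := by
    intro h0; rw [h0] at hn2; simp at hn2; linarith
  obtain ⟨h1, h2⟩ := hR x η hη (fun z hz => ⟨by
    rw [mem_sphere, dist_eq_norm] at hz
    have := abs_norm_sub_norm_le z (x : ℂ)
    rw [norm_real, Real.norm_eq_abs, abs_le] at this
    linarith [this.1], le_norm_sub_of_mem_sphere hη hgap hxm hz⟩) (fun p : SignedIndex × Fin m =>
      ρ p.1 p.2) hρ
  have h3 : {p | comparisonZero ω p ∈ ball (x : ℂ) η} = {p | p.1 = n ∧ ω p.2 = ω q} := by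
    ext p
    simp only [mem_ofPred_eq]
    constructor
    · intro hp
      have h0 : comparisonZero ω p ≠ 0 := by
        intro h0
        rw [h0, mem_ball, dist_eq_norm, zero_sub, norm_neg, norm_real, Real.norm_eq_abs] at hp
        linarith
      obtain ⟨h4, h5⟩ := comparisonZero_eq ω h0
      rw [h4, norm_ofReal_sub_lt_iff hgap hη hxm h5] at hp
      have h6 : p.1.val = n.val := by
        have a1 := hω p.2
        have a2 := hω q
        have a3 : ((p.1.val - n.val : ℤ) : ℝ) = ω q - ω p.2 := by push_cast; linarith
        have a4 : |((p.1.val - n.val : ℤ) : ℝ)| < 1 := by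
          rw [a3, abs_lt]; constructor <;> linarith [a1.1, a1.2, a2.1, a2.2]
        have a5 : |p.1.val - n.val| < 1 := by exact_mod_cast a4
        rw [abs_lt] at a5; omega
      refine ⟨(SignedIndex.eq_of_val_eq h6.symm hnv).symm, ?_⟩
      rw [h6] at hp; linarith
    · rintro ⟨rfl, h5⟩
      have : p.1 ≠ Sum.inr 0 := by rintro h0; rw [h0] at hnv; simp [SignedIndex.val] at hnv
      rw [comparisonZero, if_neg this, h5, hxc]; simpa using hη
  have h4 : {p : SignedIndex × Fin m | p.1 = n ∧ ω p.2 = ω q} ⊆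
      {p | ρ p.1 p.2 ∈ ball (x : ℂ) η} := by
    rintro p ⟨rfl, h5⟩
    have := has p.1 hn1 p.2
    rw [h5, hxc] at this
    rw [mem_ofPred_eq, mem_ball, dist_eq_norm]
    refine this.trans_lt ?_
    rw [div_lt_iff₀ hη] at hCN
    rw [div_lt_iff₀ (by linarith)]
    nlinarith
  rw [h3] at h1 h2
  have h5 : {p : SignedIndex × Fin m | ρ p.1 p.2 ∈ ball (x : ℂ) η}.Finite :=
    Set.encard_ne_top_iff.1 (by rw [← h1]; exact h2.encard_lt_top.ne)
  have h6 := h2.eq_of_subset_of_encard_le h4 h1.ge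
  intro p
  rw [hxc]
  exact (Set.ext_iff.1 h6 p).symm

end Numbering

/-! ### Residues at simple poles -/

section Residues

open Metric Complex

theorem differentiable_update_of_tendsto {f : ℂ → ℂ} {z a : ℂ}
    (hd : ∀ᶠ w in 𝓝[≠] z, DifferentiableAt ℂ f w) (h : Tendsto f (𝓝[≠] z) (𝓝 a)) :
    DifferentiableAt ℂ (Function.update f z a) z := by
  rw [eventually_nhdsWithin_iff] at hd
  refine DifferentiableOn.differentiableAt (s := {w | w ∈ ({z}ᶜ : Set ℂ) → DifferentiableAt ℂ f w})
    ?_ hd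
  refine (differentiableOn_compl_singleton_and_continuousAt_iff hd).1
    ⟨fun w hw => ?_, continuousAt_update_same.2 h⟩
  have hwz : w ≠ z := hw.2
  refine DifferentiableAt.differentiableWithinAt ((hw.1 hw.2).congr_of_eventuallyEq ?_)
  filter_upwards [isOpen_ne.mem_nhds hwz] with y hy
  exact Function.update_of_ne hy _ _

/-- The residue theorem for simple poles, by splitting off one pole at a time: the slope of
`(w - z) f(w)` at `z` is `f` without its polar part at `z`. -/
theorem circleIntegral_of_simple_poles (Z : Finset ℂ) {f : ℂ → ℂ} {c : ℂ} {r : ℝ} (hr : 0 < r)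
    (α : ℂ → ℂ) (hZ : ∀ z ∈ Z, z ∈ ball c r)
    (hd : ∀ w ∈ closedBall c r, w ∉ Z → DifferentiableAt ℂ f w)
    (hα : ∀ z ∈ Z, Tendsto (fun w => (w - z) * f w) (𝓝[≠] z) (𝓝 (α z))) :
    ∮ w in C(c, r), f w = 2 * π * I * ∑ z ∈ Z, α z := by
  induction Z using Finset.induction_on generalizing f with
  | empty =>
    simp only [Finset.sum_empty, mul_zero]
    refine circleIntegral_eq_zero_of_differentiable_on_off_countable hr.le countable_empty
      (fun w hw => (hd w hw (by simp)).continuousAt.continuousWithinAt) fun w hw =>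
      hd w (ball_subset_closedBall hw.1) (by simp)
  | insert z Z hz ih =>
    have hzb : z ∈ ball c r := hZ z (Finset.mem_insert_self z Z)
    set h : ℂ → ℂ := Function.update (fun w => (w - z) * f w) z (α z) with hh
    have hne : ∀ {w}, w ≠ z → DifferentiableAt ℂ f w → DifferentiableAt ℂ h w := by
      intro w hw hfw
      have h1 : DifferentiableAt ℂ (fun w => (w - z) * f w) w := by fun_prop
      refine h1.congr_of_eventuallyEq ?_
      filter_upwards [isOpen_ne.mem_nhds hw] with y hy
      exact Function.update_of_ne hy _ _
    have hzd : DifferentiableAt ℂ h z := by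
      refine differentiable_update_of_tendsto ?_ (hα z (Finset.mem_insert_self z Z))
      have h1 : (closedBall c r \ Z : Set ℂ) ∈ 𝓝 z :=
        inter_mem (mem_of_superset (isOpen_ball.mem_nhds hzb) ball_subset_closedBall)
          (Z.finite_toSet.isClosed.isOpen_compl.mem_nhds hz)
      filter_upwards [nhdsWithin_le_nhds h1, self_mem_nhdsWithin] with w hw hwz
      have hwz' : w ≠ z := hwz
      have := hd w hw.1 (by
        rw [Finset.mem_insert, not_or]; exact ⟨hwz', fun h => hw.2 (by exact_mod_cast h)⟩)
      fun_prop
    have hds : ∀ w, w ≠ z → dslope h z w = f w - α z * (w - z)⁻¹ := by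
      intro w hw
      rw [dslope_of_ne _ hw, slope_def_field, hh, Function.update_of_ne hw, Function.update_self]
      have := sub_ne_zero.2 hw
      field_simp
    have hdd : ∀ w ∈ closedBall c r, w ∉ Z → DifferentiableAt ℂ (dslope h z) w := by
      intro w hw hwZ
      rcases eq_or_ne w z with rfl | hwz
      · have h1 : (closedBall c r \ Z : Set ℂ) ∈ 𝓝 w :=
          inter_mem (mem_of_superset (isOpen_ball.mem_nhds hzb) ball_subset_closedBall)
            (Z.finite_toSet.isClosed.isOpen_compl.mem_nhds hz)
        refine ((differentiableOn_dslope h1).2 fun y hy => ?_).differentiableAt h1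
        refine DifferentiableAt.differentiableWithinAt ?_
        rcases eq_or_ne y w with rfl | hyw
        · exact hzd
        · exact hne hyw (hd y hy.1 (by
            rw [Finset.mem_insert, not_or]; exact ⟨hyw, fun h => hy.2 (by exact_mod_cast h)⟩))
      · rw [differentiableAt_dslope_of_ne hwz]
        exact hne hwz (hd w hw (by rw [Finset.mem_insert, not_or]; exact ⟨hwz, hwZ⟩))
    have key := ih (f := dslope h z) (fun y hy => hZ y (Finset.mem_insert_of_mem hy)) hdd
      (fun y hy => by
        have hyz : y ≠ z := fun h => hz (h ▸ hy)
        have h1 := hα y (Finset.mem_insert_of_mem hy)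
        have hy0 : y - z ≠ 0 := sub_ne_zero.2 hyz
        have h2 : Tendsto (fun w => (w - y) * (α z * (w - z)⁻¹)) (𝓝[≠] y) (𝓝 0) := by
          have : ContinuousAt (fun w => (w - y) * (α z * (w - z)⁻¹)) y := by fun_prop (disch := exact hy0)
          have h3 := this.tendsto.mono_left (nhdsWithin_le_nhds (s := {y}ᶜ))
          simpa using h3
        have h3 := h1.sub h2
        rw [sub_zero] at h3
        refine h3.congr' ?_
        filter_upwards [nhdsWithin_le_nhds (isOpen_ne.mem_nhds hyz)] with w hw
        rw [hds w hw]; ring)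
    rw [Finset.sum_insert hz, mul_add, ← key]
    have hsph : ∀ w ∈ sphere c r, w ≠ z := fun w hw h => by
      rw [← h, mem_ball, mem_sphere.1 hw] at hzb; exact lt_irrefl _ hzb
    have hZs : ∀ w ∈ sphere c r, w ∉ Z := fun w hw h => by
      have := hZ w (Finset.mem_insert_of_mem h)
      rw [mem_ball, mem_sphere.1 hw] at this; exact lt_irrefl _ this
    have hc1 : ContinuousOn (fun w => α z * (w - z)⁻¹) (sphere c r) :=
      continuousOn_const.mul ((continuous_id.sub continuous_const).continuousOn.inv₀
        fun w hw => sub_ne_zero.2 (hsph w hw))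
    have hc2 : ContinuousOn (dslope h z) (sphere c r) := fun w hw =>
      (hdd w (sphere_subset_closedBall hw) (hZs w hw)).continuousAt.continuousWithinAt
    rw [circleIntegral.integral_congr hr.le (g := fun w => α z * (w - z)⁻¹ + dslope h z w)
      (fun w hw => by simp only [hds w (hsph w hw)]; ring),
      circleIntegral.integral_add (hc1.circleIntegrable hr.le) (hc2.circleIntegrable hr.le),
      circleIntegral.integral_const_mul, circleIntegral.integral_sub_inv_of_mem_ball hzb]
    ring

/-- At a pole that is at most simple, the residue is the limit of `(w - z) f(w)`. -/
theorem residueAt_eq {f : ℂ → ℂ} {z a : ℂ} (hd : ∀ᶠ w in 𝓝[≠] z, DifferentiableAt ℂ f w)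
    (h : Tendsto (fun w => (w - z) * f w) (𝓝[≠] z) (𝓝 a)) : residueAt f z = a := by
  refine Tendsto.limUnder_eq ?_
  rw [eventually_nhdsWithin_iff, Metric.eventually_nhds_iff] at hd
  obtain ⟨ε, hε, hd⟩ := hd
  refine tendsto_const_nhds.congr' ?_
  filter_upwards [Ioo_mem_nhdsGT hε] with r hr
  rw [circleIntegral_of_simple_poles {z} hr.1 (fun _ => a) (by simpa using hr.1)
    (fun w hw hwz => hd ((mem_closedBall.1 hw).trans_lt hr.2) (by simpa using hwz))
    (by simpa using h)]
  simp only [Finset.sum_singleton]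
  rw [← mul_assoc, inv_mul_cancel₀ two_pi_I_ne_zero, one_mul]

end Residues

/-! ### Unitary matrices and ranks of residues -/

section LinearAlgebra

open Complex

variable {m : ℕ}

theorem Matrix.IsHermitian.exists_unitary_diagonal {H : Matrix (Fin m) (Fin m) ℂ}
    (hH : H.IsHermitian) : ∃ (U : Matrix (Fin m) (Fin m) ℂ) (d : Fin m → ℝ), Uᴴ * U = 1 ∧
      U * Uᴴ = 1 ∧ H = U * Matrix.diagonal (fun i => (d i : ℂ)) * Uᴴ := by
  refine ⟨hH.eigenvectorUnitary, hH.eigenvalues, ?_, ?_, ?_⟩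
  · exact (Matrix.mem_unitaryGroup_iff'.1 hH.eigenvectorUnitary.2)
  · exact (Matrix.mem_unitaryGroup_iff.1 hH.eigenvectorUnitary.2)
  · conv_lhs => rw [hH.spectral_theorem]
    rfl

theorem exists_mem_Ico_exp_eq {μ : ℂ} (hμ : ‖μ‖ = 1) :
    ∃ t ∈ Ico (0 : ℝ) 1, cexp (2 * π * I * t) = μ := by
  refine ⟨Int.fract (μ.arg / (2 * π)), ⟨Int.fract_nonneg _, Int.fract_lt_one _⟩, ?_⟩
  have h1 : 2 * π * I * ((Int.fract (μ.arg / (2 * π)) : ℝ) : ℂ) =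
      μ.arg * I - (⌊μ.arg / (2 * π)⌋ : ℂ) * (2 * π * I) := by
    rw [Int.fract]; push_cast
    have : (π : ℂ) ≠ 0 := ofReal_ne_zero.2 Real.pi_ne_zero
    field_simp
  rw [h1, Complex.exp_sub, Complex.exp_int_mul_two_pi_mul_I, div_one]
  have := norm_mul_exp_arg_mul_I μ
  rwa [hμ, ofReal_one, one_mul] at this

/-- The unit circle is infinite, so that it contains a point outside the spectrum. It serves as the base
point of a Cayley transform. -/
theorem exists_norm_one_det_ne_zero (A : Matrix (Fin m) (Fin m) ℂ) :
    ∃ ζ : ℂ, ‖ζ‖ = 1 ∧ (ζ • (1 : Matrix (Fin m) (Fin m) ℂ) - A).det ≠ 0 := by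
  have h1 : (Metric.sphere (0 : ℂ) 1).Infinite := by
    refine Set.infinite_of_injective_forall_mem (f := fun n : ℕ => cexp (n * I)) ?_ fun n => ?_
    · intro a b hab
      obtain ⟨k, hk⟩ := exp_eq_exp_iff_exists_int.1 hab
      have h2 : (a : ℂ) = b + k * (2 * π) := by
        have := I_ne_zero
        refine mul_right_cancel₀ this ?_
        rw [hk]; ring
      have h3 : (a : ℝ) = b + k * (2 * π) := by exact_mod_cast h2
      rcases eq_or_ne k 0 with rfl | hk0
      · exact_mod_cast (by simpa using h3 : (a : ℝ) = b)
      · exfalso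
        refine irrational_pi ⟨((a : ℚ) - b) / (2 * k), ?_⟩
        have : (k : ℝ) ≠ 0 := by exact_mod_cast hk0
        push_cast; field_simp; linarith
    · rw [mem_sphere_zero_iff_norm]
      have := norm_exp_ofReal_mul_I (n : ℝ)
      push_cast at this; exact this
  obtain ⟨ζ, hζ, hζ'⟩ := h1.exists_notMem_finset A.charpoly.roots.toFinset
  refine ⟨ζ, by simpa using hζ, fun h0 => hζ' ?_⟩
  rw [Multiset.mem_toFinset, Polynomial.mem_roots A.charpoly_monic.ne_zero, Polynomial.IsRoot,
    Matrix.eval_charpoly, ← h0, Matrix.scalar_apply, ← Matrix.smul_one_eq_diagonal]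

/-- The spectral theorem for unitary matrices, through the Cayley transform
`i (ζ + A) (ζ - A)⁻¹`, which is Hermitian. -/
theorem exists_unitary_diagonalization {A : Matrix (Fin m) (Fin m) ℂ} (hA : Aᴴ * A = 1) :
    ∃ (ω : Fin m → ℝ) (W : Matrix (Fin m) (Fin m) ℂ), (∀ q, ω q ∈ Ico (0 : ℝ) 1) ∧
      W ∈ Matrix.unitaryGroup (Fin m) ℂ ∧
      A = Wᴴ * Matrix.diagonal (fun q => cexp (2 * π * I * ω q)) * W := by
  obtain ⟨ζ, hζ, hdet⟩ := exists_norm_one_det_ne_zero A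
  have hA' : A * Aᴴ = 1 := mul_eq_one_comm.1 hA
  have hζζ : ζ * star ζ = 1 := by
    rw [RCLike.star_def, mul_conj, normSq_eq_norm_sq, hζ]; simp
  have hζζ' : star ζ * ζ = 1 := by rw [mul_comm, hζζ]
  set K := ζ • (1 : Matrix (Fin m) (Fin m) ℂ) - A with hK
  have hKu : IsUnit K.det := isUnit_iff_ne_zero.2 hdet
  have hKK : K * K⁻¹ = 1 := Matrix.mul_nonsing_inv K hKu
  have hKK' : K⁻¹ * K = 1 := Matrix.nonsing_inv_mul K hKu
  set H := I • ((ζ • (1 : Matrix (Fin m) (Fin m) ℂ) + A) * K⁻¹) with hH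
  have hHK : H * K = I • (ζ • (1 : Matrix (Fin m) (Fin m) ℂ) + A) := by
    rw [hH, Matrix.smul_mul, Matrix.mul_assoc, hKK', Matrix.mul_one]
  have hHerm : H.IsHermitian := by
    have e1 : Kᴴ * (H * K) = Kᴴ * (Hᴴ * K) := by
      have e2 : Kᴴ * Hᴴ = (-I) • (star ζ • (1 : Matrix (Fin m) (Fin m) ℂ) + Aᴴ) := by
        rw [← Matrix.conjTranspose_mul, hHK]; simp [Matrix.conjTranspose_smul]
      rw [← Matrix.mul_assoc Kᴴ Hᴴ, e2, hHK, hK]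
      simp only [Matrix.conjTranspose_sub, Matrix.conjTranspose_smul, Matrix.conjTranspose_one,
        Matrix.mul_smul, Matrix.smul_mul, Matrix.mul_add, Matrix.add_mul, Matrix.mul_sub,
        Matrix.sub_mul, Matrix.one_mul, Matrix.mul_one, hA, smul_sub, smul_add, smul_smul,
        neg_smul, Matrix.neg_mul]
      rw [← sub_eq_zero]
      have e3 : (I * (star ζ * ζ) - I) • (1 : Matrix (Fin m) (Fin m) ℂ) = 0 := by
        rw [hζζ', mul_one, sub_self, zero_smul]
      rw [← smul_zero (2 : ℂ), ← e3]
      module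
    have hKH : IsUnit Kᴴ.det := by rw [Matrix.det_conjTranspose]; exact hKu.star
    have e4 : H * K = Hᴴ * K := by
      have := congrArg (fun M => (Kᴴ)⁻¹ * M) e1
      simpa [← Matrix.mul_assoc, Matrix.nonsing_inv_mul _ hKH] using this
    have := congrArg (fun M => M * K⁻¹) e4
    rw [Matrix.IsHermitian]
    simpa [Matrix.mul_assoc, hKK] using this.symm
  obtain ⟨U, d, hU, hU', hHU⟩ := hHerm.exists_unitary_diagonal
  set D := Matrix.diagonal (fun i => (d i : ℂ)) with hD
  set B := Uᴴ * A * U with hB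
  have hAB : A = U * B * Uᴴ := by
    rw [hB]
    calc A = (U * Uᴴ) * A * (U * Uᴴ) := by rw [hU']; simp
      _ = _ := by simp only [Matrix.mul_assoc]
  -- `H (ζ - A) = i (ζ + A)` in the eigenbasis of `H`
  have hDB : D * (ζ • 1 - B) = I • (ζ • (1 : Matrix (Fin m) (Fin m) ℂ) + B) := by
    have e1 : Uᴴ * (H * K) * U = D * (ζ • 1 - B) := by
      rw [hHU, hK, hB]
      calc Uᴴ * (U * D * Uᴴ * (ζ • 1 - A)) * U = (Uᴴ * U) * D * (Uᴴ * (ζ • 1 - A) * U) := by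
            simp only [Matrix.mul_assoc]
        _ = _ := by
            rw [hU, Matrix.one_mul, Matrix.mul_sub, Matrix.sub_mul, Matrix.mul_smul, Matrix.smul_mul,
              Matrix.mul_one, hU]
    rw [← e1, hHK, Matrix.mul_smul, Matrix.smul_mul, Matrix.mul_add, Matrix.add_mul,
      Matrix.mul_smul, Matrix.smul_mul, Matrix.mul_one, hU, hB]
  have hdI : ∀ i, (d i : ℂ) + I ≠ 0 := fun i h => by
    have := congrArg Complex.im h; simp at this
  have hBd : B = Matrix.diagonal fun i => ζ * ((d i : ℂ) - I) / ((d i : ℂ) + I) := by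
    ext i j
    have := congrFun (congrFun hDB i) j
    rw [hD, Matrix.diagonal_mul] at this
    simp only [Matrix.sub_apply, Matrix.smul_apply, Matrix.add_apply, smul_eq_mul] at this
    rw [Matrix.diagonal_apply]
    split_ifs with hij
    · subst hij
      rw [Matrix.one_apply_eq] at this
      rw [eq_div_iff (hdI i)]
      linear_combination -this
    · rw [Matrix.one_apply_ne hij] at this
      have h2 : ((d i : ℂ) + I) * B i j = 0 := by linear_combination -this
      exact (mul_eq_zero.1 h2).resolve_left (hdI i)
  have hnorm : ∀ i, ‖ζ * ((d i : ℂ) - I) / ((d i : ℂ) + I)‖ = 1 := fun i => by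
    have h1 : ‖(d i : ℂ) - I‖ = ‖(d i : ℂ) + I‖ := by
      rw [← norm_conj ((d i : ℂ) - I)]; simp
    rw [norm_div, norm_mul, hζ, one_mul, h1, div_self (norm_ne_zero_iff.2 (hdI i))]
  choose ω hω hωe using fun i => exists_mem_Ico_exp_eq (hnorm i)
  refine ⟨ω, Uᴴ, hω, ?_, ?_⟩
  · rw [Matrix.mem_unitaryGroup_iff, star_eq_conjTranspose, Matrix.conjTranspose_conjTranspose, hU]
  · rw [Matrix.conjTranspose_conjTranspose, hAB, hBd]
    simp only [hωe]

end LinearAlgebra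

section RankOfResidue

variable {m : ℕ}

theorem tendsto_matrix_mul_apply {l : Filter ℂ} {Δ D : ℂ → Matrix (Fin m) (Fin m) ℂ}
    {Δ₀ D₀ : Matrix (Fin m) (Fin m) ℂ} (hΔ : ∀ j k, Tendsto (fun w => Δ w j k) l (𝓝 (Δ₀ j k)))
    (hD : ∀ j k, Tendsto (fun w => D w j k) l (𝓝 (D₀ j k))) (j k : Fin m) :
    Tendsto (fun w => (Δ w * D w) j k) l (𝓝 ((Δ₀ * D₀) j k)) := by
  simp only [Matrix.mul_apply]
  exact tendsto_finsetSum _ fun i _ => (hΔ j i).mul (hD i k)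

/-- If `Δ` is an entire matrix function whose inverse has at most a simple pole at `z`, then the
order of the zero of `det Δ` is the rank of the residue of `Δ⁻¹`. Indeed, after a change of basis
`Δ` becomes regular once the columns that vanish at `z` are divided by `w - z`. -/
theorem analyticOrderNatAt_det_eq_rank {Δ D : ℂ → Matrix (Fin m) (Fin m) ℂ} {z : ℂ}
    (hΔ : ∀ j k, Differentiable ℂ fun w => Δ w j k)
    (hD : ∀ j k, DifferentiableAt ℂ (fun w => D w j k) z)
    (h : ∀ᶠ w in 𝓝[≠] z, Δ w * D w = (w - z) • (1 : Matrix (Fin m) (Fin m) ℂ)) :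
    analyticOrderNatAt (fun w => (Δ w).det) z = (D z).rank := by
  classical
  have hzero : Δ z * D z = 0 := by
    ext j k
    refine tendsto_nhds_unique (tendsto_matrix_mul_apply (l := 𝓝[≠] z) (Δ := Δ) (D := D)
      (fun j k => (hΔ j k z).continuousAt.continuousWithinAt)
      (fun j k => (hD j k).continuousAt.continuousWithinAt) j k) ?_
    have h1 : Tendsto (fun w => ((w - z) • (1 : Matrix (Fin m) (Fin m) ℂ)) j k) (𝓝[≠] z)
        (𝓝 ((0 : Matrix (Fin m) (Fin m) ℂ) j k)) := by
      have : Continuous fun w : ℂ => ((w - z) • (1 : Matrix (Fin m) (Fin m) ℂ)) j k := by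
        simp only [Matrix.smul_apply]; fun_prop
      have h2 := (this.tendsto z).mono_left (nhdsWithin_le_nhds (s := {z}ᶜ))
      simpa using h2
    refine h1.congr' ?_
    filter_upwards [h] with w hw
    rw [hw]
  -- in an orthonormal eigenbasis of `Δ(z)ᴴ Δ(z)` the kernel of `Δ(z)` is spanned by basis vectors
  obtain ⟨U, μ, hU, hU', hμ⟩ :=
    (Matrix.isHermitian_conjTranspose_mul_self (Δ z)).exists_unitary_diagonal
  set V : ℂ → Matrix (Fin m) (Fin m) ℂ := fun w => Δ w * U with hV
  set T : ℂ → Matrix (Fin m) (Fin m) ℂ := fun w => Uᴴ * D w with hT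
  have hVd : ∀ j k, Differentiable ℂ fun w => V w j k := fun j k => by
    simp only [hV, Matrix.mul_apply]
    exact Differentiable.fun_sum fun i _ => (hΔ j i).mul_const _
  have hTd : ∀ j k, DifferentiableAt ℂ (fun w => T w j k) z := fun j k => by
    simp only [hT, Matrix.mul_apply]
    exact DifferentiableAt.fun_sum fun i _ => (hD i k).const_mul _
  have hVV : (V z)ᴴ * V z = Matrix.diagonal fun i => (μ i : ℂ) := by
    rw [hV]
    simp only [Matrix.conjTranspose_mul]
    calc Uᴴ * (Δ z)ᴴ * (Δ z * U) = Uᴴ * ((Δ z)ᴴ * Δ z) * U := by simp only [Matrix.mul_assoc]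
      _ = (Uᴴ * U) * Matrix.diagonal (fun i => (μ i : ℂ)) * (Uᴴ * U) := by
          rw [hμ]; simp only [Matrix.mul_assoc]
      _ = _ := by rw [hU, Matrix.one_mul, Matrix.mul_one]
  have hV0 : ∀ j k, μ k = 0 → V z j k = 0 := by
    intro j k hk
    have h1 := congrFun (congrFun hVV k) k
    rw [Matrix.diagonal_apply_eq, hk, Matrix.mul_apply] at h1
    simp only [Matrix.conjTranspose_apply, RCLike.star_def, ← Complex.normSq_eq_conj_mul_self] at h1
    rw [← Complex.ofReal_sum, Complex.ofReal_inj, Finset.sum_eq_zero_iff_of_nonneg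
      (fun i _ => Complex.normSq_nonneg _)] at h1
    exact Complex.normSq_eq_zero.1 (h1 j (Finset.mem_univ j))
  have hT0 : ∀ i k, μ i ≠ 0 → T z i k = 0 := by
    intro i k hi
    have h1 : Matrix.diagonal (fun i => (μ i : ℂ)) * T z = 0 := by
      rw [← hVV]
      calc (V z)ᴴ * V z * T z = (V z)ᴴ * (Δ z * (U * Uᴴ) * D z) := by
            simp only [hV, hT, Matrix.mul_assoc]
        _ = 0 := by rw [hU', Matrix.mul_one, hzero, Matrix.mul_zero]
    have h2 := congrFun (congrFun h1 i) k
    rw [Matrix.diagonal_mul, Matrix.zero_apply] at h2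
    exact (mul_eq_zero.1 h2).resolve_left (by exact_mod_cast hi)
  -- divide the columns of `V` vanishing at `z`, and the rows of `T` vanishing at `z`, by `w - z`:
  -- the quotients are inverse to each other
  set E : ℂ → Matrix (Fin m) (Fin m) ℂ := fun w => Matrix.of fun j k =>
    if μ k = 0 then dslope (fun w => V w j k) z w else V w j k with hE
  set G : ℂ → Matrix (Fin m) (Fin m) ℂ := fun w => Matrix.of fun i k =>
    if μ i = 0 then T w i k else dslope (fun w => T w i k) z w with hG
  have hEd : ∀ j k, Differentiable ℂ fun w => E w j k := fun j k => by
    by_cases hk : μ k = 0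
    · simpa [hE, hk] using (hVd j k).dslope_complex z
    · simpa [hE, hk] using hVd j k
  have hGc : ∀ j k, ContinuousAt (fun w => G w j k) z := fun j k => by
    by_cases hk : μ j = 0
    · simpa [hG, hk] using (hTd j k).continuousAt
    · simpa [hG, hk] using continuousAt_dslope_same.2 (hTd j k)
  have hEG : ∀ w, (w - z) • (E w * G w) = Δ w * D w := by
    intro w
    have h1 : Δ w * D w = V w * T w := by
      simp only [hV, hT]
      rw [← Matrix.mul_assoc, Matrix.mul_assoc (Δ w), hU', Matrix.mul_one]
    rw [h1]
    ext j k
    rw [Matrix.smul_apply, Matrix.mul_apply, Matrix.mul_apply, Finset.smul_sum]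
    refine Finset.sum_congr rfl fun i _ => ?_
    by_cases hi : μ i = 0
    · have h2 := sub_smul_dslope (fun w => V w j i) z w
      simp only [hV0 j i hi, sub_zero, smul_eq_mul] at h2
      simp only [hE, hG, Matrix.of_apply, hi, if_true, smul_eq_mul]
      rw [← h2]; ring
    · have h2 := sub_smul_dslope (fun w => T w i k) z w
      simp only [hT0 i k hi, sub_zero, smul_eq_mul] at h2
      simp only [hE, hG, Matrix.of_apply, hi, if_false, smul_eq_mul]
      rw [← h2]; ring
  have hEG1 : E z * G z = 1 := by
    ext j k
    refine tendsto_nhds_unique (tendsto_matrix_mul_apply (l := 𝓝[≠] z) (Δ := E) (D := G)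
      (fun j k => (hEd j k z).continuousAt.continuousWithinAt)
      (fun j k => (hGc j k).continuousWithinAt) j k) (tendsto_const_nhds.congr' ?_)
    filter_upwards [h, self_mem_nhdsWithin] with w hw hwz
    have h1 := hEG w
    rw [hw] at h1
    rw [smul_right_injective _ (sub_ne_zero.2 (hwz : w ≠ z)) h1]
  have hdE : (E z).det ≠ 0 := fun h0 => by
    have := congrArg Matrix.det hEG1
    rw [Matrix.det_mul, h0, zero_mul, Matrix.det_one] at this
    exact zero_ne_one this
  have hdG : (G z).det ≠ 0 := fun h0 => by
    have := congrArg Matrix.det hEG1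
    rw [Matrix.det_mul, h0, mul_zero, Matrix.det_one] at this
    exact zero_ne_one this
  have hdU : (Uᴴ).det * U.det = 1 := by rw [← Matrix.det_mul, hU, Matrix.det_one]
  set n := (Finset.univ.filter fun i => μ i = 0).card with hn
  have hdet : ∀ w, (Δ w).det = (w - z) ^ n • ((E w).det * (Uᴴ).det) := by
    intro w
    have h1 : Δ w = V w * Uᴴ := by
      simp only [hV]; rw [Matrix.mul_assoc, hU', Matrix.mul_one]
    have h2 : V w = E w * Matrix.diagonal fun k => if μ k = 0 then w - z else 1 := by
      ext j k
      rw [Matrix.mul_diagonal]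
      by_cases hk : μ k = 0
      · have h2 := sub_smul_dslope (fun w => V w j k) z w
        simp only [hV0 j k hk, sub_zero, smul_eq_mul] at h2
        simp only [hE, Matrix.of_apply, hk, if_true]
        rw [← h2]; ring
      · simp [hE, hk]
    rw [h1, Matrix.det_mul, h2, Matrix.det_mul, Matrix.det_diagonal, Finset.prod_ite,
      Finset.prod_const, Finset.prod_const_one, smul_eq_mul]
    ring
  have hdetd : ∀ B : ℂ → Matrix (Fin m) (Fin m) ℂ, (∀ j k, Differentiable ℂ fun w => B w j k) →
      Differentiable ℂ fun w => (B w).det := fun B hB => by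
    simp only [Matrix.det_apply']
    exact Differentiable.fun_sum fun σ _ => (Differentiable.fun_finsetProd fun i _ => hB _ _).const_mul _
  have hord : analyticOrderAt (fun w => (Δ w).det) z = n := by
    rw [((hdetd Δ hΔ).analyticAt z).analyticOrderAt_eq_natCast]
    refine ⟨fun w => (E w).det * (Uᴴ).det, ((hdetd E hEd).mul_const _).analyticAt z,
      mul_ne_zero hdE (left_ne_zero_of_mul_eq_one hdU), Eventually.of_forall hdet⟩
  have hrank : (D z).rank = n := by
    have h1 : D z = U * T z := by
      simp only [hT]; rw [← Matrix.mul_assoc, hU', Matrix.one_mul]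
    have h2 : T z = Matrix.diagonal (fun i => if μ i = 0 then (1 : ℂ) else 0) * G z := by
      ext i k
      rw [Matrix.diagonal_mul]
      by_cases hi : μ i = 0
      · simp [hG, hi]
      · simp [hi, hT0 i k hi]
    rw [h1, Matrix.rank_mul_eq_right_of_isUnit_det _ _ (isUnit_iff_ne_zero.2 (right_ne_zero_of_mul_eq_one hdU)), h2,
      Matrix.rank_mul_eq_left_of_isUnit_det _ _ (isUnit_iff_ne_zero.2 hdG), Matrix.rank_diagonal, hn, Fintype.card_subtype]
    congr 1; ext i; simp
  rw [analyticOrderNatAt, hord, hrank, ENat.toNat_natCast]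

end RankOfResidue

/-! ### The monodromy matrix and the comparison of characteristic functions -/

section Cayley

variable {n : Type*} [Fintype n] [DecidableEq n] {H : Matrix n n ℂ}

theorem inv_one_add_mul_one_sub_mem_unitaryGroup (hH : Hᴴ = -H) (h1 : (1 + H).det ≠ 0)
    (h2 : (1 - H).det ≠ 0) : (1 + H)⁻¹ * (1 - H) ∈ Matrix.unitaryGroup n ℂ := by
  have e1 : (1 + H) * (1 + H)⁻¹ = 1 := Matrix.mul_nonsing_inv _ (isUnit_iff_ne_zero.2 h1)
  have e2 : (1 - H)⁻¹ * (1 - H) = 1 := Matrix.nonsing_inv_mul _ (isUnit_iff_ne_zero.2 h2)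
  have hc : (1 + H) * (1 - H) = (1 - H) * (1 + H) := by noncomm_ring
  rw [Matrix.mem_unitaryGroup_iff', star_eq_conjTranspose, Matrix.conjTranspose_mul,
    Matrix.conjTranspose_nonsing_inv, Matrix.conjTranspose_sub, Matrix.conjTranspose_add,
    Matrix.conjTranspose_one, hH, sub_neg_eq_add, ← sub_eq_add_neg]
  calc (1 + H) * (1 - H)⁻¹ * ((1 + H)⁻¹ * (1 - H))
      = (1 + H) * ((1 - H)⁻¹ * (1 + H)⁻¹) * (1 - H) := by simp only [Matrix.mul_assoc]
    _ = (1 + H) * ((1 + H)⁻¹ * (1 - H)⁻¹) * (1 - H) := by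
        rw [← Matrix.mul_inv_rev, hc, Matrix.mul_inv_rev]
    _ = ((1 + H) * (1 + H)⁻¹) * ((1 - H)⁻¹ * (1 - H)) := by simp only [Matrix.mul_assoc]
    _ = 1 := by rw [e1, e2, Matrix.one_mul]

theorem one_add_mul_inv_one_sub_mem_unitaryGroup (hH : Hᴴ = -H) (h1 : (1 + H).det ≠ 0)
    (h2 : (1 - H).det ≠ 0) : (1 + H) * (1 - H)⁻¹ ∈ Matrix.unitaryGroup n ℂ := by
  have e1 : (1 + H)⁻¹ * (1 + H) = 1 := Matrix.nonsing_inv_mul _ (isUnit_iff_ne_zero.2 h1)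
  have e2 : (1 - H) * (1 - H)⁻¹ = 1 := Matrix.mul_nonsing_inv _ (isUnit_iff_ne_zero.2 h2)
  have hc : (1 - H) * (1 + H) = (1 + H) * (1 - H) := by noncomm_ring
  rw [Matrix.mem_unitaryGroup_iff', star_eq_conjTranspose, Matrix.conjTranspose_mul,
    Matrix.conjTranspose_nonsing_inv, Matrix.conjTranspose_sub, Matrix.conjTranspose_add,
    Matrix.conjTranspose_one, hH, sub_neg_eq_add, ← sub_eq_add_neg]
  calc (1 + H)⁻¹ * (1 - H) * ((1 + H) * (1 - H)⁻¹)
      = (1 + H)⁻¹ * ((1 - H) * (1 + H)) * (1 - H)⁻¹ := by simp only [Matrix.mul_assoc]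
    _ = ((1 + H)⁻¹ * (1 + H)) * ((1 - H) * (1 - H)⁻¹) := by
        rw [hc]; simp only [Matrix.mul_assoc]
    _ = 1 := by rw [e1, e2, Matrix.one_mul]

end Cayley

/-- The resolvent `(z - A)⁻¹` of `A = W^† diag(e^{2πiω}) W`. -/
def unitaryResolvent {m : ℕ} (ω : Fin m → ℝ) (W : Matrix (Fin m) (Fin m) ℂ) (z : ℂ) :
    Matrix (Fin m) (Fin m) ℂ :=
  Wᴴ * Matrix.diagonal (fun q => (z - Complex.exp (2 * π * Complex.I * ω q))⁻¹) * W

section Resolvent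

variable {m : ℕ} {ω : Fin m → ℝ} {W A : Matrix (Fin m) (Fin m) ℂ}

theorem sub_mul_unitaryResolvent (hW : W ∈ Matrix.unitaryGroup (Fin m) ℂ)
    (hA : A = Wᴴ * Matrix.diagonal (fun q => Complex.exp (2 * π * Complex.I * ω q)) * W) {z : ℂ}
    (hz : ∀ q, z ≠ Complex.exp (2 * π * Complex.I * ω q)) :
    (z • 1 - A) * unitaryResolvent ω W z = 1 := by
  have hW1 : Wᴴ * W = 1 := Matrix.mem_unitaryGroup_iff'.1 hW
  have hW2 : W * Wᴴ = 1 := Matrix.mem_unitaryGroup_iff.1 hW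
  set Λ := Matrix.diagonal (fun q => Complex.exp (2 * π * Complex.I * ω q)) with hΛ
  set G := Matrix.diagonal (fun q => (z - Complex.exp (2 * π * Complex.I * ω q))⁻¹) with hG
  have h1 : z • 1 - A = Wᴴ * (z • 1 - Λ) * W := by
    rw [hA, Matrix.mul_sub, Matrix.sub_mul, Matrix.mul_smul, Matrix.mul_one, Matrix.smul_mul, hW1]
  have h2 : (z • 1 - Λ) * G = 1 := by
    rw [hΛ, hG, Matrix.smul_one_eq_diagonal, Matrix.diagonal_sub, Matrix.diagonal_mul_diagonal,
      ← Matrix.diagonal_one]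
    congr 1; funext q
    exact mul_inv_cancel₀ (sub_ne_zero.2 (hz q))
  rw [h1, unitaryResolvent, ← hG]
  calc Wᴴ * (z • 1 - Λ) * W * (Wᴴ * G * W) = Wᴴ * (z • 1 - Λ) * (W * Wᴴ) * G * W := by
        simp only [Matrix.mul_assoc]
    _ = Wᴴ * ((z • 1 - Λ) * G) * W := by rw [hW2, Matrix.mul_one]; simp only [Matrix.mul_assoc]
    _ = 1 := by rw [h2, Matrix.mul_one, hW1]

theorem norm_le_one_of_mem_unitaryGroup (hW : W ∈ Matrix.unitaryGroup (Fin m) ℂ) : ‖W‖ ≤ 1 :=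
  l2_opNorm_le_one_of_isometry (Matrix.mem_unitaryGroup_iff'.1 hW)

/-- The resolvent of a unitary matrix is bounded by the inverse distance to the spectrum. -/
theorem norm_unitaryResolvent_le (hW : W ∈ Matrix.unitaryGroup (Fin m) ℂ) {z : ℂ} {d : ℝ}
    (hd : 0 < d) (hz : ∀ q, d ≤ ‖z - Complex.exp (2 * π * Complex.I * ω q)‖) :
    ‖unitaryResolvent ω W z‖ ≤ 1 / d := by
  have h1 := norm_le_one_of_mem_unitaryGroup hW
  have h1' : ‖Wᴴ‖ ≤ 1 := by rw [Matrix.l2_opNorm_conjTranspose]; exact h1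
  have h2 : ‖Matrix.diagonal (fun q => (z - Complex.exp (2 * π * Complex.I * ω q))⁻¹)‖ ≤ 1 / d := by
    rw [Matrix.l2_opNorm_diagonal, pi_norm_le_iff_of_nonneg (by positivity)]
    intro q
    rw [norm_inv, one_div]
    gcongr
    exact hz q
  rw [unitaryResolvent]
  refine (norm_mul_le _ _).trans ((mul_le_of_le_one_right (norm_nonneg _) h1).trans ?_)
  exact (norm_mul_le _ _).trans ((mul_le_of_le_one_left (norm_nonneg _) h1').trans h2)

theorem det_smul_one_sub (hW : W ∈ Matrix.unitaryGroup (Fin m) ℂ)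
    (hA : A = Wᴴ * Matrix.diagonal (fun q => Complex.exp (2 * π * Complex.I * ω q)) * W) (z : ℂ) :
    (z • 1 - A).det = ∏ q, (z - Complex.exp (2 * π * Complex.I * ω q)) := by
  have hW1 : Wᴴ * W = 1 := Matrix.mem_unitaryGroup_iff'.1 hW
  have h1 : z • 1 - A = Wᴴ * (z • 1 -
      Matrix.diagonal (fun q => Complex.exp (2 * π * Complex.I * ω q))) * W := by
    rw [hA, Matrix.mul_sub, Matrix.sub_mul, Matrix.mul_smul, Matrix.mul_one, Matrix.smul_mul, hW1]
  have h2 : (Wᴴ).det * W.det = 1 := by rw [← Matrix.det_mul, hW1, Matrix.det_one]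
  rw [h1, Matrix.det_mul, Matrix.det_mul, mul_right_comm, h2, one_mul, Matrix.smul_one_eq_diagonal,
    Matrix.diagonal_sub, Matrix.det_diagonal]

/-- Away from the nodes, `e^{2πiρ}` keeps a distance from the eigenvalues of the monodromy matrix that
is comparable to the growth of the terms in `mainDelta`. -/
theorem le_norm_exp_sub {ρ : ℂ} {δ : ℝ} (hδ : δ ≤ 1 / 2) (h : ∀ x ∈ nodes ω, δ ≤ ‖ρ - x‖)
    (q : Fin m) : δ * Real.exp (|ρ.im| * π) * ‖Complex.exp (Complex.I * ρ * π)‖ ≤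
      ‖Complex.exp (2 * π * Complex.I * ρ) - Complex.exp (2 * π * Complex.I * ω q)‖ := by
  have h1 := mul_exp_le_norm_exp_sub_one (z := ρ - ω q) hδ (fun n => by
    have := h (n + ω q) ⟨n, q, rfl⟩
    push_cast at this
    rwa [show ρ - (ω q : ℂ) - n = ρ - (n + ω q) by ring])
  have h2 : ‖Complex.exp (Complex.I * π * (ρ - ω q))‖ = ‖Complex.exp (Complex.I * ρ * π)‖ := by
    rw [Complex.norm_exp, Complex.norm_exp]
    congr 1; simp; ring
  have h3 : Complex.exp (2 * π * Complex.I * ρ) - Complex.exp (2 * π * Complex.I * ω q) =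
      Complex.exp (2 * π * Complex.I * ω q) * (Complex.exp (2 * π * Complex.I * (ρ - ω q)) - 1) := by
    rw [mul_sub, ← Complex.exp_add, mul_one]
    congr 2; ring
  have h4 : ‖Complex.exp (2 * π * Complex.I * ω q)‖ = 1 := by
    rw [Complex.norm_exp]; simp
  rw [h3, norm_mul, h4, one_mul]
  rw [h2] at h1
  simp only [Complex.sub_im, Complex.ofReal_im, sub_zero] at h1
  rwa [mul_comm |ρ.im|]

end Resolvent

namespace MatrixPencil

variable {m : ℕ} {L : MatrixPencil m} {ω : Fin m → ℝ} {W : Matrix (Fin m) (Fin m) ℂ}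

theorem pi_mem_Icc : π ∈ Icc 0 π := right_mem_Icc.2 Real.pi_pos.le

theorem monodromy_mem_unitaryGroup (hI : L.ConditionI) (hII : L.ConditionII) :
    L.monodromy ∈ Matrix.unitaryGroup (Fin m) ℂ := by
  obtain ⟨i1, i2, i3, i4⟩ := hI
  have h1 := inv_one_add_mul_one_sub_mem_unitaryGroup hII.2.2.1 i3 i4
  have h2 := one_add_mul_inv_one_sub_mem_unitaryGroup hII.2.1 i1 i2
  have h3 : L.Pp π ∈ Matrix.unitaryGroup (Fin m) ℂ :=
    Matrix.mem_unitaryGroup_iff'.2 (hII.Pp_unitary pi_mem_Icc)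
  have h4 : L.Pm π ∈ Matrix.unitaryGroup (Fin m) ℂ :=
    Matrix.mem_unitaryGroup_iff'.2 (hII.Pm_unitary pi_mem_Icc)
  have h5 : (L.Pm π)⁻¹ ∈ Matrix.unitaryGroup (Fin m) ℂ := by
    rw [Matrix.inv_eq_left_inv (hII.Pm_unitary pi_mem_Icc)]
    exact Unitary.star_mem h4
  have h6 : L.monodromy = (L.Pm π)⁻¹ * ((1 + L.H₁)⁻¹ * (1 - L.H₁)) * L.Pp π *
      ((1 + L.h₁) * (1 - L.h₁)⁻¹) := by
    simp only [monodromy, Pm, Pp, Matrix.mul_assoc]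
  rw [h6]
  exact mul_mem (mul_mem (mul_mem h5 h1) h3) h2

/-- The left factor `(1 + H₁) P₋(π)` of the leading part of the characteristic matrix. -/
def leftFactor (L : MatrixPencil m) : Matrix (Fin m) (Fin m) ℂ := (1 + L.H₁) * L.Pm π

theorem det_leftFactor_ne_zero (hI : L.ConditionI) (hII : L.ConditionII) : L.leftFactor.det ≠ 0 := by
  rw [leftFactor, Matrix.det_mul]
  refine mul_ne_zero hI.2.2.1 ?_
  have := congrArg Matrix.det (hII.Pm_unitary pi_mem_Icc)
  rw [Matrix.det_mul, Matrix.det_one] at this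
  exact right_ne_zero_of_mul_eq_one this

/-- The definition of the monodromy matrix: inserted into the coefficient of `e^{iρπ}` in `mainDelta`, it
produces, up to the sign, the coefficient of `e^{-iρπ}`. -/
theorem leftFactor_mul_monodromy (hI : L.ConditionI) (hII : L.ConditionII) :
    L.leftFactor * L.monodromy * (1 - L.h₁) = (1 - L.H₁) * (L.Pp π * (1 + L.h₁)) := by
  obtain ⟨i1, i2, i3, i4⟩ := hI
  have e1 : L.Pm π * (L.Pm π)⁻¹ = 1 := by
    rw [Matrix.inv_eq_left_inv (hII.Pm_unitary pi_mem_Icc)]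
    exact mul_eq_one_comm.1 (hII.Pm_unitary pi_mem_Icc)
  have e2 : (1 + L.H₁) * (1 + L.H₁)⁻¹ = 1 := Matrix.mul_nonsing_inv _ (isUnit_iff_ne_zero.2 i3)
  have e3 : (1 - L.h₁)⁻¹ * (1 - L.h₁) = 1 := Matrix.nonsing_inv_mul _ (isUnit_iff_ne_zero.2 i2)
  have h6 : L.monodromy = (L.Pm π)⁻¹ * ((1 + L.H₁)⁻¹ * (1 - L.H₁)) * L.Pp π *
      ((1 + L.h₁) * (1 - L.h₁)⁻¹) := by
    simp only [monodromy, Pm, Pp, Matrix.mul_assoc]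
  rw [h6, leftFactor]
  calc (1 + L.H₁) * L.Pm π * ((L.Pm π)⁻¹ * ((1 + L.H₁)⁻¹ * (1 - L.H₁)) * L.Pp π *
        ((1 + L.h₁) * (1 - L.h₁)⁻¹)) * (1 - L.h₁)
      = (1 + L.H₁) * (L.Pm π * (L.Pm π)⁻¹) * (1 + L.H₁)⁻¹ * (1 - L.H₁) * (L.Pp π *
        (1 + L.h₁)) * ((1 - L.h₁)⁻¹ * (1 - L.h₁)) := by simp only [Matrix.mul_assoc]
    _ = _ := by rw [e1, e3, Matrix.mul_one, Matrix.mul_one, e2, Matrix.one_mul]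

theorem exp_two_pi_eq (ρ : ℂ) : Complex.exp (-(Complex.I * ρ * π)) *
    Complex.exp (2 * π * Complex.I * ρ) = Complex.exp (Complex.I * ρ * π) := by
  rw [← Complex.exp_add]; congr 1; ring

/-- The leading part of the characteristic matrix vanishes exactly where `e^{2πiρ}` is an eigenvalue
of the monodromy matrix. -/
theorem mainDelta_eq_mul_sub_monodromy (hI : L.ConditionI) (hII : L.ConditionII) (ρ : ℂ) :
    L.mainDelta ρ = Complex.exp (-(Complex.I * ρ * π)) • (L.leftFactor *
      (Complex.exp (2 * π * Complex.I * ρ) • 1 - L.monodromy) * (1 - L.h₁)) := by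
  rw [Matrix.mul_sub L.leftFactor, Matrix.sub_mul, leftFactor_mul_monodromy hI hII,
    Matrix.mul_smul, Matrix.mul_one, Matrix.smul_mul, smul_sub, smul_smul, exp_two_pi_eq, mainDelta, leftFactor,
    Matrix.mul_assoc]

/-- The inverse of `mainDelta`. -/
def mainInv (L : MatrixPencil m) (ω : Fin m → ℝ) (W : Matrix (Fin m) (Fin m) ℂ) (ρ : ℂ) :
    Matrix (Fin m) (Fin m) ℂ :=
  Complex.exp (Complex.I * ρ * π) • ((1 - L.h₁)⁻¹ *
    unitaryResolvent ω W (Complex.exp (2 * π * Complex.I * ρ)) * L.leftFactor⁻¹)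

theorem mainDelta_mul_mainInv (hI : L.ConditionI) (hII : L.ConditionII)
    (hW : W ∈ Matrix.unitaryGroup (Fin m) ℂ)
    (hA : L.monodromy = Wᴴ * Matrix.diagonal (fun q => Complex.exp (2 * π * Complex.I * ω q)) * W)
    {ρ : ℂ} (hρ : ∀ q, Complex.exp (2 * π * Complex.I * ρ) ≠ Complex.exp (2 * π * Complex.I * ω q)) :
    L.mainDelta ρ * L.mainInv ω W ρ = 1 := by
  have e1 : L.leftFactor * L.leftFactor⁻¹ = 1 :=
    Matrix.mul_nonsing_inv _ (isUnit_iff_ne_zero.2 (det_leftFactor_ne_zero hI hII))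
  have e3 : (1 - L.h₁) * (1 - L.h₁)⁻¹ = 1 :=
    Matrix.mul_nonsing_inv _ (isUnit_iff_ne_zero.2 hI.2.1)
  have e2 := sub_mul_unitaryResolvent hW hA hρ
  rw [mainDelta_eq_mul_sub_monodromy hI hII, mainInv, Matrix.smul_mul, Matrix.mul_smul, smul_smul,
    ← Complex.exp_add, neg_add_cancel, Complex.exp_zero, one_smul]
  set K := Complex.exp (2 * π * Complex.I * ρ) • (1 : Matrix (Fin m) (Fin m) ℂ) - L.monodromy
  set G := unitaryResolvent ω W (Complex.exp (2 * π * Complex.I * ρ))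
  calc L.leftFactor * K * (1 - L.h₁) * ((1 - L.h₁)⁻¹ * G * L.leftFactor⁻¹)
      = L.leftFactor * K * ((1 - L.h₁) * (1 - L.h₁)⁻¹) * G * L.leftFactor⁻¹ := by
        simp only [Matrix.mul_assoc]
    _ = L.leftFactor * (K * G) * L.leftFactor⁻¹ := by
        rw [e3, Matrix.mul_one]; simp only [Matrix.mul_assoc]
    _ = 1 := by rw [e2, Matrix.mul_one, e1]

/-- Away from the nodes, the relative error `Q` of the leading part of the characteristic matrix is
small: the bound for the inverse of the leading part compensates the exponential growth. -/
theorem exists_charMatrix_factor (hI : L.ConditionI) (hII : L.ConditionII)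
    (hW : W ∈ Matrix.unitaryGroup (Fin m) ℂ)
    (hA : L.monodromy = Wᴴ * Matrix.diagonal (fun q => Complex.exp (2 * π * Complex.I * ω q)) * W) :
    ∃ C R : ℝ, 0 < C ∧ 1 ≤ R ∧ ∀ (ρ : ℂ) (δ : ℝ), R ≤ ‖ρ‖ → 0 < δ → δ ≤ 1 / 2 →
      (∀ x ∈ nodes ω, δ ≤ ‖ρ - x‖) →
      (∀ q, Complex.exp (2 * π * Complex.I * ρ) ≠ Complex.exp (2 * π * Complex.I * ω q)) ∧
      ‖L.mainInv ω W ρ‖ ≤ C / (δ * Real.exp (|ρ.im| * π)) ∧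
      ∃ Q : Matrix (Fin m) (Fin m) ℂ, ‖Q‖ ≤ C / (δ * ‖ρ‖) ∧
        L.charMatrix ρ = (Complex.I * ρ / 2) • (L.mainDelta ρ * (1 - Q)) := by
  obtain ⟨C, R, hC, hR, hasy⟩ := exists_char_asymptotics (L := L) hII
  obtain ⟨a, ha⟩ : ∃ a, a = ‖(1 - L.h₁)⁻¹‖ := ⟨_, rfl⟩
  obtain ⟨b, hb⟩ : ∃ b, b = ‖L.leftFactor⁻¹‖ := ⟨_, rfl⟩
  have ha0 : 0 ≤ a := by rw [ha]; exact norm_nonneg _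
  have hb0 : 0 ≤ b := by rw [hb]; exact norm_nonneg _
  have hab : 0 ≤ a * b := by positivity
  refine ⟨(a * b + 1) * (2 * C + 1), R, by positivity, hR, fun ρ δ hρ hδ hδ2 hnode => ?_⟩
  have hρ0 : 0 < ‖ρ‖ := one_pos.trans_le (hR.trans hρ)
  set E := Real.exp (|ρ.im| * π) with hE
  have hE0 : 0 < E := Real.exp_pos _
  set e := Complex.exp (Complex.I * ρ * π) with he
  have he0 : 0 < ‖e‖ := norm_pos_iff.2 (Complex.exp_ne_zero _)
  have hlow := le_norm_exp_sub hδ2 hnode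
  have hne : ∀ q, Complex.exp (2 * π * Complex.I * ρ) ≠ Complex.exp (2 * π * Complex.I * ω q) := by
    intro q h
    have := hlow q
    rw [h, sub_self, norm_zero] at this
    exact absurd this (not_le.2 (by positivity))
  have h1 : ‖L.mainInv ω W ρ‖ ≤ a * b / (δ * E) := by
    have h2 := norm_unitaryResolvent_le (ω := ω) hW (by positivity : 0 < δ * E * ‖e‖) hlow
    rw [mainInv, norm_smul]
    calc ‖e‖ * ‖(1 - L.h₁)⁻¹ * unitaryResolvent ω W (Complex.exp (2 * π * Complex.I * ρ)) *
          L.leftFactor⁻¹‖ ≤ ‖e‖ * (a * (1 / (δ * E * ‖e‖)) * b) := by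
          refine mul_le_mul_of_nonneg_left ?_ he0.le
          refine (norm_mul_le _ _).trans (mul_le_mul ?_ hb.ge (norm_nonneg _) (by positivity))
          exact (norm_mul_le _ _).trans (mul_le_mul ha.ge h2 (norm_nonneg _) ha0)
      _ = _ := by field_simp
  have h3 := mainDelta_mul_mainInv hI hII hW hA hne
  refine ⟨hne, h1.trans (div_le_div_of_nonneg_right (by nlinarith) (by positivity)), -((2 / (Complex.I * ρ)) • (L.mainInv ω W ρ *
    (L.charMatrix ρ - (Complex.I * ρ / 2) • L.mainDelta ρ))), ?_, ?_⟩
  · rw [norm_neg, norm_smul, norm_div, norm_mul, Complex.norm_I, one_mul, Complex.norm_ofNat]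
    calc 2 / ‖ρ‖ * ‖L.mainInv ω W ρ * (L.charMatrix ρ - (Complex.I * ρ / 2) • L.mainDelta ρ)‖
        ≤ 2 / ‖ρ‖ * (a * b / (δ * E) * (C * E)) := by
          gcongr
          exact (norm_mul_le _ _).trans (mul_le_mul h1 (hasy ρ hρ).1 (norm_nonneg _) (by positivity))
      _ = a * b * (2 * C) / (δ * ‖ρ‖) := by field_simp
      _ ≤ _ := div_le_div_of_nonneg_right (by nlinarith) (by positivity)
  · have hρne : Complex.I * ρ ≠ 0 := mul_ne_zero Complex.I_ne_zero (norm_pos_iff.1 hρ0)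
    rw [sub_neg_eq_add, Matrix.mul_add, Matrix.mul_one, Matrix.mul_smul, ← Matrix.mul_assoc, h3,
      Matrix.one_mul, smul_add, smul_smul, div_mul_div_cancel₀ two_ne_zero, div_self hρne, one_smul]
    abel

theorem exists_norm_det_one_sub_sub_one_lt : ∃ ε : ℝ, 0 < ε ∧ ∀ Q : Matrix (Fin m) (Fin m) ℂ,
    ‖Q‖ ≤ ε → ‖(1 - Q).det - 1‖ < 1 := by
  have h1 : Continuous fun Q : Matrix (Fin m) (Fin m) ℂ => ‖(1 - Q).det - 1‖ := by
    have : Continuous fun Q : Matrix (Fin m) (Fin m) ℂ => (1 - Q).det :=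
      (continuous_const.sub continuous_id).matrix_det
    fun_prop
  have h2 := h1.tendsto 0
  simp only [sub_zero, Matrix.det_one, sub_self, norm_zero] at h2
  obtain ⟨ε, hε, h⟩ := Metric.eventually_nhds_iff.1 (h2.eventually (gt_mem_nhds one_pos))
  refine ⟨ε / 2, by positivity, fun Q hQ => h ?_⟩
  rw [dist_zero_right]; linarith

/-- The determinant of the leading part is a multiple of `comparison ω`, and the relative error `1 - Q`
has determinant close to `1`. -/
theorem isComparable_charFun (hI : L.ConditionI) (hII : L.ConditionII)
    (hW : W ∈ Matrix.unitaryGroup (Fin m) ℂ)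
    (hA : L.monodromy = Wᴴ * Matrix.diagonal (fun q => Complex.exp (2 * π * Complex.I * ω q)) * W) :
    IsComparable ω L.charFun := by
  obtain ⟨C, R, hC, hR, h⟩ := exists_charMatrix_factor hI hII hW hA
  obtain ⟨ε, hε, hdet⟩ := exists_norm_det_one_sub_sub_one_lt (m := m)
  set c : ℂ := (Complex.I / 2) ^ m * L.leftFactor.det * (1 - L.h₁).det with hc
  have hc0 : c ≠ 0 := mul_ne_zero (mul_ne_zero (pow_ne_zero _ (div_ne_zero Complex.I_ne_zero
    two_ne_zero)) (det_leftFactor_ne_zero hI hII)) hI.2.1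
  refine ⟨C / ε, R, c⁻¹, by positivity, hR, inv_ne_zero hc0, fun ρ δ hρ hδρ hδ2 hnode => ?_⟩
  have hρ0 : 0 < ‖ρ‖ := one_pos.trans_le (hR.trans hρ)
  have hδ0 : 0 < δ := by
    by_contra hcon
    have h1 : δ * ‖ρ‖ ≤ 0 := mul_nonpos_of_nonpos_of_nonneg (not_lt.1 hcon) hρ0.le
    have h2 : 0 < C / ε := by positivity
    linarith
  obtain ⟨hne, -, Q, hQ, hfac⟩ := h ρ δ hρ hδ0 hδ2 hnode
  have hQε : ‖Q‖ ≤ ε := hQ.trans (by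
    rw [div_le_iff₀ hε] at hδρ
    rw [div_le_iff₀ (by positivity)]; linarith)
  have h1 : L.charFun ρ = c * comparison ω ρ * (1 - Q).det := by
    rw [L.charFun_eq, hfac, mainDelta_eq_mul_sub_monodromy hI hII, Matrix.smul_mul, smul_smul,
      Matrix.det_smul, Matrix.det_mul, Matrix.det_mul, Matrix.det_mul, det_smul_one_sub hW hA,
      Fintype.card_fin, comparison, hc]
    rw [show Complex.I * π * ρ = Complex.I * ρ * π by ring]
    ring
  have h2 : comparison ω ρ ≠ 0 := by
    rw [comparison]
    refine mul_ne_zero (pow_ne_zero _ (norm_pos_iff.1 hρ0)) (mul_ne_zero (pow_ne_zero _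
      (Complex.exp_ne_zero _)) (Finset.prod_ne_zero_iff.2 fun q _ => sub_ne_zero.2 (hne q)))
  have h3 : c⁻¹ * L.charFun ρ - comparison ω ρ = comparison ω ρ * ((1 - Q).det - 1) := by
    rw [h1]; field_simp
  rw [h3, norm_mul]
  exact mul_lt_of_lt_one_right (norm_pos_iff.2 h2) (hdet Q hQε)

end MatrixPencil

/-! ### Lagrange's identity and the growth of the Weyl matrix near the real axis -/

section Column

variable {n p : Type*} [Fintype n] [Fintype p] [DecidableEq p]

theorem norm_apply_unit (M : Matrix Unit Unit ℂ) : ‖M () ()‖ = ‖M‖ := by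
  have : M = Matrix.diagonal fun _ => M () () := by ext; simp
  rw [this, Matrix.l2_opNorm_diagonal]
  simp

theorem conjTranspose_mul_self_apply_unit (y : Matrix n Unit ℂ) :
    (yᴴ * y) () () = ((‖y‖ ^ 2 : ℝ) : ℂ) := by
  have h1 : (yᴴ * y) () () = ((∑ i, Complex.normSq (y i ()) : ℝ) : ℂ) := by
    rw [Matrix.mul_apply]; push_cast
    refine Finset.sum_congr rfl fun i _ => ?_
    rw [Matrix.conjTranspose_apply, RCLike.star_def, Complex.normSq_eq_conj_mul_self]
  have h2 : ‖(yᴴ * y) () ()‖ = ‖y‖ ^ 2 := by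
    rw [norm_apply_unit, Matrix.l2_opNorm_conjTranspose_mul_self, sq]
  rw [h1, Complex.norm_real, Real.norm_eq_abs, abs_of_nonneg
    (Finset.sum_nonneg fun i _ => Complex.normSq_nonneg _)] at h2
  rw [h1, h2]

theorem norm_add_sq_unit (u w : Matrix n Unit ℂ) :
    ‖u + w‖ ^ 2 = ‖u‖ ^ 2 + ‖w‖ ^ 2 + 2 * ((uᴴ * w) () ()).re := by
  have h1 := conjTranspose_mul_self_apply_unit (u + w)
  rw [Matrix.conjTranspose_add, Matrix.add_mul, Matrix.mul_add, Matrix.mul_add, Matrix.add_apply,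
    Matrix.add_apply, Matrix.add_apply, conjTranspose_mul_self_apply_unit,
    conjTranspose_mul_self_apply_unit] at h1
  have h2 : (wᴴ * u) () () = star ((uᴴ * w) () ()) := by
    rw [← Matrix.conjTranspose_apply, Matrix.conjTranspose_mul, Matrix.conjTranspose_conjTranspose]
  rw [h2] at h1
  have := congrArg Complex.re h1
  simp only [Complex.add_re, Complex.ofReal_re, RCLike.star_def, Complex.conj_re] at this
  linarith

variable [DecidableEq n]

theorem norm_conjTranspose_mul_mul_apply_le (a : Matrix n Unit ℂ) (B : Matrix n p ℂ)
    (b : Matrix p Unit ℂ) : ‖(aᴴ * B * b) () ()‖ ≤ ‖B‖ * (‖a‖ * ‖b‖) := by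
  rw [norm_apply_unit]
  calc ‖aᴴ * B * b‖ ≤ ‖aᴴ * B‖ * ‖b‖ := Matrix.l2_opNorm_mul _ _
    _ ≤ ‖aᴴ‖ * ‖B‖ * ‖b‖ := by gcongr; exact Matrix.l2_opNorm_mul _ _
    _ = _ := by rw [Matrix.l2_opNorm_conjTranspose]; ring

/-- The `k`-th standard basis column. -/
def unitCol (k : n) : Matrix n Unit ℂ := Matrix.of fun i _ => if i = k then 1 else 0

theorem norm_unitCol (k : n) : ‖unitCol k‖ = 1 := by
  have h := conjTranspose_mul_self_apply_unit (unitCol k)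
  have h1 : ((unitCol k)ᴴ * unitCol k) () () = 1 := by
    rw [Matrix.mul_apply]; simp [unitCol, Matrix.conjTranspose_apply]
  rw [h1] at h
  have h2 : ‖unitCol k‖ ^ 2 = 1 := by exact_mod_cast h.symm
  nlinarith [norm_nonneg (unitCol k)]

theorem mul_unitCol_apply {r : Type*} (B : Matrix r p ℂ) (j : r) (k : p) :
    (B * unitCol k) j () = B j k := by
  rw [Matrix.mul_apply]; simp [unitCol]

theorem norm_apply_le_l2_opNorm (B : Matrix n p ℂ) (j : n) (k : p) : ‖B j k‖ ≤ ‖B‖ := by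
  have h := norm_conjTranspose_mul_mul_apply_le (unitCol j) B (unitCol k)
  rw [norm_unitCol, norm_unitCol, one_mul, mul_one, mul_unitCol_apply, Matrix.mul_apply] at h
  simpa [unitCol, Matrix.conjTranspose_apply, apply_ite] using h

theorem norm_mul_eq_of_isometry {P : Matrix n n ℂ} (hP : Pᴴ * P = 1) (y : Matrix n Unit ℂ) :
    ‖P * y‖ = ‖y‖ := by
  have h1 : (P * y)ᴴ * (P * y) = yᴴ * y := by
    rw [Matrix.conjTranspose_mul, Matrix.mul_assoc, ← Matrix.mul_assoc Pᴴ, hP, Matrix.one_mul]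
  have h2 := conjTranspose_mul_self_apply_unit (P * y)
  rw [h1, conjTranspose_mul_self_apply_unit, Complex.ofReal_inj] at h2
  exact ((sq_eq_sq₀ (norm_nonneg _) (norm_nonneg _)).1 h2).symm

end Column

/-- The Riemann–Lebesgue lemma on `[0, π]`. -/
theorem exists_norm_integral_exp_smul_le {E : Type*} [NormedAddCommGroup E] [NormedSpace ℂ E]
    (G : ℝ → E) {ε : ℝ} (hε : 0 < ε) : ∃ R : ℝ, ∀ σ : ℝ, R ≤ |σ| →
      ‖∫ x in (0)..π, Complex.exp (-(2 * Complex.I * σ * x)) • G x‖ ≤ ε := by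
  have h1 := Real.tendsto_integral_exp_smul_cocompact ((Ioc 0 π).indicator G)
  have h2 := (h1.norm.eventually (gt_mem_nhds (by simpa using hε)))
  rw [cocompact_eq_atBot_atTop, eventually_sup, eventually_atBot, eventually_atTop] at h2
  obtain ⟨⟨a, ha⟩, b, hb⟩ := h2
  refine ⟨π * max (-a) b, fun σ hσ => ?_⟩
  have h3 : ∀ w : ℝ, w = σ / π → ∫ x in (0)..π, Complex.exp (-(2 * Complex.I * σ * x)) • G x =
      ∫ v : ℝ, Real.fourierChar (-(v * w)) • (Ioc 0 π).indicator G v := by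
    rintro w rfl
    rw [intervalIntegral.integral_of_le Real.pi_pos.le, ← integral_indicator measurableSet_Ioc]
    refine integral_congr_ae (Eventually.of_forall fun x => ?_)
    simp only
    by_cases hx : x ∈ Ioc 0 π
    · rw [indicator_of_mem hx, indicator_of_mem hx, Circle.smul_def, Real.fourierChar_apply]
      congr 2
      have : (π : ℂ) ≠ 0 := Complex.ofReal_ne_zero.2 Real.pi_ne_zero
      push_cast; field_simp
    · rw [indicator_of_notMem hx, indicator_of_notMem hx, smul_zero]
  rw [h3 _ rfl]
  rcases le_abs.1 hσ with h | h
  · refine (hb _ ?_).le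
    rw [le_div_iff₀ Real.pi_pos]
    exact le_trans (by rw [mul_comm]; gcongr; exact le_max_right _ _) h
  · refine (ha _ ?_).le
    rw [div_le_iff₀ Real.pi_pos]
    have : π * (-a) ≤ -σ := le_trans (by gcongr; exact le_max_left _ _) h
    linarith

namespace MatrixPencil

variable {m : ℕ} {L : MatrixPencil m}

theorem IsSolution.continuousOn {κ : Type} [Finite κ] {ρ : ℂ} {Y Y' : ℝ → Matrix (Fin m) κ ℂ}
    (h : L.IsSolution ρ Y Y') : ContinuousOn Y (Icc 0 π) :=
  (h.matAC.submatrix Sum.inl id).continuousOn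

/-- Lagrange's identity for a solution with `U(Y) = C` and `V(Y) = 0`. -/
theorem lagrange_identity (hII : L.ConditionII) {ρ : ℂ} {Y Y' : ℝ → Matrix (Fin m) Unit ℂ}
    (hY : L.IsSolution ρ Y Y') {C : Matrix (Fin m) Unit ℂ} (hU : L.U ρ Y Y' = C)
    (hV : L.V ρ Y Y' = 0) :
    (ρ - star ρ) * ((∫ x in (0)..π, (2 * ρ.re * (‖Y x‖ ^ 2 : ℝ) +
        2 * Complex.I * (((Y x)ᴴ * L.Q₁ x * Y x) () ()))) -
      Complex.I * (((Y π)ᴴ * L.H₁ * Y π) () () - ((Y 0)ᴴ * L.h₁ * Y 0) () ())) =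
    ((Y 0)ᴴ * C - Cᴴ * Y 0) () () := by
  obtain ⟨hQ, e1, e2, e3, e4⟩ := hII
  have hac := hY.matAC
  have a1 : MatAC Y Y' := (hac.submatrix Sum.inl id).congr_deriv (by
    refine Eventually.of_forall fun x => ?_
    ext j k
    simp [sysMatrix, fromBlocks_mul_fromRows])
  have a2 : MatAC Y' fun x => -((ρ ^ 2 • (1 : Matrix (Fin m) (Fin m) ℂ) +
      (2 * Complex.I * ρ) • L.Q₁ x + L.Q₀ x) * Y x) :=
    (hac.submatrix Sum.inr id).congr_deriv (by
      refine Eventually.of_forall fun x => ?_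
      ext j k
      simp [sysMatrix, fromBlocks_mul_fromRows, Matrix.neg_mul, -neg_add_rev])
  have a3 := (a1.conjTranspose.mul a2).sub (a2.conjTranspose.mul a1)
  have hYc : ContinuousOn Y (Icc 0 π) := hY.continuousOn
  have hcs : ContinuousOn (fun x => (star ρ - ρ) • ((Y x)ᴴ * ((2 * ρ.re : ℂ) • 1 +
      (2 * Complex.I) • L.Q₁ x) * Y x)) (Icc 0 π) := by
    have h1 : ContinuousOn (fun x => (Y x)ᴴ) (Icc 0 π) := by fun_prop
    have h2 : ContinuousOn (fun x => (2 * ρ.re : ℂ) • (1 : Matrix (Fin m) (Fin m) ℂ) +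
      (2 * Complex.I) • L.Q₁ x) (Icc 0 π) :=
      continuousOn_const.add (L.continuousOn_Q₁.const_smul (2 * Complex.I))
    have h3 := (continuous_fst.matrix_mul continuous_snd).comp_continuousOn
      (((continuous_fst.matrix_mul continuous_snd).comp_continuousOn (h1.prodMk h2)).prodMk hYc)
    exact h3.const_smul (star ρ - ρ)
  have a4 := a3.congr_deriv (G' := fun x => (star ρ - ρ) • ((Y x)ᴴ * ((2 * ρ.re : ℂ) • 1 +
      (2 * Complex.I) • L.Q₁ x) * Y x)) (by
    filter_upwards [hQ] with x hx
    have hre : (2 * ρ.re : ℂ) = star ρ + ρ := by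
      rw [RCLike.star_def, add_comm, Complex.add_conj]; push_cast; ring
    simp only [Matrix.conjTranspose_neg, Matrix.conjTranspose_mul, Matrix.conjTranspose_add,
      Matrix.conjTranspose_smul, hx.1, hx.2, star_mul', star_pow,
      RCLike.star_def, Complex.conj_I, map_ofNat, Matrix.mul_add, Matrix.add_mul, Matrix.mul_neg,
      Matrix.neg_mul, Matrix.mul_smul, Matrix.smul_mul, Matrix.mul_one, Matrix.one_mul,
      Matrix.mul_assoc, hre]
    module)
  have a5 := a4.eq_add_integral (hcs.intervalIntegrable_of_Icc Real.pi_pos.le) pi_mem_Icc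
  rw [U] at hU
  rw [V] at hV
  have b1 : Y' 0 = C - ((Complex.I * ρ) • L.h₁ + L.h₀) * Y 0 := by rw [← hU]; abel
  have b2 : Y' π = -(((Complex.I * ρ) • L.H₁ + L.H₀) * Y π) := eq_neg_of_add_eq_zero_left hV
  have a6 := congrFun (congrFun a5 ()) ()
  rw [Matrix.add_apply, integral_matrix_apply (hcs.intervalIntegrable_of_Icc Real.pi_pos.le)] at a6
  have a7 : (fun x => ((star ρ - ρ) • ((Y x)ᴴ * ((2 * ρ.re : ℂ) • 1 +
      (2 * Complex.I) • L.Q₁ x) * Y x) : Matrix Unit Unit ℂ) () ()) = fun x => (star ρ - ρ) *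
      (2 * ρ.re * (‖Y x‖ ^ 2 : ℝ) + 2 * Complex.I * (((Y x)ᴴ * L.Q₁ x * Y x) () ())) := by
    funext x
    rw [← conjTranspose_mul_self_apply_unit]
    simp only [Matrix.mul_add, Matrix.add_mul, Matrix.mul_smul, Matrix.smul_mul, Matrix.mul_one,
      Matrix.smul_apply, Matrix.add_apply, smul_eq_mul]
  rw [a7, intervalIntegral.integral_const_mul, b1, b2] at a6
  simp only [Matrix.conjTranspose_neg, Matrix.conjTranspose_sub, Matrix.conjTranspose_mul,
    Matrix.conjTranspose_add, Matrix.conjTranspose_smul, e1, e2, e3, e4, star_mul',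
    RCLike.star_def, Complex.conj_I, Matrix.mul_add, Matrix.add_mul, Matrix.mul_sub, Matrix.sub_mul,
    Matrix.mul_neg, Matrix.neg_mul, Matrix.mul_smul, Matrix.smul_mul, Matrix.smul_apply,
    Matrix.add_apply, Matrix.sub_apply, Matrix.neg_apply, smul_eq_mul, Matrix.mul_assoc] at a6 ⊢
  linear_combination a6

/-- The sum of the two waves with amplitudes `a` and `b`. -/
def waveSum (L : MatrixPencil m) (ρ : ℂ) (a b : Matrix (Fin m) Unit ℂ) (x : ℝ) :
    Matrix (Fin m) Unit ℂ :=
  Complex.exp (Complex.I * ρ * x) • (L.Pm x * a) + Complex.exp (-(Complex.I * ρ * x)) • (L.Pp x * b)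

/-- In the strip `|Im ρ| ≤ 1`, every solution is close to a sum of two waves. -/
theorem exists_amplitudes (hII : L.ConditionII) : ∃ K R : ℝ, 0 < K ∧ 1 ≤ R ∧ ∀ ρ : ℂ, R ≤ ‖ρ‖ →
    |ρ.im| ≤ 1 → ∀ Y Y' : ℝ → Matrix (Fin m) Unit ℂ, L.IsSolution ρ Y Y' →
      ∃ a b : Matrix (Fin m) Unit ℂ, ∀ x ∈ Icc 0 π,
        ‖Y x - L.waveSum ρ a b x‖ ≤ K / ‖ρ‖ * (‖a‖ + ‖b‖) ∧ ‖Y x‖ ≤ K * (‖a‖ + ‖b‖) := by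
  obtain ⟨C, R, hC, hR, hwave⟩ := exists_wave_asymptotics (L := L) hII
  obtain ⟨E, hE⟩ : ∃ E, E = Real.exp π := ⟨_, rfl⟩
  have hE0 : 0 < E := hE ▸ Real.exp_pos _
  refine ⟨E * (1 + 2 * C), R, by positivity, hR, fun ρ h1 him Y Y' hY => ?_⟩
  have hρ1 : 1 ≤ ‖ρ‖ := hR.trans h1
  obtain ⟨hu, Z, hZc, hZ, hZF⟩ := hwave ρ h1
  -- the amplitudes at the left end
  obtain ⟨hu0, -⟩ := hu 0 (left_mem_Icc.2 Real.pi_pos.le)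
  obtain ⟨a, b, hab⟩ : ∃ a b : Matrix (Fin m) Unit ℂ,
      L.waveT ρ 0 * fromRows a b = fromRows (Y 0) (Y' 0) := by
    have hinv : L.symb ρ 0 * (L.symb ρ 0)⁻¹ = 1 :=
      Matrix.mul_nonsing_inv _ ((Matrix.isUnit_iff_isUnit_det _).1 hu0)
    refine ⟨(2⁻¹ : ℂ) • (Y 0 + (L.symb ρ 0)⁻¹ * Y' 0), (2⁻¹ : ℂ) • (Y 0 - (L.symb ρ 0)⁻¹ * Y' 0), ?_⟩
    rw [waveT, fromBlocks_mul_fromRows]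
    simp only [Matrix.one_mul, Matrix.mul_smul, Matrix.mul_add, Matrix.mul_sub, Matrix.neg_mul,
      ← Matrix.mul_assoc, hinv]
    congr 1 <;> module
  refine ⟨a, b, ?_⟩
  obtain ⟨N, hN⟩ : ∃ N, N = ‖a‖ + ‖b‖ := ⟨_, rfl⟩
  have hN0 : 0 ≤ N := by rw [hN]; positivity
  rw [← hN]
  obtain ⟨J, hJ⟩ : ∃ J : Matrix (Fin m) (Fin m ⊕ Fin m) ℂ, J = fromCols 1 1 := ⟨_, rfl⟩
  have hone : ∀ X : Matrix (Fin m ⊕ Fin m) Unit ℂ, ‖J * X‖ ≤ 2 * ‖X‖ := fun X => by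
    rw [hJ]
    refine (Matrix.l2_opNorm_mul _ _).trans (mul_le_mul_of_nonneg_right ?_ (norm_nonneg _))
    have := l2_opNorm_fromCols_le (1 : Matrix (Fin m) (Fin m) ℂ) (1 : Matrix (Fin m) (Fin m) ℂ)
    linarith [l2_opNorm_one_le (n := Fin m)]
  have hexp : ∀ x ∈ Icc 0 π, Real.exp (|ρ.im| * x) ≤ E := fun x hx => by
    rw [hE]
    refine Real.exp_le_exp.2 ?_
    calc |ρ.im| * x ≤ 1 * π := mul_le_mul him hx.2 hx.1 zero_le_one
      _ = π := one_mul _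
  have hYeq : ∀ x ∈ Icc 0 π, Y x = J * (Z x * fromRows a b) := by
    intro x hx
    have h4 := hY.eq_fund_mul hx
    rw [← hab, ← Matrix.mul_assoc, hZ x hx, Matrix.mul_assoc, waveT, ← fromRows_fromCols_eq_fromBlocks,
      fromRows_mul, ← hJ] at h4
    exact (fromRows_inj h4).1
  have hyeq : ∀ x, L.waveSum ρ a b x = J * (L.waveF ρ x * fromRows a b) := by
    intro x
    rw [waveF, fromBlocks_mul_fromRows, hJ, fromCols_mul_fromRows]
    simp [waveSum, Matrix.smul_mul]
  have hv : ‖fromRows a b‖ ≤ N := hN ▸ l2_opNorm_fromRows_le a b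
  have hdiff : ∀ x ∈ Icc 0 π, ‖Y x - L.waveSum ρ a b x‖ ≤ 2 * C * E / ‖ρ‖ * N := by
    intro x hx
    rw [hYeq x hx, hyeq, ← Matrix.mul_sub, ← Matrix.sub_mul]
    refine (hone _).trans ?_
    have h5 : ‖(Z x - L.waveF ρ x) * fromRows a b‖ ≤ C / ‖ρ‖ * E * N := by
      refine (Matrix.l2_opNorm_mul _ _).trans (mul_le_mul ?_ hv (norm_nonneg _) (by positivity))
      exact (hZF x hx).trans (mul_le_mul_of_nonneg_left (hexp x hx) (by positivity))
    calc 2 * ‖(Z x - L.waveF ρ x) * fromRows a b‖ ≤ 2 * (C / ‖ρ‖ * E * N) := by linarith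
      _ = _ := by ring
  have hyup : ∀ x ∈ Icc 0 π, ‖L.waveSum ρ a b x‖ ≤ E * N := by
    intro x hx
    obtain ⟨g1, g2⟩ := norm_cexp_mul_I_le ρ hx.1
    refine (norm_add_le _ _).trans ?_
    rw [norm_smul, norm_smul, norm_mul_eq_of_isometry (hII.Pm_unitary hx),
      norm_mul_eq_of_isometry (hII.Pp_unitary hx), hN, mul_add]
    exact add_le_add (mul_le_mul_of_nonneg_right (g1.trans (hexp x hx)) (norm_nonneg _))
      (mul_le_mul_of_nonneg_right (g2.trans (hexp x hx)) (norm_nonneg _))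
  intro x hx
  have h5 : 2 * C * E / ‖ρ‖ * N ≤ 2 * C * E * N :=
    mul_le_mul_of_nonneg_right (div_le_self (by positivity) hρ1) hN0
  constructor
  · refine (hdiff x hx).trans (mul_le_mul_of_nonneg_right ?_ hN0)
    refine div_le_div_of_nonneg_right ?_ (norm_nonneg _)
    nlinarith
  · have h4 : ‖Y x‖ ≤ ‖Y x - L.waveSum ρ a b x‖ + ‖L.waveSum ρ a b x‖ := by
      simpa using norm_add_le (Y x - L.waveSum ρ a b x) (L.waveSum ρ a b x)
    calc ‖Y x‖ ≤ 2 * C * E * N + E * N := h4.trans (add_le_add ((hdiff x hx).trans h5) (hyup x hx))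
      _ = _ := by ring

theorem continuousOn_waveSum (ρ : ℂ) (a b : Matrix (Fin m) Unit ℂ) :
    ContinuousOn (L.waveSum ρ a b) (Icc 0 π) := by
  have hPm : ContinuousOn L.Pm (Icc 0 π) := L.isCauchySolution_Pm.continuousOn
  have hPp : ContinuousOn L.Pp (Icc 0 π) := L.isCauchySolution_Pp.continuousOn
  have hmul : ∀ {P : ℝ → Matrix (Fin m) (Fin m) ℂ} (v : Matrix (Fin m) Unit ℂ),
      ContinuousOn P (Icc 0 π) → ContinuousOn (fun x => P x * v) (Icc 0 π) := fun v hP =>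
    (continuous_fst.matrix_mul continuous_snd).comp_continuousOn (hP.prodMk continuousOn_const)
  have e1 : Continuous fun x : ℝ => Complex.exp (Complex.I * ρ * x) := by fun_prop
  have e2 : Continuous fun x : ℝ => Complex.exp (-(Complex.I * ρ * x)) := by fun_prop
  exact (e1.continuousOn.smul (hmul a hPm)).add (e2.continuousOn.smul (hmul b hPp))

/-- The squared norm of a wave sum, up to the oscillating cross term, is at least a multiple of the
squared amplitudes. -/
theorem le_norm_waveSum_sq (hII : L.ConditionII) {ρ : ℂ} (him : |ρ.im| ≤ 1)
  (a b : Matrix (Fin m) Unit ℂ) {x : ℝ} (hx : x ∈ Icc 0 π) :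
  Real.exp (-(2 * π)) * (‖a‖ ^ 2 + ‖b‖ ^ 2) +
    2 * ((aᴴ * (Complex.exp (-(2 * Complex.I * ρ.re * x)) • ((L.Pm x)ᴴ * L.Pp x)) * b) () ()).re ≤
      ‖L.waveSum ρ a b x‖ ^ 2 := by
  obtain ⟨k, hk⟩ : ∃ k, k = Real.exp (-(2 * π)) := ⟨_, rfl⟩
  rw [waveSum, ← hk]
  rw [norm_add_sq_unit, norm_smul, norm_smul, norm_mul_eq_of_isometry (hII.Pm_unitary hx),
    norm_mul_eq_of_isometry (hII.Pp_unitary hx)]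
  have hx' : |ρ.im * x| ≤ π := by
    rw [abs_mul, abs_of_nonneg hx.1]
    calc |ρ.im| * x ≤ 1 * π := mul_le_mul him hx.2 hx.1 zero_le_one
      _ = π := one_mul _
  have g1 : k ≤ ‖Complex.exp (Complex.I * ρ * x)‖ ^ 2 := by
    rw [Complex.norm_exp, ← Real.exp_nat_mul, hk]
    refine Real.exp_le_exp.2 ?_
    simp; linarith [le_abs_self (ρ.im * x)]
  have g2 : k ≤ ‖Complex.exp (-(Complex.I * ρ * x))‖ ^ 2 := by
    rw [Complex.norm_exp, ← Real.exp_nat_mul, hk]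
    refine Real.exp_le_exp.2 ?_
    simp; linarith [neg_abs_le (ρ.im * x)]
  have g3 : (Complex.exp (Complex.I * ρ * x) • (L.Pm x * a))ᴴ *
      (Complex.exp (-(Complex.I * ρ * x)) • (L.Pp x * b)) =
      aᴴ * (Complex.exp (-(2 * Complex.I * ρ.re * x)) • ((L.Pm x)ᴴ * L.Pp x)) * b := by
    rw [Matrix.conjTranspose_smul, Matrix.smul_mul, Matrix.mul_smul, smul_smul,
      Matrix.conjTranspose_mul, Matrix.mul_smul, Matrix.smul_mul, RCLike.star_def,
      ← Complex.exp_conj, ← Complex.exp_add]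
    congr 1
    · congr 1
      have : (2 * ρ.re : ℂ) = ρ + (starRingEnd ℂ) ρ := by rw [Complex.add_conj]; push_cast; ring
      simp only [map_mul, Complex.conj_I, Complex.conj_ofReal]
      linear_combination Complex.I * x * this
    · simp only [Matrix.mul_assoc]
  rw [g3, mul_pow, mul_pow]
  have := mul_le_mul_of_nonneg_right g1 (sq_nonneg ‖a‖)
  have := mul_le_mul_of_nonneg_right g2 (sq_nonneg ‖b‖)
  linarith

/-- The cross term of the two waves is negligible in the mean for large `Re ρ`, by the
Riemann–Lebesgue lemma. -/
theorem exists_le_integral_waveSum_sq (hII : L.ConditionII) : ∃ c R : ℝ, 0 < c ∧ ∀ ρ : ℂ,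
    R ≤ |ρ.re| → |ρ.im| ≤ 1 → ∀ a b : Matrix (Fin m) Unit ℂ,
      π * c * (‖a‖ ^ 2 + ‖b‖ ^ 2) ≤ ∫ x in (0)..π, ‖L.waveSum ρ a b x‖ ^ 2 := by
  have hlow' := fun ρ him a b => @le_norm_waveSum_sq m L hII ρ him a b
  obtain ⟨k, hk⟩ : ∃ k, k = Real.exp (-(2 * π)) := ⟨_, rfl⟩
  have hk0 : 0 < k := hk ▸ Real.exp_pos _
  rw [← hk] at hlow'
  obtain ⟨R', hosc⟩ := exists_norm_integral_exp_smul_le (fun x => (L.Pm x)ᴴ * L.Pp x)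
    (by positivity : 0 < π * k / 2)
  refine ⟨k / 2, R', by positivity, fun ρ h2 him a b => ?_⟩
  obtain ⟨S, hS⟩ : ∃ S, S = ‖a‖ ^ 2 + ‖b‖ ^ 2 := ⟨_, rfl⟩
  have hlow := fun x => @hlow' ρ him a b x
  rw [← hS] at hlow ⊢
  have hPm : ContinuousOn L.Pm (Icc 0 π) := L.isCauchySolution_Pm.continuousOn
  have hPp : ContinuousOn L.Pp (Icc 0 π) := L.isCauchySolution_Pp.continuousOn
  have hyc := L.continuousOn_waveSum ρ a b
  have hG : ContinuousOn (fun x : ℝ => Complex.exp (-(2 * Complex.I * ρ.re * x)) •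
      ((L.Pm x)ᴴ * L.Pp x)) (Icc 0 π) := by
    have e1 : ContinuousOn (fun x => (L.Pm x)ᴴ) (Icc 0 π) := by fun_prop
    have e2 : Continuous fun x : ℝ => Complex.exp (-(2 * Complex.I * ρ.re * x)) := by fun_prop
    exact e2.continuousOn.smul (e1.mul hPp)
  have hGi := hG.intervalIntegrable_of_Icc (μ := volume) Real.pi_pos.le
  -- the cross term, as a linear functional of the matrix in the middle
  let ψ : Matrix (Fin m) (Fin m) ℂ →L[ℂ] ℂ := LinearMap.toContinuousLinearMap
    { toFun := fun X => (aᴴ * X * b) () ()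
      map_add' := fun X X' => by rw [Matrix.mul_add, Matrix.add_mul, Matrix.add_apply]
      map_smul' := fun c X => by
        rw [Matrix.mul_smul, Matrix.smul_mul, Matrix.smul_apply, RingHom.id_apply] }
  have hψ : ∀ X, ψ X = (aᴴ * X * b) () () := fun X => rfl
  have hψi : IntervalIntegrable (fun x : ℝ => ψ (Complex.exp (-(2 * Complex.I * ρ.re * x)) •
      ((L.Pm x)ᴴ * L.Pp x))) volume 0 π :=
    (ψ.continuous.comp_continuousOn hG).intervalIntegrable_of_Icc Real.pi_pos.le
  have hcross : |(∫ x in (0)..π, (ψ (Complex.exp (-(2 * Complex.I * ρ.re * x)) •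
      ((L.Pm x)ᴴ * L.Pp x))).re)| ≤ π * k / 2 * (‖a‖ * ‖b‖) := by
    have e1 := Complex.reCLM.intervalIntegral_comp_comm hψi
    simp only [Complex.reCLM_apply] at e1
    rw [e1, ψ.intervalIntegral_comp_comm hGi]
    refine (Complex.abs_re_le_norm _).trans ((norm_conjTranspose_mul_mul_apply_le _ _ _).trans ?_)
    exact mul_le_mul_of_nonneg_right (hosc ρ.re h2) (by positivity)
  have hre : IntervalIntegrable (fun x : ℝ => (ψ (Complex.exp (-(2 * Complex.I * ρ.re * x)) •
      ((L.Pm x)ᴴ * L.Pp x))).re) volume 0 π :=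
    (Complex.continuous_re.comp_continuousOn
      (ψ.continuous.comp_continuousOn hG)).intervalIntegrable_of_Icc Real.pi_pos.le
  have e1 : ∫ x in (0)..π, (k * S + 2 * (ψ (Complex.exp (-(2 * Complex.I * ρ.re * x)) •
      ((L.Pm x)ᴴ * L.Pp x))).re) ≤ ∫ x in (0)..π, ‖L.waveSum ρ a b x‖ ^ 2 :=
    intervalIntegral.integral_mono_on Real.pi_pos.le
      (intervalIntegrable_const.add (hre.const_mul 2))
      ((hyc.norm.pow 2).intervalIntegrable_of_Icc Real.pi_pos.le) hlow
  rw [intervalIntegral.integral_add intervalIntegrable_const (hre.const_mul 2),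
    intervalIntegral.integral_const, intervalIntegral.integral_const_mul, sub_zero,
    smul_eq_mul] at e1
  have e2 := (abs_le.1 hcross).1
  have e3 : ‖a‖ * ‖b‖ ≤ S / 2 := by rw [hS]; nlinarith [sq_nonneg (‖a‖ - ‖b‖)]
  have e4 : π * k / 2 * (‖a‖ * ‖b‖) ≤ π * k / 2 * (S / 2) :=
    mul_le_mul_of_nonneg_left e3 (by positivity)
  linarith

/-- In the strip `|Im ρ| ≤ 1`, for large `Re ρ`, the boundary values of a solution are controlled by
its mean: both are comparable with the amplitudes. -/
theorem exists_energy_bound (hII : L.ConditionII) : ∃ c R : ℝ, 0 < c ∧ ∀ ρ : ℂ, R ≤ |ρ.re| →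
    |ρ.im| ≤ 1 → ∀ Y Y' : ℝ → Matrix (Fin m) Unit ℂ, L.IsSolution ρ Y Y' →
      c * (‖Y 0‖ ^ 2 + ‖Y π‖ ^ 2) ≤ ∫ x in (0)..π, ‖Y x‖ ^ 2 := by
  obtain ⟨K, R, hK, hR, hamp⟩ := exists_amplitudes (L := L) hII
  obtain ⟨k, R', hk, hmean⟩ := exists_le_integral_waveSum_sq (L := L) hII
  refine ⟨π * k / 4 / (4 * K ^ 2), max (max R R') (8 * K ^ 2 / k), by positivity,
    fun ρ hρ him Y Y' hY => ?_⟩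
  have hρn : |ρ.re| ≤ ‖ρ‖ := Complex.abs_re_le_norm ρ
  have h1 : R ≤ ‖ρ‖ := ((le_max_left _ _).trans ((le_max_left _ _).trans hρ)).trans hρn
  have h2 : R' ≤ |ρ.re| := (le_max_right _ _).trans ((le_max_left _ _).trans hρ)
  have h3 : 8 * K ^ 2 / k ≤ ‖ρ‖ := ((le_max_right _ _).trans hρ).trans hρn
  have hρ1 : 1 ≤ ‖ρ‖ := hR.trans h1
  obtain ⟨a, b, hab⟩ := hamp ρ h1 him Y Y' hY
  have hy2 := hmean ρ h2 him a b
  have hyc := L.continuousOn_waveSum ρ a b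
  obtain ⟨N, hN⟩ : ∃ N, N = ‖a‖ + ‖b‖ := ⟨_, rfl⟩
  obtain ⟨S, hS⟩ : ∃ S, S = ‖a‖ ^ 2 + ‖b‖ ^ 2 := ⟨_, rfl⟩
  rw [← hN] at hab
  rw [← hS] at hy2
  have hN0 : 0 ≤ N := by rw [hN]; positivity
  have hNS : N ^ 2 ≤ 2 * S := by
    rw [hN, hS]; nlinarith [sq_nonneg (‖a‖ - ‖b‖)]
  have hd : ∀ x ∈ Icc 0 π, ‖L.waveSum ρ a b x‖ ^ 2 / 2 - k / 4 * S ≤ ‖Y x‖ ^ 2 := by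
    intro x hx
    have e1 : ‖L.waveSum ρ a b x‖ ≤ ‖Y x‖ + ‖Y x - L.waveSum ρ a b x‖ := by
      rw [norm_sub_rev]; simpa using norm_add_le (Y x) (L.waveSum ρ a b x - Y x)
    have e2 := (hab x hx).1
    have e3 : ‖Y x - L.waveSum ρ a b x‖ ^ 2 ≤ k / 8 * N ^ 2 := by
      refine (pow_le_pow_left₀ (norm_nonneg _) e2 2).trans ?_
      rw [mul_pow]
      refine mul_le_mul_of_nonneg_right ?_ (sq_nonneg N)
      rw [div_le_iff₀ hk] at h3
      rw [div_pow, div_le_iff₀ (by positivity)]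
      nlinarith
    have e5 := pow_le_pow_left₀ (norm_nonneg _) e1 2
    nlinarith [sq_nonneg (‖Y x‖ - ‖Y x - L.waveSum ρ a b x‖)]
  have hY2 : π * k / 4 * S ≤ ∫ x in (0)..π, ‖Y x‖ ^ 2 := by
    have hyi : IntervalIntegrable (fun x => ‖L.waveSum ρ a b x‖ ^ 2) volume 0 π :=
      (hyc.norm.pow 2).intervalIntegrable_of_Icc Real.pi_pos.le
    have e1 : ∫ x in (0)..π, (‖L.waveSum ρ a b x‖ ^ 2 / 2 - k / 4 * S) ≤ ∫ x in (0)..π, ‖Y x‖ ^ 2 :=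
      intervalIntegral.integral_mono_on Real.pi_pos.le
        ((hyi.div_const 2).sub intervalIntegrable_const)
        ((hY.continuousOn.norm.pow 2).intervalIntegrable_of_Icc Real.pi_pos.le) hd
    rw [intervalIntegral.integral_sub (hyi.div_const 2) intervalIntegrable_const,
      intervalIntegral.integral_div, intervalIntegral.integral_const, sub_zero, smul_eq_mul] at e1
    linarith
  refine le_trans ?_ hY2
  have hsq : ∀ x ∈ Icc 0 π, ‖Y x‖ ^ 2 ≤ K ^ 2 * (2 * S) := fun x hx =>
    (pow_le_pow_left₀ (norm_nonneg _) (hab x hx).2 2).trans (by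
      rw [mul_pow]; exact mul_le_mul_of_nonneg_left hNS (sq_nonneg K))
  have e1 := hsq 0 (left_mem_Icc.2 Real.pi_pos.le)
  have e2 := hsq π pi_mem_Icc
  rw [div_mul_eq_mul_div, div_le_iff₀ (by positivity), mul_assoc (π * k / 4)]
  exact mul_le_mul_of_nonneg_left (by linarith) (by positivity)

/-- Near the real axis, but off it, the values at `0` of solutions with `V(Y) = 0` are controlled by
`U(Y)`: with the energy bound, the boundary terms in Lagrange's identity are absorbed. -/
theorem exists_abs_im_mul_norm_le (hII : L.ConditionII) : ∃ R : ℝ, 1 ≤ R ∧ ∀ ρ : ℂ, R ≤ |ρ.re| →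
    |ρ.im| ≤ 1 → ∀ Y Y' : ℝ → Matrix (Fin m) Unit ℂ, L.IsSolution ρ Y Y' → L.V ρ Y Y' = 0 →
      |ρ.im| * ‖Y 0‖ ≤ ‖L.U ρ Y Y'‖ := by
  obtain ⟨c, R, hc, henergy⟩ := exists_energy_bound (L := L) hII
  obtain ⟨q, hq0, hq⟩ := L.exists_bound_Q₁
  set d := ‖L.H₁‖ + ‖L.h₁‖ with hd
  refine ⟨max 1 (max R (q + (d + 1) / (2 * c))), le_max_left _ _, fun ρ hρ him Y Y' hY hV => ?_⟩
  have h1 : R ≤ |ρ.re| := ((le_max_left _ _).trans (le_max_right _ _)).trans hρ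
  have h2 : q + (d + 1) / (2 * c) ≤ |ρ.re| := ((le_max_right _ _).trans (le_max_right _ _)).trans hρ
  have hen := henergy ρ h1 him Y Y' hY
  have hlag := lagrange_identity hII hY rfl hV
  have hYc := hY.continuousOn
  have hn2 : ContinuousOn (fun x => ‖Y x‖ ^ 2) (Icc 0 π) := hYc.norm.pow 2
  have hn2i := hn2.intervalIntegrable_of_Icc (μ := volume) Real.pi_pos.le
  set I₂ := ∫ x in (0)..π, ‖Y x‖ ^ 2 with hI₂
  set S := ‖Y 0‖ ^ 2 + ‖Y π‖ ^ 2 with hS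
  have hqc : ContinuousOn (fun x => ((Y x)ᴴ * L.Q₁ x * Y x) () ()) (Icc 0 π) := by
    have e1 : ContinuousOn (fun x => (Y x)ᴴ) (Icc 0 π) := by fun_prop
    exact ((continuous_fst.matrix_mul continuous_snd).comp_continuousOn
      (((continuous_fst.matrix_mul continuous_snd).comp_continuousOn
        (e1.prodMk L.continuousOn_Q₁)).prodMk hYc)).matrix_apply () ()
  have hqi := hqc.intervalIntegrable_of_Icc (μ := volume) Real.pi_pos.le
  have hq2 : ‖∫ x in (0)..π, ((Y x)ᴴ * L.Q₁ x * Y x) () ()‖ ≤ q * I₂ := by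
    rw [hI₂, ← intervalIntegral.integral_const_mul]
    refine intervalIntegral.norm_integral_le_of_norm_le Real.pi_pos.le ?_ (hn2i.const_mul q)
    refine Eventually.of_forall fun x hx => ?_
    refine (norm_conjTranspose_mul_mul_apply_le _ _ _).trans ?_
    rw [sq]
    exact mul_le_mul_of_nonneg_right (hq x (Ioc_subset_Icc_self hx)) (by positivity)
  have hint : ∫ x in (0)..π, (2 * ρ.re * (‖Y x‖ ^ 2 : ℝ) +
        2 * Complex.I * (((Y x)ᴴ * L.Q₁ x * Y x) () ()) : ℂ) = ((2 * ρ.re * I₂ : ℝ) : ℂ) +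
      2 * Complex.I * ∫ x in (0)..π, ((Y x)ᴴ * L.Q₁ x * Y x) () () := by
    have e1 : IntervalIntegrable (fun x => (2 * ρ.re * (‖Y x‖ ^ 2 : ℝ) : ℂ)) volume 0 π :=
      ((Complex.continuous_ofReal.comp_continuousOn hn2).intervalIntegrable_of_Icc
        Real.pi_pos.le).const_mul _
    rw [intervalIntegral.integral_add e1 (hqi.const_mul _), intervalIntegral.integral_const_mul,
      intervalIntegral.integral_const_mul, intervalIntegral.integral_ofReal]
    push_cast; rfl
  rw [hint] at hlag
  have hb1 : ‖((Y π)ᴴ * L.H₁ * Y π) () () - ((Y 0)ᴴ * L.h₁ * Y 0) () ()‖ ≤ d * S := by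
    have e1 := norm_conjTranspose_mul_mul_apply_le (Y π) L.H₁ (Y π)
    have e2 := norm_conjTranspose_mul_mul_apply_le (Y 0) L.h₁ (Y 0)
    refine (norm_sub_le _ _).trans ?_
    rw [hd, hS]
    nlinarith [norm_nonneg L.H₁, norm_nonneg L.h₁, sq_nonneg ‖Y 0‖, sq_nonneg ‖Y π‖]
  have hI0 : 0 ≤ I₂ := intervalIntegral.integral_nonneg Real.pi_pos.le fun x _ => by positivity
  have hS0 : 0 ≤ S := by positivity
  have hmain : S ≤ ‖((2 * ρ.re * I₂ : ℝ) : ℂ) +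
      2 * Complex.I * (∫ x in (0)..π, ((Y x)ᴴ * L.Q₁ x * Y x) () ()) -
      Complex.I * (((Y π)ᴴ * L.H₁ * Y π) () () - ((Y 0)ᴴ * L.h₁ * Y 0) () ())‖ := by
    have e1 : ‖((2 * ρ.re * I₂ : ℝ) : ℂ)‖ = 2 * |ρ.re| * I₂ := by
      rw [Complex.norm_real, Real.norm_eq_abs, abs_mul, abs_mul, abs_of_nonneg hI0]; norm_num
    have e2 : ‖2 * Complex.I * (∫ x in (0)..π, ((Y x)ᴴ * L.Q₁ x * Y x) () ())‖ ≤ 2 * (q * I₂) := by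
      rw [norm_mul, norm_mul, Complex.norm_I, Complex.norm_ofNat, mul_one]; linarith
    have e3 : ‖Complex.I * (((Y π)ᴴ * L.H₁ * Y π) () () - ((Y 0)ᴴ * L.h₁ * Y 0) () ())‖ ≤ d * S := by
      rw [norm_mul, Complex.norm_I, one_mul]; exact hb1
    have e4 := norm_sub_le_norm_add ((2 * ρ.re * I₂ : ℝ) : ℂ)
      (2 * Complex.I * (∫ x in (0)..π, ((Y x)ᴴ * L.Q₁ x * Y x) () ()))
    have e5 := norm_sub_norm_le (((2 * ρ.re * I₂ : ℝ) : ℂ) +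
      2 * Complex.I * (∫ x in (0)..π, ((Y x)ᴴ * L.Q₁ x * Y x) () ()))
      (Complex.I * (((Y π)ᴴ * L.H₁ * Y π) () () - ((Y 0)ᴴ * L.h₁ * Y 0) () ()))
    -- `2 (|Re ρ| - q)` times the mean dominates `(d + 1) S`, so that the boundary terms `d S` are
    -- absorbed and `S` is left over
    have e6 : (d + 1) / (2 * c) ≤ |ρ.re| - q := by linarith
    rw [div_le_iff₀ (by positivity)] at e6
    have e7 : (|ρ.re| - q) * (c * S) ≤ (|ρ.re| - q) * I₂ := by
      refine mul_le_mul_of_nonneg_left hen ?_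
      have : 0 ≤ (d + 1) / (2 * c) := by positivity
      linarith
    nlinarith
  have hfin := congrArg norm hlag
  rw [norm_mul] at hfin
  have him2 : ‖ρ - star ρ‖ = 2 * |ρ.im| := by
    rw [RCLike.star_def, Complex.sub_conj]; simp
  rw [him2] at hfin
  have hrhs : ‖((Y 0)ᴴ * L.U ρ Y Y' - (L.U ρ Y Y')ᴴ * Y 0) () ()‖ ≤
      2 * (‖Y 0‖ * ‖L.U ρ Y Y'‖) := by
    rw [norm_apply_unit]
    refine (norm_sub_le _ _).trans ?_
    have e1 := Matrix.l2_opNorm_mul (Y 0)ᴴ (L.U ρ Y Y')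
    have e2 := Matrix.l2_opNorm_mul (L.U ρ Y Y')ᴴ (Y 0)
    rw [Matrix.l2_opNorm_conjTranspose] at e1 e2
    linarith
  have h3 : 2 * |ρ.im| * ‖Y 0‖ ^ 2 ≤ 2 * (‖Y 0‖ * ‖L.U ρ Y Y'‖) := by
    refine le_trans ?_ (hfin.le.trans hrhs)
    refine mul_le_mul_of_nonneg_left (le_trans ?_ hmain) (by positivity)
    rw [hS]; nlinarith [sq_nonneg ‖Y π‖]
  rcases eq_or_lt_of_le (norm_nonneg (Y 0)) with h0 | h0
  · rw [← h0, mul_zero]; exact norm_nonneg _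
  · refine le_of_mul_le_mul_left ?_ h0
    nlinarith

/-- Off the real axis, in the strip and far from the imaginary axis, there are no eigenvalues, and
the Weyl matrix is bounded by the inverse distance to the real axis. -/
theorem exists_weylMatrix_bound (hII : L.ConditionII) : ∃ R : ℝ, 1 ≤ R ∧ ∀ ρ : ℂ, R ≤ |ρ.re| →
    |ρ.im| ≤ 1 → ρ.im ≠ 0 → L.charFun ρ ≠ 0 ∧ ∀ j k, ‖L.weylMatrix ρ j k‖ ≤ 1 / |ρ.im| := by
  obtain ⟨R, hR, h⟩ := exists_abs_im_mul_norm_le (L := L) hII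
  refine ⟨R, hR, fun ρ hre him him0 => ?_⟩
  have hpos : 0 < |ρ.im| := abs_pos.2 him0
  have hne : L.charFun ρ ≠ 0 := by
    intro h0
    rw [← isEigenvalue_iff] at h0
    obtain ⟨Y, Y', hY, hU, hV, x, hx, hne⟩ := h0
    have h1 := h ρ hre him Y Y' hY hV
    rw [hU, norm_zero] at h1
    have h2 : Y 0 = 0 := norm_eq_zero.1 (le_antisymm (nonpos_of_mul_nonpos_right h1 hpos)
      (norm_nonneg _))
    have h3 : Y' 0 = 0 := by simpa [U, h2] using hU
    have h4 := hY.eq_fund_mul hx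
    rw [h2, h3, show fromRows (0 : Matrix (Fin m) Unit ℂ) (0 : Matrix (Fin m) Unit ℂ) = 0 by
      ext (i | i) <;> rfl, Matrix.mul_zero] at h4
    exact hne (by ext i u; exact congrFun (congrFun h4 (Sum.inl i)) u)
  refine ⟨hne, fun j k => ?_⟩
  have h1 := h ρ hre him _ _ (L.isSolution_solY ρ (L.weylMatrix ρ * unitCol k) (unitCol k)) (by
    have hu : IsUnit (L.charMatrix ρ).det := by rw [← charFun_eq]; exact hne.isUnit
    rw [V_solY, ← Matrix.mul_assoc, ← Matrix.add_mul, L.weylMatrix_eq hne, Matrix.mul_neg,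
      ← Matrix.mul_assoc, Matrix.mul_nonsing_inv _ hu, Matrix.one_mul, neg_add_cancel,
      Matrix.zero_mul])
  rw [U_solY, solY_zero, norm_unitCol] at h1
  rw [← mul_unitCol_apply (L.weylMatrix ρ)]
  refine (norm_apply_le_l2_opNorm _ _ _).trans ?_
  rw [le_div_iff₀ hpos]; linarith

end MatrixPencil

/-! ### Poles of the Weyl matrix -/

namespace MatrixPencil

variable {m : ℕ} {L : MatrixPencil m}

theorem eventually_charFun_ne_zero (hII : L.ConditionII) (z : ℂ) :
    ∀ᶠ w in 𝓝[≠] z, L.charFun w ≠ 0 := by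
  have ha : AnalyticOnNhd ℂ L.charFun univ := fun w _ => L.differentiable_charFun.analyticAt w
  refine (ha z (mem_univ z)).eventually_eq_zero_or_eventually_ne_zero.resolve_left fun h => ?_
  obtain ⟨R, hR, hbd⟩ := exists_weylMatrix_bound hII
  have h1 := ha.eqOn_zero_of_preconnected_of_eventuallyEq_zero isPreconnected_univ (mem_univ z) h
    (mem_univ ((R : ℂ) + Complex.I))
  exact (hbd ((R : ℂ) + Complex.I) (by simp [abs_of_pos (one_pos.trans_le hR)]) (by simp)
    (by simp)).1 h1

variable (L) in
theorem weylMatrix_apply_eq {w : ℂ} (hw : L.charFun w ≠ 0) (j k : Fin m) : L.weylMatrix w j k =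
    -((L.charMatrix w).adjugate * L.matrixVS w) j k / L.charFun w := by
  rw [L.weylMatrix_eq hw, Matrix.inv_def, Matrix.smul_mul, Matrix.neg_apply, Matrix.smul_apply,
    ← L.charFun_eq, Ring.inverse_eq_inv', smul_eq_mul]
  field_simp

variable (L) in
theorem differentiable_adjugate_mul_matrixVS (j k : Fin m) :
    Differentiable ℂ fun w => -((L.charMatrix w).adjugate * L.matrixVS w) j k := by
  have h1 : ∀ i, Differentiable ℂ fun w => (L.charMatrix w).adjugate j i := fun i => by
    simp only [Matrix.adjugate_apply, Matrix.det_apply']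
    refine Differentiable.fun_sum fun σ _ => (Differentiable.fun_finsetProd fun l _ => ?_).const_mul _
    by_cases hl : σ l = i
    · simp [Matrix.updateRow_apply, hl]
    · simpa [Matrix.updateRow_apply, hl] using L.differentiable_charMatrix (σ l) l
  simp only [Matrix.mul_apply]
  exact (Differentiable.fun_sum fun i _ => (h1 i).mul (L.differentiable_matrixVS i k)).fun_neg

variable (L) in
theorem differentiableAt_weylMatrix {z : ℂ} (hz : L.charFun z ≠ 0) (j k : Fin m) :
    DifferentiableAt ℂ (fun w => L.weylMatrix w j k) z := by
  have h1 : ∀ᶠ w in 𝓝 z, L.charFun w ≠ 0 :=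
    L.differentiable_charFun.continuous.continuousAt.eventually_ne hz
  refine DifferentiableAt.congr_of_eventuallyEq
    ((L.differentiable_adjugate_mul_matrixVS j k z).fun_div (L.differentiable_charFun z) hz) ?_
  filter_upwards [h1] with w hw using L.weylMatrix_apply_eq hw j k

theorem eventually_differentiableAt_weylMatrix (hII : L.ConditionII) (z : ℂ) (j k : Fin m) :
    ∀ᶠ w in 𝓝[≠] z, DifferentiableAt ℂ (fun w => L.weylMatrix w j k) w :=
  (eventually_charFun_ne_zero hII z).mono fun _ hw => L.differentiableAt_weylMatrix hw j k

theorem meromorphicAt_weylMatrix (hII : L.ConditionII) (z : ℂ) (j k : Fin m) :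
    MeromorphicAt (fun w => L.weylMatrix w j k) z := by
  have h1 := ((L.differentiable_adjugate_mul_matrixVS j k).analyticAt z).meromorphicAt
  have h2 := (L.differentiable_charFun.analyticAt z).meromorphicAt
  refine (h1.fun_div h2).congr ?_
  filter_upwards [eventually_charFun_ne_zero hII z] with w hw using
    (L.weylMatrix_apply_eq hw j k).symm

/-- If the Weyl matrix stayed bounded at an eigenvalue, then so would the inverse of the
characteristic matrix, which is an entire combination of it. -/
theorem hasMatrixPole_weylMatrix_iff (hII : L.ConditionII) (z : ℂ) :
    HasMatrixPole L.weylMatrix z ↔ L.charFun z = 0 := by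
  constructor
  · rintro ⟨-, j, k, hjk⟩
    by_contra hz
    have h1 : AnalyticAt ℂ (fun w => L.weylMatrix w j k) z := by
      rw [Complex.analyticAt_iff_eventually_differentiableAt]
      filter_upwards [L.differentiable_charFun.continuous.continuousAt.eventually_ne hz] with w hw
        using L.differentiableAt_weylMatrix hw j k
    exact absurd h1.meromorphicOrderAt_nonneg (not_le.2 hjk)
  · intro hz
    refine ⟨meromorphicAt_weylMatrix hII z, ?_⟩
    by_contra! hcon
    choose M₀ hM₀ using fun j k =>
      tendsto_nhds_of_meromorphicOrderAt_nonneg (meromorphicAt_weylMatrix hII z j k) (hcon j k)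
    have hB := fun j k => (L.differentiable_bezout j k).continuous.continuousAt (x := z)
    have h1 : ∀ j k, Tendsto (fun w => ((L.bezout w).toRows₁ -
        L.weylMatrix w * (L.bezout w).toRows₂) j k) (𝓝[≠] z)
        (𝓝 (((L.bezout z).toRows₁ - Matrix.of M₀ * (L.bezout z).toRows₂) j k)) := fun j k => by
      simp only [Matrix.sub_apply, Matrix.mul_apply]
      refine ((hB (Sum.inl j) k).tendsto.mono_left nhdsWithin_le_nhds).sub
        (tendsto_finsetSum _ fun i _ => (hM₀ j i).mul ?_)
      exact (hB (Sum.inr i) k).tendsto.mono_left nhdsWithin_le_nhds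
    have h2 : L.charMatrix z * ((L.bezout z).toRows₁ - Matrix.of M₀ * (L.bezout z).toRows₂) = 1 := by
      ext j k
      refine tendsto_nhds_unique (tendsto_matrix_mul_apply (l := 𝓝[≠] z)
        (Δ := L.charMatrix) (fun j k => (L.differentiable_charMatrix j k).continuous.continuousAt.continuousWithinAt)
        h1 j k)
        (tendsto_const_nhds.congr' ?_)
      filter_upwards [eventually_charFun_ne_zero hII z] with w hw
      rw [← L.inv_charMatrix_eq hw, Matrix.mul_nonsing_inv _ (by
        rw [← charFun_eq]; exact hw.isUnit)]
    have h3 := congrArg Matrix.det h2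
    rw [Matrix.det_mul, ← L.charFun_eq, hz, zero_mul, Matrix.det_one] at h3
    exact zero_ne_one h3

/-- At a pole that is at most simple, the weight matrix is the limit of `(w - z) M(w)`. -/
theorem tendsto_sub_mul_weylMatrix (hII : L.ConditionII) {z : ℂ}
    (hz : ∀ j k, -1 ≤ meromorphicOrderAt (fun w => L.weylMatrix w j k) z) (j k : Fin m) :
    Tendsto (fun w => (w - z) * L.weylMatrix w j k) (𝓝[≠] z) (𝓝 (L.weightMatrix z j k)) := by
  have h1 : MeromorphicAt (fun w : ℂ => w - z) z := by fun_prop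
  have h2 : 0 ≤ meromorphicOrderAt (fun w => (w - z) * L.weylMatrix w j k) z := by
    rw [fun_meromorphicOrderAt_mul h1 (meromorphicAt_weylMatrix hII z j k),
      meromorphicOrderAt_id_sub_const]
    have h3 := add_le_add_right (hz j k) 1
    simpa [add_comm] using h3
  obtain ⟨a, ha⟩ := tendsto_nhds_of_meromorphicOrderAt_nonneg
    (h1.fun_mul (meromorphicAt_weylMatrix hII z j k)) h2
  have h3 : L.weightMatrix z j k = a :=
    residueAt_eq (eventually_differentiableAt_weylMatrix hII z j k) ha
  rwa [h3]

/-- The residue of the inverse of the characteristic matrix and the weight matrix are multiples of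
each other, so that they have the same rank. -/
theorem rank_weightMatrix (hII : L.ConditionII) {z : ℂ}
    (hz : ∀ j k, -1 ≤ meromorphicOrderAt (fun w => L.weylMatrix w j k) z) :
    (L.weightMatrix z).rank = L.multiplicity z := by
  have hlim := tendsto_sub_mul_weylMatrix hII hz
  -- the continuous extension of `(w - z) M(w)`
  set G : ℂ → Matrix (Fin m) (Fin m) ℂ := fun w => Matrix.of fun j k =>
    Function.update (fun w => (w - z) * L.weylMatrix w j k) z (L.weightMatrix z j k) w with hG
  have hGz : G z = L.weightMatrix z := by ext j k; simp [hG]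
  have hGw : ∀ w, w ≠ z → G w = (w - z) • L.weylMatrix w := fun w hw => by
    ext j k; simp [hG, Function.update_of_ne hw]
  have hGd : ∀ j k, DifferentiableAt ℂ (fun w => G w j k) z := fun j k => by
    refine differentiable_update_of_tendsto ?_ (hlim j k)
    filter_upwards [eventually_differentiableAt_weylMatrix hII z j k] with w hw
    exact (differentiableAt_id.sub_const z).mul hw
  set D : ℂ → Matrix (Fin m) (Fin m) ℂ := fun w =>
    (w - z) • (L.bezout w).toRows₁ - G w * (L.bezout w).toRows₂ with hD
  have hDw : ∀ w, w ≠ z → L.charFun w ≠ 0 → D w = (w - z) • (L.charMatrix w)⁻¹ := by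
    intro w hw h0
    simp only [hD]
    rw [hGw w hw, L.inv_charMatrix_eq h0, Matrix.smul_mul, smul_sub]
  have hDd : ∀ j k, DifferentiableAt ℂ (fun w => D w j k) z := fun j k => by
    simp only [hD, Matrix.sub_apply, Matrix.smul_apply, Matrix.mul_apply, smul_eq_mul]
    refine ((differentiableAt_id.sub_const z).fun_mul (L.differentiable_bezout (Sum.inl j) k z)).fun_sub
      (DifferentiableAt.fun_sum fun i _ => (hGd j i).fun_mul (L.differentiable_bezout (Sum.inr i) k z))
  have hne := eventually_charFun_ne_zero hII z
  have hmult : L.multiplicity z = (D z).rank := by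
    have h1 := analyticOrderNatAt_det_eq_rank L.differentiable_charMatrix hDd (by
      filter_upwards [hne, self_mem_nhdsWithin] with w h0 hw
      rw [hDw w hw h0, Matrix.mul_smul, Matrix.mul_nonsing_inv _ (by
        rw [← charFun_eq]; exact h0.isUnit)])
    rw [← h1, multiplicity]
    congr 1
    funext w; exact L.charFun_eq w
  have h1 : D z = L.weightMatrix z * -(L.bezout z).toRows₂ := by
    simp only [hD]; rw [hGz, sub_self, zero_smul, zero_sub, Matrix.mul_neg]
  have h2 : L.weightMatrix z = D z * -L.matrixVS z := by
    ext j k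
    refine tendsto_nhds_unique (hlim j k) (Tendsto.congr' ?_ (tendsto_matrix_mul_apply
      (l := 𝓝[≠] z) (Δ := D) (D := fun w => -L.matrixVS w) (D₀ := -L.matrixVS z)
      (fun j k => (hDd j k).continuousAt.continuousWithinAt) (fun j k =>
        (L.differentiable_matrixVS j k).fun_neg.continuous.continuousAt.continuousWithinAt) j k))
    filter_upwards [hne, self_mem_nhdsWithin] with w h0 hw
    rw [hDw w hw h0, L.weylMatrix_eq h0, Matrix.smul_mul, Matrix.smul_apply, Matrix.mul_neg,
      smul_eq_mul]
  rw [hmult]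
  refine le_antisymm ?_ ?_
  · rw [h2]; exact Matrix.rank_mul_le_left _ _
  · rw [h1]; exact Matrix.rank_mul_le_left _ _

/-- Large poles near the real axis are real and simple, because the Weyl matrix grows there at most
like the inverse distance to the real axis. -/
theorem exists_real_simple (hII : L.ConditionII) : ∃ R : ℝ, 1 ≤ R ∧ ∀ z : ℂ, R ≤ |z.re| →
    |z.im| ≤ 1 → L.charFun z = 0 → z.im = 0 ∧
      ∀ j k, -1 ≤ meromorphicOrderAt (fun w => L.weylMatrix w j k) z := by
  obtain ⟨R, hR, h⟩ := exists_weylMatrix_bound hII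
  refine ⟨R, hR, fun z hre him hz => ?_⟩
  have h0 : z.im = 0 := by
    by_contra h0
    exact (h z hre him h0).1 hz
  refine ⟨h0, fun j k => ?_⟩
  have h1 : MeromorphicAt (fun w : ℂ => w - z) z := by fun_prop
  have h2 : 0 ≤ meromorphicOrderAt (fun w => (w - z) * L.weylMatrix w j k) z := by
    by_contra hcon
    have h3 := tendsto_cobounded_of_meromorphicOrderAt_neg (not_le.1 hcon)
    rw [← tendsto_norm_atTop_iff_cobounded] at h3
    -- approach `z` vertically, where `|w - z| = |Im w|` and hence `|(w - z) M(w)| ≤ 1`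
    have h4 : Tendsto (fun t : ℝ => z + t * Complex.I) (𝓝[>] 0) (𝓝[≠] z) := by
      refine tendsto_nhdsWithin_iff.2 ⟨?_, ?_⟩
      · have : Continuous fun t : ℝ => z + t * Complex.I := by fun_prop
        simpa using (this.tendsto 0).mono_left nhdsWithin_le_nhds
      · filter_upwards [self_mem_nhdsWithin] with t ht
        simpa using (ht : 0 < t).ne'
    have h5 := (h3.comp h4).eventually (eventually_gt_atTop 1)
    obtain ⟨t, h6, ht⟩ := (h5.and (Ioo_mem_nhdsGT one_pos)).exists
    have h7 := (h (z + t * Complex.I) (by simpa using hre) (by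
      simp [h0, abs_of_pos ht.1, ht.2.le]) (by simpa [h0] using ht.1.ne')).2 j k
    simp only [Complex.add_im, h0, Complex.mul_im, Complex.ofReal_re, Complex.I_im, mul_one,
      Complex.ofReal_im, Complex.I_re, mul_zero, add_zero, zero_add, abs_of_pos ht.1] at h7
    simp only [Function.comp_apply, add_sub_cancel_left, norm_mul, Complex.norm_real,
      Complex.norm_I, mul_one, Real.norm_eq_abs, abs_of_pos ht.1] at h6
    rw [le_div_iff₀ ht.1] at h7
    linarith
  rw [fun_meromorphicOrderAt_mul h1 (meromorphicAt_weylMatrix hII z j k),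
    meromorphicOrderAt_id_sub_const] at h2
  generalize meromorphicOrderAt (fun w => L.weylMatrix w j k) z = o at h2
  cases o with
  | top => exact le_top
  | coe o =>
    have h3 : (0 : ℤ) ≤ 1 + o := by exact_mod_cast h2
    have h4 : (-1 : ℤ) ≤ o := by linarith
    exact WithTop.coe_le_coe.2 h4

end MatrixPencil

/-! ### Asymptotics of the Weyl matrix on small circles about the nodes -/

/-- The function `2 e^{2πia} / (e^{2πiw} - e^{2πia})`, with simple poles at the points of `a + ℤ`. -/
def expKernel (a : ℝ) (w : ℂ) : ℂ := 2 * Complex.exp (2 * π * Complex.I * a) /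
  (Complex.exp (2 * π * Complex.I * w) - Complex.exp (2 * π * Complex.I * a))

theorem differentiableAt_expKernel {a : ℝ} {w : ℂ}
    (h : Complex.exp (2 * π * Complex.I * w) ≠ Complex.exp (2 * π * Complex.I * a)) :
    DifferentiableAt ℂ (expKernel a) w := by
  unfold expKernel
  exact DifferentiableAt.fun_div (by fun_prop) (by fun_prop) (sub_ne_zero.2 h)

theorem tendsto_sub_mul_expKernel {a : ℝ} {c : ℂ}
    (h : Complex.exp (2 * π * Complex.I * c) = Complex.exp (2 * π * Complex.I * a)) :
    Tendsto (fun w => (w - c) * expKernel a w) (𝓝[≠] c) (𝓝 (π * Complex.I)⁻¹) := by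
  have h1 : HasDerivAt (fun w : ℂ => Complex.exp (2 * π * Complex.I * w))
      (Complex.exp (2 * π * Complex.I * c) * (2 * π * Complex.I)) c := by
    simpa using ((hasDerivAt_id c).const_mul (2 * π * Complex.I)).cexp
  have h0 := Complex.exp_ne_zero (2 * π * Complex.I * a)
  have h2 := ((hasDerivAt_iff_tendsto_slope.1 h1).inv₀ (mul_ne_zero (Complex.exp_ne_zero _)
    Complex.two_pi_I_ne_zero)).const_mul (2 * Complex.exp (2 * π * Complex.I * a))
  have h3 : 2 * Complex.exp (2 * π * Complex.I * a) *
      (Complex.exp (2 * π * Complex.I * c) * (2 * π * Complex.I))⁻¹ = (π * Complex.I)⁻¹ := by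
    rw [h]
    have : (π : ℂ) ≠ 0 := Complex.ofReal_ne_zero.2 Real.pi_ne_zero
    have := Complex.I_ne_zero
    field_simp
  rw [h3] at h2
  refine h2.congr fun w => ?_
  rw [slope_def_field, h, expKernel, inv_div]
  ring

theorem mul_diagonal_mul_apply {m : ℕ} (P S : Matrix (Fin m) (Fin m) ℂ) (d : Fin m → ℂ)
    (j k : Fin m) : (P * Matrix.diagonal d * S) j k = ∑ s, P j s * d s * S s k := by
  rw [Matrix.mul_apply]
  exact Finset.sum_congr rfl fun s _ => by rw [Matrix.mul_diagonal]

namespace MatrixPencil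

variable {m : ℕ} {L : MatrixPencil m} {ω : Fin m → ℝ} {W : Matrix (Fin m) (Fin m) ℂ}

/-- The leading part of `-iρ M(ρ)`. -/
def weylMain (L : MatrixPencil m) (ω : Fin m → ℝ) (W : Matrix (Fin m) (Fin m) ℂ) (ρ : ℂ) :
    Matrix (Fin m) (Fin m) ℂ :=
  (1 - L.h₁)⁻¹ + (1 - L.h₁)⁻¹ * Wᴴ * Matrix.diagonal (fun s => expKernel (ω s) ρ) *
    (W * (1 + L.h₁)⁻¹)

/-- The leading part of `V(S)`, written through `e^{2πiρ} - A`, so that multiplication by the inverse of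
`mainDelta` leaves a constant and a resolvent term. -/
theorem mainS_eq_mul (hI : L.ConditionI) (hII : L.ConditionII) (ρ : ℂ) :
    L.mainS ρ = Complex.exp (-(Complex.I * ρ * π)) • (L.leftFactor *
      ((Complex.exp (2 * π * Complex.I * ρ) • 1 - L.monodromy) +
        (2 : ℂ) • (L.monodromy * (1 + L.h₁)⁻¹))) := by
  have e1 : (1 + L.h₁) * (1 + L.h₁)⁻¹ = 1 := Matrix.mul_nonsing_inv _ (isUnit_iff_ne_zero.2 hI.1)
  have e2 : (1 - L.H₁) * L.Pp π = L.leftFactor * L.monodromy * (1 - L.h₁) * (1 + L.h₁)⁻¹ := by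
    rw [leftFactor_mul_monodromy hI hII, Matrix.mul_assoc, Matrix.mul_assoc (L.Pp π), e1,
      Matrix.mul_one]
  have e3 : (1 - L.h₁) * (1 + L.h₁)⁻¹ = (2 : ℂ) • (1 + L.h₁)⁻¹ - 1 := by
    have e4 : 1 - L.h₁ = (2 : ℂ) • 1 - (1 + L.h₁) := by module
    rw [e4, Matrix.sub_mul, e1, Matrix.smul_mul, Matrix.one_mul]
  rw [mainS, e2, ← exp_two_pi_eq, Matrix.mul_assoc (L.leftFactor * L.monodromy), e3, leftFactor]
  simp only [Matrix.mul_add, Matrix.mul_sub, Matrix.mul_smul, Matrix.mul_one, Matrix.mul_assoc]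
  module

theorem mainInv_mul_mainS (hI : L.ConditionI) (hII : L.ConditionII)
    (hW : W ∈ Matrix.unitaryGroup (Fin m) ℂ)
    (hA : L.monodromy = Wᴴ * Matrix.diagonal (fun q => Complex.exp (2 * π * Complex.I * ω q)) * W)
    {ρ : ℂ} (hρ : ∀ q, Complex.exp (2 * π * Complex.I * ρ) ≠ Complex.exp (2 * π * Complex.I * ω q)) :
    L.mainInv ω W ρ * L.mainS ρ = L.weylMain ω W ρ := by
  have e1 : L.leftFactor⁻¹ * L.leftFactor = 1 :=
    Matrix.nonsing_inv_mul _ (isUnit_iff_ne_zero.2 (det_leftFactor_ne_zero hI hII))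
  have e2 := mul_eq_one_comm.1 (sub_mul_unitaryResolvent hW hA hρ)
  have e3 : unitaryResolvent ω W (Complex.exp (2 * π * Complex.I * ρ)) * ((2 : ℂ) • L.monodromy) =
      Wᴴ * Matrix.diagonal (fun s => expKernel (ω s) ρ) * W := by
    have hW2 : W * Wᴴ = 1 := Matrix.mem_unitaryGroup_iff.1 hW
    rw [unitaryResolvent, hA, ← Matrix.smul_mul, ← Matrix.mul_smul]
    calc _ = Wᴴ * (Matrix.diagonal (fun q => (Complex.exp (2 * π * Complex.I * ρ) -
          Complex.exp (2 * π * Complex.I * ω q))⁻¹) * (W * Wᴴ) *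
          ((2 : ℂ) • Matrix.diagonal fun q => Complex.exp (2 * π * Complex.I * ω q))) * W := by
          simp only [Matrix.mul_assoc]
      _ = _ := by
          rw [hW2, Matrix.mul_one, ← Matrix.diagonal_smul, Matrix.diagonal_mul_diagonal]
          congr 3; funext s
          simp only [Pi.smul_apply, smul_eq_mul, expKernel]
          ring
  rw [mainInv, mainS_eq_mul hI hII, Matrix.smul_mul, Matrix.mul_smul, smul_smul, ← Complex.exp_add,
    add_neg_cancel, Complex.exp_zero, one_smul]
  set K := Complex.exp (2 * π * Complex.I * ρ) • (1 : Matrix (Fin m) (Fin m) ℂ) - L.monodromy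
  set G := unitaryResolvent ω W (Complex.exp (2 * π * Complex.I * ρ))
  calc (1 - L.h₁)⁻¹ * G * L.leftFactor⁻¹ * (L.leftFactor * (K +
        (2 : ℂ) • (L.monodromy * (1 + L.h₁)⁻¹)))
      = (1 - L.h₁)⁻¹ * (G * (L.leftFactor⁻¹ * L.leftFactor) * (K +
        (2 : ℂ) • (L.monodromy * (1 + L.h₁)⁻¹))) := by simp only [Matrix.mul_assoc]
    _ = (1 - L.h₁)⁻¹ * (G * K + G * ((2 : ℂ) • L.monodromy) * (1 + L.h₁)⁻¹) := by
        rw [e1, Matrix.mul_one, Matrix.mul_add, ← Matrix.smul_mul, Matrix.mul_assoc G]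
    _ = _ := by
        rw [e2, e3, weylMain, Matrix.mul_add, Matrix.mul_one]
        simp only [Matrix.mul_assoc]

/-- The asymptotics of the Weyl matrix at a fixed distance from the nodes. There the leading part is
bounded, because the exponential growth of `V(S)` cancels that of `V(φ)`. -/
theorem exists_weylMatrix_asymptotics (hI : L.ConditionI) (hII : L.ConditionII)
    (hW : W ∈ Matrix.unitaryGroup (Fin m) ℂ)
    (hA : L.monodromy = Wᴴ * Matrix.diagonal (fun q => Complex.exp (2 * π * Complex.I * ω q)) * W)
    {η : ℝ} (hη : 0 < η) (hη2 : η ≤ 1 / 2) : ∃ C R : ℝ, 0 < C ∧ 1 ≤ R ∧ ∀ ρ : ℂ, R ≤ ‖ρ‖ →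
      (∀ x ∈ nodes ω, η ≤ ‖ρ - x‖) →
      (∀ q, Complex.exp (2 * π * Complex.I * ρ) ≠ Complex.exp (2 * π * Complex.I * ω q)) ∧
      L.charFun ρ ≠ 0 ∧ ‖L.weylMain ω W ρ‖ ≤ C ∧
      ‖L.weylMatrix ρ + (Complex.I * ρ)⁻¹ • L.weylMain ω W ρ‖ ≤ C / ‖ρ‖ ^ 2 := by
  obtain ⟨C, R, hC, hR, hfac⟩ := exists_charMatrix_factor hI hII hW hA
  obtain ⟨C', R', hC', hR', hasy⟩ := exists_char_asymptotics (L := L) hII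
  obtain ⟨s, hs⟩ : ∃ s, s = ‖(1 + L.H₁) * L.Pm π‖ + ‖(1 - L.H₁) * L.Pp π‖ := ⟨_, rfl⟩
  have hs0 : 0 ≤ s := by rw [hs]; positivity
  obtain ⟨B, hB⟩ : ∃ B, B = C / η := ⟨_, rfl⟩
  have hB0 : 0 < B := by rw [hB]; positivity
  refine ⟨B * s + B * (2 * C') + 2 * B * (B * (s + 2 * C')) , max (max R R') (2 * B), by positivity,
    hR.trans ((le_max_left _ _).trans (le_max_left _ _)), fun ρ hρ hnode => ?_⟩
  have h1 : R ≤ ‖ρ‖ := ((le_max_left _ _).trans (le_max_left _ _)).trans hρ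
  have h2 : R' ≤ ‖ρ‖ := ((le_max_right _ _).trans (le_max_left _ _)).trans hρ
  have h3 : 2 * B ≤ ‖ρ‖ := (le_max_right _ _).trans hρ
  have hρ1 : 1 ≤ ‖ρ‖ := hR.trans h1
  have hρ0 : 0 < ‖ρ‖ := one_pos.trans_le hρ1
  have hρne : Complex.I * ρ ≠ 0 := mul_ne_zero Complex.I_ne_zero (norm_pos_iff.1 hρ0)
  obtain ⟨hne, hinv, Q, hQ, hchar⟩ := hfac ρ η h1 hη hη2 hnode
  obtain ⟨E, hE⟩ : ∃ E, E = Real.exp (|ρ.im| * π) := ⟨_, rfl⟩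
  have hE0 : 0 < E := hE ▸ Real.exp_pos _
  have hVS := (hasy ρ h2).2
  rw [← hE] at hinv hVS
  have hinv' : ‖L.mainInv ω W ρ‖ ≤ B / E := hinv.trans_eq (by rw [hB, div_div])
  have hQ' : ‖Q‖ ≤ B / ‖ρ‖ := hQ.trans_eq (by rw [hB, div_div])
  have hQ2 : ‖Q‖ ≤ 1 / 2 := hQ'.trans (by rw [div_le_div_iff₀ hρ0 two_pos]; linarith)
  obtain ⟨hu, hQinv⟩ := norm_nonsing_inv_one_sub_le hQ2
  have hQQ : (1 - Q) * (1 - Q)⁻¹ = 1 :=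
    Matrix.mul_nonsing_inv _ ((Matrix.isUnit_iff_isUnit_det _).1 hu)
  have hQQ' : (1 - Q)⁻¹ * (1 - Q) = 1 :=
    Matrix.nonsing_inv_mul _ ((Matrix.isUnit_iff_isUnit_det _).1 hu)
  have hDI := mainDelta_mul_mainInv hI hII hW hA hne
  have hright : L.charMatrix ρ * ((2 / (Complex.I * ρ)) • ((1 - Q)⁻¹ * L.mainInv ω W ρ)) = 1 := by
    rw [hchar, Matrix.smul_mul, Matrix.mul_smul, smul_smul, div_mul_div_cancel₀ two_ne_zero,
      div_self hρne, one_smul, Matrix.mul_assoc, ← Matrix.mul_assoc (1 - Q), hQQ, Matrix.one_mul,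
      hDI]
  have hcf : L.charFun ρ ≠ 0 := fun h0 => by
    have := congrArg Matrix.det hright
    rw [Matrix.det_mul, ← L.charFun_eq, h0, zero_mul, Matrix.det_one] at this
    exact zero_ne_one this
  have hS : ‖L.mainS ρ‖ ≤ s * E := by
    obtain ⟨g1, g2⟩ := norm_cexp_mul_I_le ρ Real.pi_pos.le
    rw [← hE] at g1 g2
    rw [mainS, hs, add_mul ‖(1 + L.H₁) * L.Pm π‖]
    refine (norm_add_le _ _).trans (add_le_add ?_ ?_)
    · rw [norm_smul, mul_comm]; exact mul_le_mul_of_nonneg_left g1 (norm_nonneg _)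
    · rw [norm_smul, mul_comm]; exact mul_le_mul_of_nonneg_left g2 (norm_nonneg _)
  -- `Q` is the relative error of the leading part of `V(φ)`, and `T` the error of that of `2 V(S)`
  obtain ⟨T, hT⟩ : ∃ T, T = (2 : ℂ) • L.matrixVS ρ - L.mainS ρ := ⟨_, rfl⟩
  have hTn : ‖T‖ ≤ 2 * C' / ‖ρ‖ * E := by
    have : T = (2 : ℂ) • (L.matrixVS ρ - (2⁻¹ : ℂ) • L.mainS ρ) := by
      rw [hT, smul_sub, smul_smul, mul_inv_cancel₀ two_ne_zero, one_smul]
    rw [this, norm_smul, Complex.norm_ofNat]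
    calc 2 * ‖L.matrixVS ρ - (2⁻¹ : ℂ) • L.mainS ρ‖ ≤ 2 * (C' / ‖ρ‖ * E) := by linarith
      _ = _ := by ring
  have hTn' : ‖T‖ ≤ 2 * C' * E := hTn.trans
    (mul_le_mul_of_nonneg_right (div_le_self (by positivity) hρ1) hE0.le)
  have hmain := mainInv_mul_mainS hI hII hW hA hne
  refine ⟨hne, hcf, ?_, ?_⟩
  · rw [← hmain]
    calc ‖L.mainInv ω W ρ * L.mainS ρ‖ ≤ B / E * (s * E) :=
        (norm_mul_le _ _).trans (mul_le_mul hinv' hS (norm_nonneg _) (by positivity))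
      _ = B * s := by field_simp
      _ ≤ _ := by
        have : 0 ≤ B * (2 * C') + 2 * B * (B * (s + 2 * C')) := by positivity
        linarith
  have hdiff : L.weylMatrix ρ + (Complex.I * ρ)⁻¹ • L.weylMain ω W ρ = -((Complex.I * ρ)⁻¹ •
      (L.mainInv ω W ρ * T + (1 - Q)⁻¹ * Q * (L.mainInv ω W ρ * (L.mainS ρ + T)))) := by
    have e1 : (1 - Q)⁻¹ * Q = (1 - Q)⁻¹ - 1 := by
      have := hQQ'
      rw [Matrix.mul_sub, Matrix.mul_one] at this
      exact eq_sub_iff_add_eq'.2 (sub_eq_iff_eq_add.1 this).symm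
    have e2 : (2 : ℂ) • L.matrixVS ρ = L.mainS ρ + T := by rw [hT]; abel
    rw [L.weylMatrix_eq hcf, Matrix.inv_eq_right_inv hright, ← hmain, e1, ← e2, Matrix.sub_mul,
      Matrix.one_mul, hT, div_eq_mul_inv, mul_comm (2 : ℂ)]
    simp only [Matrix.mul_sub, Matrix.mul_smul, Matrix.smul_mul, Matrix.mul_assoc]
    module
  rw [hdiff, norm_neg, norm_smul, norm_inv, norm_mul, Complex.norm_I, one_mul]
  have k1 : ‖L.mainInv ω W ρ * T‖ ≤ B * (2 * C') / ‖ρ‖ := by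
    calc ‖L.mainInv ω W ρ * T‖ ≤ B / E * (2 * C' / ‖ρ‖ * E) :=
        (norm_mul_le _ _).trans (mul_le_mul hinv' hTn (norm_nonneg _) (by positivity))
      _ = _ := by field_simp
  have k2 : ‖L.mainInv ω W ρ * (L.mainS ρ + T)‖ ≤ B * (s + 2 * C') := by
    calc ‖L.mainInv ω W ρ * (L.mainS ρ + T)‖ ≤ B / E * (s * E + 2 * C' * E) :=
        (norm_mul_le _ _).trans (mul_le_mul hinv' ((norm_add_le _ _).trans (add_le_add hS hTn'))
          (norm_nonneg _) (by positivity))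
      _ = _ := by field_simp
  have k3 : ‖(1 - Q)⁻¹ * Q * (L.mainInv ω W ρ * (L.mainS ρ + T))‖ ≤
      2 * (B / ‖ρ‖) * (B * (s + 2 * C')) :=
    (norm_mul_le _ _).trans (mul_le_mul ((norm_mul_le _ _).trans
      (mul_le_mul hQinv hQ' (norm_nonneg _) zero_le_two)) k2 (norm_nonneg _) (by positivity))
  calc ‖ρ‖⁻¹ * ‖L.mainInv ω W ρ * T + (1 - Q)⁻¹ * Q * (L.mainInv ω W ρ * (L.mainS ρ + T))‖
      ≤ ‖ρ‖⁻¹ * (B * (2 * C') / ‖ρ‖ + 2 * (B / ‖ρ‖) * (B * (s + 2 * C'))) :=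
        mul_le_mul_of_nonneg_left ((norm_add_le _ _).trans (add_le_add k1 k3)) (by positivity)
    _ = (B * (2 * C') + 2 * B * (B * (s + 2 * C'))) / ‖ρ‖ ^ 2 := by field_simp
    _ ≤ _ := div_le_div_of_nonneg_right (by nlinarith) (by positivity)

/-- The integral of the leading part about a node only sees the poles belonging to that node. -/
theorem circleIntegral_weylMain {η : ℝ} (hη : 0 < η)
    (hgap : ∀ x ∈ nodes ω, ∀ y ∈ nodes ω, x = y ∨ 4 * η ≤ |x - y|)
    (n : ℤ) (hω : ∀ q, ω q ∈ Ico (0 : ℝ) 1) (q j k : Fin m) :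
    ∮ w in C((n : ℂ) + ω q, η), L.weylMain ω W w j k =
      2 * ((1 - L.h₁)⁻¹ * Wᴴ * groupProjection ω q * W * (1 + L.h₁)⁻¹) j k := by
  set c : ℂ := (n : ℂ) + ω q with hc
  set P := (1 - L.h₁)⁻¹ * Wᴴ with hP
  set S := W * (1 + L.h₁)⁻¹ with hS
  have hexpc : ∀ s, Complex.exp (2 * π * Complex.I * c) = Complex.exp (2 * π * Complex.I * ω s) ↔
      ω s = ω q := by
    intro s
    rw [exp_two_pi_mul_eq_iff]
    constructor
    · rintro ⟨l, hl⟩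
      have h1 : (l : ℝ) + ω s = n + ω q := by
        have : (((l : ℝ) + ω s : ℝ) : ℂ) = ((n + ω q : ℝ) : ℂ) := by push_cast; rw [hl, hc]
        exact Complex.ofReal_injective this
      have h2 := hω s
      have h3 := hω q
      have h4 : l = n := by
        have a1 : (l : ℝ) < n + 1 := by linarith [h2.1, h3.2]
        have a2 : (n : ℝ) < l + 1 := by linarith [h2.2, h3.1]
        have a3 : l < n + 1 := by exact_mod_cast a1
        have a4 : n < l + 1 := by exact_mod_cast a2
        omega
      subst h4; linarith
    · intro h; exact ⟨n, by rw [h, hc]⟩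
  have hentry : ∀ w, L.weylMain ω W w j k =
      ((1 - L.h₁)⁻¹) j k + ∑ s, P j s * expKernel (ω s) w * S s k := fun w => by
    rw [weylMain, Matrix.add_apply, ← mul_diagonal_mul_apply]
  have hd : ∀ w ∈ Metric.closedBall c η, w ∉ ({c} : Finset ℂ) →
      DifferentiableAt ℂ (fun w => L.weylMain ω W w j k) w := by
    intro w hw hwc
    simp only [hentry]
    refine (DifferentiableAt.fun_sum fun s _ => ?_).const_add _
    refine ((differentiableAt_expKernel fun h => hwc ?_).const_mul _).mul_const _
    obtain ⟨l, hl⟩ := (exp_two_pi_mul_eq_iff w (ω s)).1 h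
    have h1 : ‖(((l : ℝ) + ω s - (n + ω q) : ℝ) : ℂ)‖ ≤ η := by
      have := mem_closedBall_iff_norm.1 hw
      rw [← hl, hc] at this
      push_cast; exact this
    rw [Complex.norm_real, Real.norm_eq_abs] at h1
    rcases hgap _ ⟨l, s, rfl⟩ _ ⟨n, q, rfl⟩ with h2 | h2
    · rw [Finset.mem_singleton, ← hl, hc]
      exact_mod_cast congrArg Complex.ofReal h2
    · linarith
  have hlim : Tendsto (fun w => (w - c) * L.weylMain ω W w j k) (𝓝[≠] c)
      (𝓝 (∑ s, P j s * (if ω s = ω q then (π * Complex.I)⁻¹ else 0) * S s k)) := by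
    have hsub : Tendsto (fun w => w - c) (𝓝[≠] c) (𝓝 0) := by
      have : Continuous fun w : ℂ => w - c := by fun_prop
      simpa using (this.tendsto c).mono_left nhdsWithin_le_nhds
    have h1 : ∀ s, Tendsto (fun w => (w - c) * expKernel (ω s) w) (𝓝[≠] c)
        (𝓝 (if ω s = ω q then (π * Complex.I)⁻¹ else 0)) := by
      intro s
      split_ifs with h
      · exact tendsto_sub_mul_expKernel ((hexpc s).2 h)
      · have := (differentiableAt_expKernel fun h' => h ((hexpc s).1 h')).continuousAt
        simpa using hsub.mul (this.tendsto.mono_left nhdsWithin_le_nhds)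
    have h2 := (hsub.mul_const (((1 - L.h₁)⁻¹) j k)).add (tendsto_finsetSum Finset.univ fun s _ =>
      ((h1 s).const_mul (P j s)).mul_const (S s k))
    rw [zero_mul, zero_add] at h2
    refine h2.congr fun w => ?_
    rw [hentry, mul_add, Finset.mul_sum]
    congr 1
    exact Finset.sum_congr rfl fun s _ => by ring
  rw [circleIntegral_of_simple_poles {c} hη (fun _ => _) (by simpa using hη) hd (by simpa using hlim),
    Finset.sum_singleton, Matrix.mul_assoc _ W, ← hS, groupProjection, mul_diagonal_mul_apply,
    Finset.mul_sum, Finset.mul_sum]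
  refine Finset.sum_congr rfl fun s _ => ?_
  have hpi : (π : ℂ) ≠ 0 := Complex.ofReal_ne_zero.2 Real.pi_ne_zero
  have := Complex.I_ne_zero
  split_ifs
  · field_simp
    rw [Complex.I_sq]; ring
  · simp

/-- Integrating the asymptotics over a circle of fixed radius: on it `1 / ρ` differs from `1 / n` by
`O(1 / n²)`, so that only the residue of the leading part at the node contributes in first order. -/
theorem exists_circleIntegral_weylMatrix (hI : L.ConditionI) (hII : L.ConditionII)
    (hω : ∀ q, ω q ∈ Ico (0 : ℝ) 1) (hW : W ∈ Matrix.unitaryGroup (Fin m) ℂ)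
    (hA : L.monodromy = Wᴴ * Matrix.diagonal (fun q => Complex.exp (2 * π * Complex.I * ω q)) * W)
    {η : ℝ} (hη : 0 < η) (hη8 : η ≤ 1 / 8)
    (hgap : ∀ x ∈ nodes ω, ∀ y ∈ nodes ω, x = y ∨ 4 * η ≤ |x - y|) :
    ∃ (C : ℝ) (N : ℕ), 1 ≤ N ∧ ∀ n : ℤ, (N : ℤ) ≤ |n| → ∀ q,
      (∀ w ∈ Metric.sphere ((n : ℂ) + ω q) η, L.charFun w ≠ 0) ∧ ∀ j k,
      ‖(2 * π * Complex.I)⁻¹ * (∮ w in C((n : ℂ) + ω q, η), L.weylMatrix w j k) -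
        ((π * (n : ℂ))⁻¹ • ((1 - L.h₁)⁻¹ * Wᴴ * groupProjection ω q * W * (1 + L.h₁)⁻¹)) j k‖ ≤
          C / (n : ℝ) ^ 2 := by
  obtain ⟨C, R, hC, hR, hasy⟩ := exists_weylMatrix_asymptotics hI hII hW hA hη (by linarith)
  obtain ⟨N, hN⟩ := exists_nat_ge (R + 4)
  have hN1 : (1 : ℝ) ≤ N := by linarith
  refine ⟨8 * C, N, by exact_mod_cast hN1, fun n hn q => ?_⟩
  have hn' : (N : ℝ) ≤ |(n : ℝ)| := by exact_mod_cast hn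
  have hn0 : (n : ℝ) ≠ 0 := fun h => by rw [h, abs_zero] at hn'; linarith
  have hnC : (n : ℂ) ≠ 0 := by exact_mod_cast hn0
  have hnn : ‖(n : ℂ)‖ = |(n : ℝ)| := by rw [← Complex.ofReal_intCast, Complex.norm_real, Real.norm_eq_abs]
  have hc : ((n : ℂ) + ω q) = (((n : ℝ) + ω q : ℝ) : ℂ) := by push_cast; rfl
  have hsph : ∀ w ∈ Metric.sphere ((n : ℂ) + ω q) η, ‖w - n‖ ≤ 2 ∧ |(n : ℝ)| / 2 ≤ ‖w‖ ∧ R ≤ ‖w‖ := by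
    intro w hw
    have h1 : ‖w - (n + ω q)‖ = η := mem_sphere_iff_norm.1 hw
    have h2 : ‖(ω q : ℂ)‖ ≤ 1 := by
      rw [Complex.norm_real, Real.norm_eq_abs, abs_of_nonneg (hω q).1]; exact (hω q).2.le
    have h3 : ‖w - n‖ ≤ 2 := by
      calc ‖w - n‖ = ‖(w - (n + ω q)) + ω q‖ := by congr 1; ring
        _ ≤ η + 1 := (norm_add_le _ _).trans (add_le_add h1.le h2)
        _ ≤ 2 := by linarith
    have h4 := norm_sub_norm_le (n : ℂ) w
    rw [norm_sub_rev, hnn] at h4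
    exact ⟨h3, by linarith, by linarith⟩
  have hw := fun w hw => hasy w (hsph w hw).2.2
    (le_norm_sub_of_mem_sphere hη hgap ⟨n, q, rfl⟩ (by rw [← hc]; exact hw))
  refine ⟨fun w hw' => (hw w hw').2.1, fun j k => ?_⟩
  have hMi : CircleIntegrable (fun w => L.weylMatrix w j k) ((n : ℂ) + ω q) η :=
    ContinuousOn.circleIntegrable hη.le fun w hw' =>
      (L.differentiableAt_weylMatrix (hw w hw').2.1 j k).continuousAt.continuousWithinAt
  have hKi : CircleIntegrable (fun w => L.weylMain ω W w j k) ((n : ℂ) + ω q) η := by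
    refine ContinuousOn.circleIntegrable hη.le fun w hw' => ?_
    have h1 : DifferentiableAt ℂ (fun w => L.weylMain ω W w j k) w := by
      simp only [weylMain, Matrix.add_apply, mul_diagonal_mul_apply]
      exact (DifferentiableAt.fun_sum fun s _ =>
        ((differentiableAt_expKernel ((hw w hw').1 s)).const_mul _).mul_const _).const_add _
    exact h1.continuousAt.continuousWithinAt
  have hbd : ∀ w ∈ Metric.sphere ((n : ℂ) + ω q) η,
      ‖L.weylMatrix w j k + (Complex.I * n)⁻¹ * L.weylMain ω W w j k‖ ≤ 8 * C / (n : ℝ) ^ 2 := by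
    intro w hw'
    obtain ⟨-, -, h1, h2⟩ := hw w hw'
    obtain ⟨h3, h4, h5⟩ := hsph w hw'
    have hw0 : 0 < ‖w‖ := by linarith
    have hna : 0 < |(n : ℝ)| := abs_pos.2 hn0
    have e1 := (norm_apply_le_l2_opNorm _ j k).trans h2
    have e2 := (norm_apply_le_l2_opNorm _ j k).trans h1
    rw [Matrix.add_apply, Matrix.smul_apply, smul_eq_mul] at e1
    have e3 : ‖(Complex.I * n)⁻¹ - (Complex.I * w)⁻¹‖ ≤ 4 / (n : ℝ) ^ 2 := by
      have hwne := norm_pos_iff.1 hw0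
      have : (Complex.I * n)⁻¹ - (Complex.I * w)⁻¹ = Complex.I⁻¹ * ((w - n) / (n * w)) := by
        have := Complex.I_ne_zero
        field_simp
      rw [this, norm_mul, norm_inv, Complex.norm_I, inv_one, one_mul, norm_div, norm_mul, hnn,
        div_le_div_iff₀ (by positivity) (by positivity), ← sq_abs (n : ℝ)]
      nlinarith [mul_le_mul_of_nonneg_left h4 hna.le]
    have e4 : C / ‖w‖ ^ 2 ≤ 4 * C / (n : ℝ) ^ 2 := by
      rw [div_le_div_iff₀ (by positivity) (by positivity), ← sq_abs (n : ℝ)]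
      nlinarith [mul_le_mul h4 h4 (by positivity) hw0.le]
    calc ‖L.weylMatrix w j k + (Complex.I * n)⁻¹ * L.weylMain ω W w j k‖
        = ‖(L.weylMatrix w j k + (Complex.I * w)⁻¹ * L.weylMain ω W w j k) +
          ((Complex.I * n)⁻¹ - (Complex.I * w)⁻¹) * L.weylMain ω W w j k‖ := by congr 1; ring
      _ ≤ 4 * C / (n : ℝ) ^ 2 + 4 / (n : ℝ) ^ 2 * C := by
          refine (norm_add_le _ _).trans (add_le_add (e1.trans e4) ?_)
          rw [norm_mul]
          exact mul_le_mul e3 e2 (norm_nonneg _) (by positivity)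
      _ = _ := by ring
  have hint := circleIntegral.norm_two_pi_i_inv_smul_integral_le_of_norm_le_const hη.le hbd
  have hadd := circleIntegral.integral_add hMi (hKi.const_smul (a := (Complex.I * (n : ℂ))⁻¹))
  simp only [Pi.smul_apply, smul_eq_mul] at hadd
  rw [hadd,
    circleIntegral.integral_const_mul, circleIntegral_weylMain hη hgap n hω, smul_eq_mul, mul_add] at hint
  rw [Matrix.smul_apply, smul_eq_mul]
  set X := ((1 - L.h₁)⁻¹ * Wᴴ * groupProjection ω q * W * (1 + L.h₁)⁻¹) j k
  have hX : (2 * π * Complex.I)⁻¹ * ((Complex.I * (n : ℂ))⁻¹ * (2 * X)) = -((π * (n : ℂ))⁻¹ * X) := by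
    have hpi : (π : ℂ) ≠ 0 := Complex.ofReal_ne_zero.2 Real.pi_ne_zero
    have h1 := Complex.I_ne_zero
    field_simp
    rw [Complex.I_sq]; ring
  rw [hX, ← sub_eq_add_neg] at hint
  refine hint.trans (mul_le_of_le_one_left (by positivity) (by linarith))

end MatrixPencil

/-! ### Numberings of the eigenvalues -/

namespace MatrixPencil

variable {m : ℕ} {L : MatrixPencil m} {ω : Fin m → ℝ} {W : Matrix (Fin m) (Fin m) ℂ}

theorem analyticOrderAt_charFun_ne_top (hII : L.ConditionII) (z : ℂ) :
    analyticOrderAt L.charFun z ≠ ⊤ := fun h => by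
  have h1 := (analyticOrderAt_eq_top.1 h).filter_mono (nhdsWithin_le_nhds (s := {z}ᶜ))
  obtain ⟨w, h2, h3⟩ := (h1.and (eventually_charFun_ne_zero hII z)).exists
  exact h3 h2

variable (L) in
theorem analyticOrderAt_charFun_ne_zero_iff (z : ℂ) :
    analyticOrderAt L.charFun z ≠ 0 ↔ L.charFun z = 0 :=
  (L.differentiable_charFun.analyticAt z).analyticOrderAt_ne_zero

theorem IsNumbering.charFun_eq_zero {ρ : SignedIndex → Fin m → ℂ} (h : L.IsNumbering ω ρ)
    (n : SignedIndex) (q : Fin m) : L.charFun (ρ n q) = 0 := by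
  rw [← analyticOrderAt_charFun_ne_zero_iff, ← h.count, Set.encard_ne_zero]
  exact ⟨(n, q), rfl⟩

theorem IsNumbering.exists_eq {ρ : SignedIndex → Fin m → ℂ} (h : L.IsNumbering ω ρ) {z : ℂ}
    (hz : L.charFun z = 0) : ∃ p : SignedIndex × Fin m, ρ p.1 p.2 = z := by
  rw [← analyticOrderAt_charFun_ne_zero_iff, ← h.count, Set.encard_ne_zero] at hz
  exact hz

/-- The eigenvalues, repeated according to their multiplicities, form a family to which the comparison
of zeros applies. -/
theorem exists_isNumbering (hI : L.ConditionI) (hII : L.ConditionII)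
    (hω : ∀ q, ω q ∈ Ico (0 : ℝ) 1) (hW : W ∈ Matrix.unitaryGroup (Fin m) ℂ)
    (hA : L.monodromy = Wᴴ * Matrix.diagonal (fun q => Complex.exp (2 * π * Complex.I * ω q)) * W) :
    ∃ ρ : SignedIndex → Fin m → ℂ, L.IsNumbering ω ρ := by
  -- the abstract multiset of eigenvalues
  let κ : Type := Σ z : ℂ, Fin (analyticOrderNatAt L.charFun z)
  have hv : ∀ z, {p : κ | p.1 = z}.encard = analyticOrderAt L.charFun z := fun z => by
    have h1 : {p : κ | p.1 = z} = range (Sigma.mk z) := by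
      ext ⟨y, i⟩
      constructor
      · rintro rfl; exact ⟨i, rfl⟩
      · rintro ⟨i', h⟩; exact (congrArg Sigma.fst h).symm
    rw [h1, ← Set.image_univ, sigma_mk_injective.encard_image, Set.encard_univ, ENat.card_eq_coe_fintype_card,
      Fintype.card_fin, Nat.cast_analyticOrderNatAt (analyticOrderAt_charFun_ne_top hII z)]
  obtain ⟨e, C, N, hN, has⟩ := (isComparable_charFun hI hII hW hA).exists_numbering
    L.differentiable_charFun hω (fun p : κ => p.1) hv
  refine ⟨fun n q => (e (n, q)).1, fun z => ?_, C, N, hN, fun n hn q => has (n, q) hn⟩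
  have h1 : {p : SignedIndex × Fin m | (e (p.1, p.2)).1 = z} = e ⁻¹' {p : κ | p.1 = z} := rfl
  rw [h1, ← hv z, ← Equiv.image_symm_eq_preimage, e.symm.injective.encard_image]

theorem IsNumbering.infinite (hm : 0 < m) (hII : L.ConditionII) {ρ : SignedIndex → Fin m → ℂ}
    (h : L.IsNumbering ω ρ) : {z | L.charFun z = 0}.Infinite := by
  intro hfin
  have h1 := hfin.preimage' (f := fun p : SignedIndex × Fin m => ρ p.1 p.2) fun z _ => by
    have h2 := h.count z
    have h3 := analyticOrderAt_charFun_ne_top hII z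
    rw [← h2] at h3
    exact Set.encard_ne_top_iff.1 h3
  have h4 : (fun p : SignedIndex × Fin m => ρ p.1 p.2) ⁻¹' {z | L.charFun z = 0} = univ :=
    Set.eq_univ_of_forall fun p => h.charFun_eq_zero p.1 p.2
  rw [h4] at h1
  have : Nonempty (Fin m) := ⟨⟨0, hm⟩⟩
  exact Set.infinite_univ h1

theorem IsNumbering.countable {ρ : SignedIndex → Fin m → ℂ} (h : L.IsNumbering ω ρ) :
    {z | L.charFun z = 0}.Countable :=
  (countable_range fun p : SignedIndex × Fin m => ρ p.1 p.2).mono fun _ hz => h.exists_eq hz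

theorem IsNumbering.exists_real_simple {ρ : SignedIndex → Fin m → ℂ} (h : L.IsNumbering ω ρ)
    (hII : L.ConditionII) (hω : ∀ q, ω q ∈ Ico (0 : ℝ) 1) : ∃ N : ℕ, ∀ n : SignedIndex,
      (N : ℤ) ≤ |n.val| → ∀ q, (ρ n q).im = 0 ∧
        ∀ j k, -1 ≤ meromorphicOrderAt (fun w => L.weylMatrix w j k) (ρ n q) := by
  obtain ⟨R, hR, hsimple⟩ := MatrixPencil.exists_real_simple hII
  obtain ⟨C, N, hN, has⟩ := h.asymptotics
  obtain ⟨N', hN'⟩ := exists_nat_ge (max (R + 2) C)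
  refine ⟨max N N', fun n hn q => ?_⟩
  have hn1 : (N : ℤ) ≤ |n.val| := le_trans (by exact_mod_cast le_max_left _ _) hn
  have hn2 : (N' : ℤ) ≤ |n.val| := le_trans (by exact_mod_cast le_max_right _ _) hn
  have hn3 : max (R + 2) C ≤ |(n.val : ℝ)| := hN'.trans (by exact_mod_cast hn2)
  have hR2 : R + 2 ≤ |(n.val : ℝ)| := (le_max_left _ _).trans hn3
  have hn0 : 0 < |(n.val : ℝ)| := by linarith
  have h1 : ‖ρ n q - ((n.val : ℂ) + (ω q : ℂ))‖ ≤ 1 := (has n hn1 q).trans (by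
    rw [div_le_one hn0]; exact (le_max_right _ _).trans hn3)
  have h2 := (Complex.abs_im_le_norm _).trans h1
  have h3 := (Complex.abs_re_le_norm _).trans h1
  simp only [Complex.sub_im, Complex.add_im, Complex.intCast_im, Complex.ofReal_im, add_zero,
    sub_zero, Complex.sub_re, Complex.add_re, Complex.intCast_re, Complex.ofReal_re] at h2 h3
  refine hsimple _ ?_ h2 (h.charFun_eq_zero n q)
  have h4 : |(n.val : ℝ)| ≤ |(ρ n q).re| + |(ρ n q).re - (n.val + ω q)| + |ω q| := by
    have := abs_add_three (ρ n q).re (-((ρ n q).re - (n.val + ω q))) (-ω q)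
    rw [abs_neg, abs_neg] at this
    refine le_trans (le_of_eq ?_) this
    congr 1; ring
  have h5 : |ω q| ≤ 1 := by rw [abs_of_nonneg (hω q).1]; exact (hω q).2.le
  linarith

/-- Near a remote node, each eigenvalue is counted in the sum over `J_q` as often as its
multiplicity, so that the sum is the sum of the residues near the node. -/
theorem IsNumbering.sum_eq_circleIntegral {ρ : SignedIndex → Fin m → ℂ} (h : L.IsNumbering ω ρ)
    (hII : L.ConditionII) {η : ℝ} (hη : 0 < η) {n : SignedIndex} {q : Fin m}
    (hball : ∀ p : SignedIndex × Fin m,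
      ρ p.1 p.2 ∈ Metric.ball ((n.val : ℂ) + ω q) η ↔ p.1 = n ∧ ω p.2 = ω q)
    (hsphere : ∀ w ∈ Metric.sphere ((n.val : ℂ) + ω q) η, L.charFun w ≠ 0)
    (hsimple : ∀ s j k, -1 ≤ meromorphicOrderAt (fun w => L.weylMatrix w j k) (ρ n s))
    (j k : Fin m) :
    (∑ s with ω s = ω q, ((L.multiplicity (ρ n s) : ℂ)⁻¹) • L.weightMatrix (ρ n s)) j k =
      (2 * π * Complex.I)⁻¹ * ∮ w in C((n.val : ℂ) + ω q, η), L.weylMatrix w j k := by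
  set F : Finset (Fin m) := Finset.univ.filter fun s => ω s = ω q with hF
  set Z : Finset ℂ := F.image (ρ n) with hZ
  have hmem : ∀ z ∈ Z, ∃ s, ω s = ω q ∧ ρ n s = z := fun z hz => by
    obtain ⟨s, hs, rfl⟩ := Finset.mem_image.1 hz
    exact ⟨s, (Finset.mem_filter.1 hs).2, rfl⟩
  have hZball : ∀ z ∈ Z, z ∈ Metric.ball ((n.val : ℂ) + ω q) η := fun z hz => by
    obtain ⟨s, hs, rfl⟩ := hmem z hz
    exact (hball (n, s)).2 ⟨rfl, hs⟩
  have hcard : ∀ z ∈ Z, ((F.filter fun s => ρ n s = z).card : ℂ) = L.multiplicity z := by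
    intro z hz
    have h1 : {p : SignedIndex × Fin m | ρ p.1 p.2 = z} =
        Prod.mk n '' ((F.filter fun s => ρ n s = z : Finset (Fin m)) : Set (Fin m)) := by
      ext ⟨n', s⟩
      simp only [mem_ofPred_eq, Finset.coe_filter, mem_image, Prod.mk.injEq, hF, Finset.mem_filter,
        Finset.mem_univ, true_and]
      constructor
      · intro hp
        have h2 := (hball (n', s)).1 (by rw [hp]; exact hZball z hz)
        obtain ⟨h3, h4⟩ := h2
        simp only at h3 h4
        subst h3
        exact ⟨s, ⟨h4, hp⟩, rfl, rfl⟩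
      · rintro ⟨s', ⟨-, hp⟩, rfl, rfl⟩
        exact hp
    have h2 := h.count z
    rw [h1, (Prod.mk_right_injective n).encard_image, Set.encard_coe_eq_coe_finsetCard] at h2
    rw [multiplicity, analyticOrderNatAt, ← h2, ENat.toNat_natCast]
  have hsum : (∑ s ∈ F, ((L.multiplicity (ρ n s) : ℂ)⁻¹) • L.weightMatrix (ρ n s)) j k =
      ∑ z ∈ Z, L.weightMatrix z j k := by
    rw [Matrix.sum_apply, ← Finset.sum_fiberwise_of_maps_to (g := ρ n) (t := Z)
      fun s hs => Finset.mem_image_of_mem _ hs]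
    refine Finset.sum_congr rfl fun z hz => ?_
    have h0 : (L.multiplicity z : ℂ) ≠ 0 := by
      rw [← hcard z hz]
      obtain ⟨s, hs, hsz⟩ := Finset.mem_image.1 hz
      exact Nat.cast_ne_zero.2 (Finset.card_ne_zero_of_mem (Finset.mem_filter.2 ⟨hs, hsz⟩))
    rw [Finset.sum_congr rfl (g := fun _ => (L.multiplicity z : ℂ)⁻¹ * L.weightMatrix z j k)
      fun s hs => by rw [(Finset.mem_filter.1 hs).2, Matrix.smul_apply, smul_eq_mul],
      Finset.sum_const, nsmul_eq_mul, hcard z hz, mul_inv_cancel_left₀ h0]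
  rw [hsum, circleIntegral_of_simple_poles Z hη (fun z => L.weightMatrix z j k) hZball ?_ ?_,
    inv_mul_cancel_left₀ Complex.two_pi_I_ne_zero]
  · intro w hw hwZ
    refine L.differentiableAt_weylMatrix (fun h0 => hwZ ?_) j k
    have hwb : w ∈ Metric.ball ((n.val : ℂ) + ω q) η := by
      rw [← Metric.sphere_union_ball] at hw
      exact hw.resolve_left fun hw' => hsphere w hw' h0
    obtain ⟨p, rfl⟩ := h.exists_eq h0
    obtain ⟨h1, h2⟩ := (hball p).1 hwb
    rw [h1]
    exact Finset.mem_image_of_mem _ (Finset.mem_filter.2 ⟨Finset.mem_univ _, h2⟩)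
  · intro z hz
    obtain ⟨s, -, rfl⟩ := hmem z hz
    exact tendsto_sub_mul_weylMatrix hII (hsimple s) j k

end MatrixPencil

end

theorem theorem1 {m : ℕ} (hm : 0 < m) (L : MatrixPencil m)
    (hI : L.ConditionI) (hII : L.ConditionII) :
    -- the eigenvalues form a countable infinite set
    {z : ℂ | L.IsEigenvalue z}.Countable ∧ {z : ℂ | L.IsEigenvalue z}.Infinite ∧
    -- they are the zeros of the entire characteristic function
    Differentiable ℂ L.charFun ∧ (∀ z, L.IsEigenvalue z ↔ L.charFun z = 0) ∧
    -- the Weyl matrix is meromorphic and its poles are the eigenvalues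
    (∀ z j k, MeromorphicAt (fun w => L.weylMatrix w j k) z) ∧
    (∀ z, HasMatrixPole L.weylMatrix z ↔ L.IsEigenvalue z) ∧
    ∃ (ω : Fin m → ℝ) (W : Matrix (Fin m) (Fin m) ℂ),
      (∀ q, ω q ∈ Set.Ico (0 : ℝ) 1) ∧
      W ∈ Matrix.unitaryGroup (Fin m) ℂ ∧
      L.monodromy =
        Wᴴ * Matrix.diagonal (fun q => Complex.exp (2 * Real.pi * Complex.I * ω q)) * W ∧
      -- (i) the eigenvalues can be numbered so as to satisfy the asymptotics
      (∃ ρ : SignedIndex → Fin m → ℂ, L.IsNumbering ω ρ) ∧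
      ∀ ρ : SignedIndex → Fin m → ℂ, L.IsNumbering ω ρ →
        ∃ N : ℕ, 1 ≤ N ∧
          (∀ n : SignedIndex, (N : ℤ) ≤ |n.val| → ∀ q,
            -- (ii) reality
            (ρ n q).im = 0 ∧
            -- (iii) simple poles
            HasSimpleMatrixPole L.weylMatrix (ρ n q) ∧
            -- (iv) ranks of the weight matrices
            (L.weightMatrix (ρ n q)).rank = L.multiplicity (ρ n q)) ∧
          -- (iv) asymptotics of the weight matrices
          ∃ C : ℝ, ∀ n : SignedIndex, (N : ℤ) ≤ |n.val| → ∀ q j k,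
            ‖((∑ s with ω s = ω q,
                  ((L.multiplicity (ρ n s) : ℂ)⁻¹) • L.weightMatrix (ρ n s)) -
                ((Real.pi * (n.val : ℂ))⁻¹) •
                  ((1 - L.h₁)⁻¹ * Wᴴ * groupProjection ω q * W * (1 + L.h₁)⁻¹)) j k‖
              ≤ C / (n.val : ℝ) ^ 2 := by
  obtain ⟨ω, W, hω, hW, hA⟩ := exists_unitary_diagonalization
    (Matrix.mem_unitaryGroup_iff'.1 (MatrixPencil.monodromy_mem_unitaryGroup hI hII))
  obtain ⟨ρ₀, hρ₀⟩ := MatrixPencil.exists_isNumbering hI hII hω hW hA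
  have heig : {z : ℂ | L.IsEigenvalue z} = {z | L.charFun z = 0} :=
    Set.ext fun z => L.isEigenvalue_iff z
  refine ⟨heig ▸ hρ₀.countable, heig ▸ hρ₀.infinite hm hII, L.differentiable_charFun,
    L.isEigenvalue_iff, MatrixPencil.meromorphicAt_weylMatrix hII, fun z => ?_, ω, W, hω, hW, hA,
    ⟨ρ₀, hρ₀⟩, fun ρ hρ => ?_⟩
  · rw [L.isEigenvalue_iff, MatrixPencil.hasMatrixPole_weylMatrix_iff hII]
  obtain ⟨η, hη, hη8, hgap, -⟩ := exists_gap ω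
  obtain ⟨N₁, hN₁⟩ := hρ.exists_real_simple hII hω
  obtain ⟨C, N₂, hN₂, hcirc⟩ :=
    MatrixPencil.exists_circleIntegral_weylMatrix hI hII hω hW hA hη hη8 hgap
  obtain ⟨N₃, hN₃, hball⟩ := (MatrixPencil.isComparable_charFun hI hII hW hA).mem_ball_iff
    L.differentiable_charFun hω hη hη8 hgap ρ hρ.count hρ.asymptotics
  refine ⟨max N₁ (max N₂ N₃), hN₂.trans ((le_max_left _ _).trans (le_max_right _ _)),
    fun n hn q => ?_, C, fun n hn q j k => ?_⟩
  · have hn₁ : (N₁ : ℤ) ≤ |n.val| := le_trans (by exact_mod_cast le_max_left _ _) hn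
    obtain ⟨h1, h2⟩ := hN₁ n hn₁ q
    exact ⟨h1, ⟨(MatrixPencil.hasMatrixPole_weylMatrix_iff hII _).2 (hρ.charFun_eq_zero n q), h2⟩,
      MatrixPencil.rank_weightMatrix hII h2⟩
  · have hn₁ : (N₁ : ℤ) ≤ |n.val| := le_trans (by exact_mod_cast le_max_left _ _) hn
    have hn₂ : (N₂ : ℤ) ≤ |n.val| :=
      le_trans (by exact_mod_cast (le_max_left _ _).trans (le_max_right _ _)) hn
    have hn₃ : (N₃ : ℤ) ≤ |n.val| :=
      le_trans (by exact_mod_cast (le_max_right _ _).trans (le_max_right _ _)) hn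
    obtain ⟨hsphere, hint⟩ := hcirc n.val hn₂ q
    rw [Matrix.sub_apply, hρ.sum_eq_circleIntegral hII hη (hball n hn₃ q) hsphere
      (fun s => (hN₁ n hn₁ s).2) j k]
    exact hint j k
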